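/- **Setting (LFR, canonical LF with refinement sorts).** Let $a$, $c$, $s$ range over type, term and sort constants. The syntax, taken up to renaming of bound variables, is $$R ::= c\mid x\mid R\,N,\qquad N ::= R\mid \lambda x.N,\qquad P ::= a\mid P\,N,\qquad A,B ::= P\mid \Pi x{:}A.\,B,\qquad K ::= \mathsf{type}\mid \Pi x{:}A.\,K,$$ $$Q ::= s\mid Q\,N,\qquad S,T ::= Q\mid \Pi x{::}S{\sqsubset}A.\,T\mid \top\mid S_1\wedge S_2,\qquad L ::= \mathsf{sort}\mid \Pi x{::}S{\sqsubset}A.\,L\mid \top\mid L_1\wedge L_2 .$$ A signature $\Sigma$ is a list of declarations $a{:}K$, $c{:}A$, $s\sqsubset a::L$, $s_1\le s_2$, $c::S$. A context $\Gamma$ is a list of declarations $x::S\sqsubset A$ with distinct variables, and $\Gamma^*$ is the LF context obtained by replacing each $x::S\sqsubset A$ by $x{:}A$. A type erases to a simple type by $|a\,N_1\cdots N_k|=a$ and $|\Pi x{:}A.B|=|A|\to|B|$. The $\eta$-expansion is $\eta_a(R)=R$ and $\eta_{\alpha\to\beta}(R)=\lambda x.\,\eta_\beta(R\;\eta_\alpha(x))$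 with $x$ fresh, and $\eta_A:=\eta_{|A|}$. *Hereditary substitution* $[N_0/x_0]_{\alpha}$ (with $[N_0/x_0]_A:=[N_0/x_0]_{|A|}$) is the partial, capture-avoiding operation defined compositionally on all syntactic categories and on contexts, except on atomic terms with head $x_0$. On these it is defined through an auxiliary operation $[N_0/x_0]^{rn}_\alpha$ with values (normal term, simple type), given by $[N_0/x_0]^{rn}_{\alpha}x_0=(N_0,\alpha)$ and, if $[N_0/x_0]^{rn}_\alpha R_1=(\lambda x.N_1,\alpha_2\to\alpha_1)$, by $[N_0/x_0]^{rn}_\alpha(R_1\,N_2)=([N_2'/x]_{\alpha_2}N_1,\ \alpha_1)$ where $N_2'=[N_0/x_0]_\alpha N_2$. The value of $[N_0/x_0]_\alpha R$ is then $R'$ if $[N_0/x_0]^{rn}_\alpha R=(R',a)$ with $R'$ atomic and $a$ a base type. *Types.* The LF judgments $\Gamma^*\vdash R\Rightarrow A$, $\Gamma^*\vdash N\Leftarrow A$, $\Gamma^*\vdash P\Rightarrow K$, $\Gamma^*\vdash A:\mathsf{type}$ and $\vdash K:\mathsf{kind}$ are those of canonical-forms LF: variables and constants synthesize their declared types; if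 $R\Rightarrow\Pi x{:}A.B$ and $N\Leftarrow A$ then $R\,N\Rightarrow[N/x]_AB$; $R\Leftarrow P$ if $R\Rightarrow P$; $\lambda x.N\Leftarrow\Pi x{:}A.B$ if $N\Leftarrow B$ under $x{:}A$; and analogously for kinds. *Sorts.* $Q\le Q'$ is the reflexive-transitive closure of $s_1N_1\cdots N_k\le s_2N_1\cdots N_k$ for $s_1\le s_2\in\Sigma$. Synthesis $\Gamma\vdash R\Rightarrow S$: a variable or constant synthesizes its declared sort; if $R\Rightarrow\Pi x{::}S{\sqsubset}A.T$ and $N\Leftarrow S$ then $R\,N\Rightarrow[N/x]_AT$; if $R\Rightarrow S_1\wedge S_2$ then $R\Rightarrow S_1$ and $R\Rightarrow S_2$. Checking $\Gamma\vdash N\Leftarrow S$: $R\Leftarrow Q$ if $R\Rightarrow Q'$ and $Q'\le Q$; $\lambda x.N\Leftarrow\Pi x{::}S{\sqsubset}A.T$ if $\Gamma,x{::}S{\sqsubset}A\vdash N\Leftarrow T$; $N\Leftarrow\top$ always; $N\Leftarrow S_1\wedge S_2$ if $N\Leftarrow S_1$ and $N\Leftarrow S_2$. *Refinement.* $\Gamma\vdash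 Q\sqsubset P\Rightarrow L$: $s\sqsubset a\Rightarrow L$ if $s\sqsubset a::L\in\Sigma$; $Q\,N\sqsubset P\,N\Rightarrow[N/x]_AL$ if $Q\sqsubset P\Rightarrow\Pi x{::}S{\sqsubset}A.L$ and $N\Leftarrow S$; and $Q\sqsubset P\Rightarrow L_i$ if $Q\sqsubset P\Rightarrow L_1\wedge L_2$. $\Gamma\vdash S\sqsubset A$: $Q\sqsubset P$ if $Q\sqsubset P\Rightarrow\mathsf{sort}$; $\Pi x{::}S{\sqsubset}A.T\sqsubset\Pi x{:}A.B$ if $S\sqsubset A$ and $\Gamma,x{::}S{\sqsubset}A\vdash T\sqsubset B$; $\top\sqsubset A$ always; $S_1\wedge S_2\sqsubset A$ if $S_1\sqsubset A$ and $S_2\sqsubset A$. The relation $\Gamma\vdash L\sqsubset K$ is analogous, with $\mathsf{sort}\sqsubset\mathsf{type}$. *Well-formedness.* $\Sigma$ is well-formed if every declaration is well-formed over the preceding ones: $K$ is a kind for $a{:}K$; $A$ is a type for $c{:}A$; $L\sqsubset K$ with $a{:}K$ declared for $s\sqsubset a::L$; $S\sqsubset A$ with $c{:}A$ declared for $c::S$;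 $s_1,s_2$ declared with the same $a$ and $L$ for $s_1\le s_2$; and no constant gets two declarations of the same form $a{:}K$, $c{:}A$, $s\sqsubset a::L$ or $c::S$. $\Gamma$ is well-formed if every $x::S\sqsubset A$ in it satisfies $S\sqsubset A$ and $A:\mathsf{type}$ over the preceding part. *Convention (refinement restriction).* Below, $\Gamma\vdash S\sqsubset A$ includes $\Gamma^*\vdash A:\mathsf{type}$, all contexts are well-formed, and a sorting judgment is only asserted for a term that has a type which the sort refines: $\Gamma\vdash N\Leftarrow S$ includes $\Gamma\vdash S\sqsubset B$ and $\Gamma^*\vdash N\Leftarrow B$ for a type $B$ (and likewise for $\Gamma\vdash R\Rightarrow S$). For $S=S_1$ or $S_2$ in (1)–(3), and for the term $N_1$ in (5), the type is the given $A$. In (4) the type $B$ is the same in hypothesis and conclusion; in (5) the type of the conclusion is $[N_1/x]_AB$. In (1)–(3) the context $\Gamma$, and in (4)–(5) the context $\Gamma_L$, ranges over the well-formed contexts in which both $S_1\sqsubset A$ and $S_2\sqsubset A$ hold. The declared variable $x$ is arbitrary subject to being distinct from the other declared variables. **Theorem (Alternate Formulations of Subsorting).** Fix a well-formed signature $\Sigma$.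 Suppose that for some well-formed $\Gamma_0$, $\Gamma_0\vdash S_1\sqsubset A$ and $\Gamma_0\vdash S_2\sqsubset A$. Then the following are equivalent. 1. For all $\Gamma$ and $R$: if $\Gamma\vdash R\Rightarrow S_1$, then $\Gamma\vdash\eta_A(R)\Leftarrow S_2$. 2. For all $\Gamma$: $\Gamma,x::S_1\sqsubset A\vdash\eta_A(x)\Leftarrow S_2$. 3. For all $\Gamma$ and $N$: if $\Gamma\vdash N\Leftarrow S_1$, then $\Gamma\vdash N\Leftarrow S_2$. 4. For all $\Gamma_L,\Gamma_R,N,S$: if $\Gamma_L,x::S_2\sqsubset A,\Gamma_R\vdash N\Leftarrow S$, then $\Gamma_L,x::S_1\sqsubset A,\Gamma_R\vdash N\Leftarrow S$. 5. For all $\Gamma_L,\Gamma_R,N,S,N_1$: if $\Gamma_L,x::S_2\sqsubset A,\Gamma_R\vdash N\Leftarrow S$ and $\Gamma_L\vdash N_1\Leftarrow S_1$, then the hereditary substitutions $[N_1/x]_A$ into $\Gamma_R$, $N$ and $S$ are defined and $\Gamma_L,[N_1/x]_A\Gamma_R\vdash[N_1/x]_AN\Leftarrow[N_1/x]_AS$.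 -/

import Mathlib

namespace LFR

/-! # The logical framework LFR (LF with refinements), canonical forms presentation

Syntax is locally nameless: free variables carry names, bound variables are de Bruijn indices, so
that α-equivalence is equality.  Binder rules quantify over all names outside a finite set, which
is the usual "for a sufficiently fresh variable".  Contexts and signatures are lists whose head is
the most recent declaration. -/

/-- Names of free variables. -/
abbrev Var := ℕ
/-- Type family constants `a`. -/
abbrev TyCon := ℕ
/-- Term constants `c`. -/
abbrev TmCon := ℕ
/-- Sort family constants `s`. -/
abbrev SrtCon := ℕ

/-! ## Grammar -/

mutual
/-- Atomic terms `R ::= c | x | R N`. -/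
inductive Atm : Type
  | con (c : TmCon) : Atm
  | fvar (x : Var) : Atm
  | bvar (i : ℕ) : Atm
  | app (R : Atm) (N : Nrm) : Atm
/-- Normal terms `N ::= R | λx.N`. -/
inductive Nrm : Type
  | atm (R : Atm) : Nrm
  | lam (N : Nrm) : Nrm
end

/-- Atomic type families `P ::= a | P N`. -/
inductive ATy : Type
  | con (a : TyCon) : ATy
  | app (P : ATy) (N : Nrm) : ATy

/-- Normal type families `A ::= P | Πx:A.B`. -/
inductive Ty : Type
  | atm (P : ATy) : Ty
  | pi (A B : Ty) : Ty

/-- Atomic sort families `Q ::= s | Q N`. -/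
inductive ASrt : Type
  | con (s : SrtCon) : ASrt
  | app (Q : ASrt) (N : Nrm) : ASrt

/-- Normal sort families `S ::= Q | Πx::S⊏A.T | ⊤ | S₁ ∧ S₂`. -/
inductive Srt : Type
  | atm (Q : ASrt) : Srt
  | pi (S : Srt) (A : Ty) (T : Srt) : Srt
  | top : Srt
  | inter (S₁ S₂ : Srt) : Srt

/-- Kinds `K ::= type | Πx:A.K`. -/
inductive Knd : Type
  | type : Knd
  | pi (A : Ty) (K : Knd) : Knd

/-- Classes `L ::= sort | Πx::S⊏A.L | ⊤ | L₁ ∧ L₂`. -/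
inductive Cls : Type
  | sort : Cls
  | pi (S : Srt) (A : Ty) (L : Cls) : Cls
  | top : Cls
  | inter (L₁ L₂ : Cls) : Cls

/-- Simple types `α ::= a | α₁ → α₂`. -/
inductive STy : Type
  | base (a : TyCon) : STy
  | arr (α β : STy) : STy

/-- Signature declarations `a:K`, `c:A`, `s⊏a::L`, `s₁≤s₂`, `c::S`. -/
inductive Decl : Type
  | tyKind (a : TyCon) (K : Knd) : Decl
  | tmType (c : TmCon) (A : Ty) : Decl
  | srtRef (s : SrtCon) (a : TyCon) (L : Cls) : Decl
  | subsort (s₁ s₂ : SrtCon) : Decl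
  | tmSort (c : TmCon) (S : Srt) : Decl

/-- Signatures. -/
abbrev Sig := List Decl

/-- LFR contexts, with declarations `x::S⊏A`. -/
abbrev Ctx := List (Var × Srt × Ty)

/-- LF contexts, with declarations `x:A`. -/
abbrev LFCtx := List (Var × Ty)

/-- The erasure `Γ*` of an LFR context to an LF context. -/
def Ctx.erase (Γ : Ctx) : LFCtx := Γ.map fun d => (d.1, d.2.2)

/-- The names declared in a context. -/
def Ctx.dom (Γ : Ctx) : List Var := Γ.map fun d => d.1

/-! ## Opening a binder with a named variable -/

mutual
/-- Replace the bound variable with index `k` by the free variable `x`. -/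
def Atm.opn (k : ℕ) (x : Var) : Atm → Atm
  | .con c => .con c
  | .fvar y => .fvar y
  | .bvar i => if i = k then .fvar x else .bvar i
  | .app R N => .app (R.opn k x) (N.opn k x)
/-- Replace the bound variable with index `k` by the free variable `x`. -/
def Nrm.opn (k : ℕ) (x : Var) : Nrm → Nrm
  | .atm R => .atm (R.opn k x)
  | .lam N => .lam (N.opn (k + 1) x)
end

def ATy.opn (k : ℕ) (x : Var) : ATy → ATy
  | .con a => .con a
  | .app P N => .app (P.opn k x) (N.opn k x)

def Ty.opn (k : ℕ) (x : Var) : Ty → Ty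
  | .atm P => .atm (P.opn k x)
  | .pi A B => .pi (A.opn k x) (B.opn (k + 1) x)

def ASrt.opn (k : ℕ) (x : Var) : ASrt → ASrt
  | .con s => .con s
  | .app Q N => .app (Q.opn k x) (N.opn k x)

def Srt.opn (k : ℕ) (x : Var) : Srt → Srt
  | .atm Q => .atm (Q.opn k x)
  | .pi S A T => .pi (S.opn k x) (A.opn k x) (T.opn (k + 1) x)
  | .top => .top
  | .inter S₁ S₂ => .inter (S₁.opn k x) (S₂.opn k x)

def Knd.opn (k : ℕ) (x : Var) : Knd → Knd
  | .type => .type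
  | .pi A K => .pi (A.opn k x) (K.opn (k + 1) x)

def Cls.opn (k : ℕ) (x : Var) : Cls → Cls
  | .sort => .sort
  | .pi S A L => .pi (S.opn k x) (A.opn k x) (L.opn (k + 1) x)
  | .top => .top
  | .inter L₁ L₂ => .inter (L₁.opn k x) (L₂.opn k x)

/-! ## Erasure to simple types and η-expansion -/

/-- `|P|` is the head constant of `P`. -/
def ATy.simple : ATy → STy
  | .con a => .base a
  | .app P _ => P.simple

/-- `|Πx:A.B| = |A| → |B|`. -/
def Ty.simple : Ty → STy
  | .atm P => P.simple
  | .pi A B => .arr A.simple B.simple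

mutual
/-- Increment the bound variables with index at least `k`; the identity on terms without
dangling indices. -/
def Atm.shift (k : ℕ) : Atm → Atm
  | .con c => .con c
  | .fvar y => .fvar y
  | .bvar i => if i < k then .bvar i else .bvar (i + 1)
  | .app R N => .app (R.shift k) (N.shift k)
/-- Increment the bound variables with index at least `k`. -/
def Nrm.shift (k : ℕ) : Nrm → Nrm
  | .atm R => .atm (R.shift k)
  | .lam N => .lam (N.shift (k + 1))
end

/-- η-expansion: `η_a(R) = R` and `η_{α→β}(R) = λx. η_β(R η_α(x))`. -/
def expand : STy → Atm → Nrm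
  | .base _, R => .atm R
  | .arr α β, R => .lam (expand β (.app (R.shift 0) (expand α (.bvar 0))))

/-! ## Hereditary substitution

A partial operation `[N₀/x₀]_{α₀}`, given as a relation between input and output. -/

mutual
/-- `[N₀/x₀]ⁿ_{α₀} N = Nr`. -/
inductive SubstN : Nrm → Var → STy → Nrm → Nrm → Prop
  | atom {N₀ x₀ α₀ R Rr} :
      SubstRR N₀ x₀ α₀ R Rr → SubstN N₀ x₀ α₀ (.atm R) (.atm Rr)
  | atomNorm {N₀ x₀ α₀ R Rr a} :
      SubstRN N₀ x₀ α₀ R (.atm Rr) (.base a) → SubstN N₀ x₀ α₀ (.atm R) (.atm Rr)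
  | lam {N₀ x₀ α₀ N Nr} (F : Finset Var) :
      (∀ y, y ∉ F → SubstN N₀ x₀ α₀ (N.opn 0 y) (Nr.opn 0 y)) →
      SubstN N₀ x₀ α₀ (.lam N) (.lam Nr)
/-- `[N₀/x₀]^{rr}_{α₀} R = Rr`. -/
inductive SubstRR : Nrm → Var → STy → Atm → Atm → Prop
  | var {N₀ x₀ α₀ x} : x ≠ x₀ → SubstRR N₀ x₀ α₀ (.fvar x) (.fvar x)
  | con {N₀ x₀ α₀ c} : SubstRR N₀ x₀ α₀ (.con c) (.con c)
  | app {N₀ x₀ α₀ R Rr N Nr} :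
      SubstRR N₀ x₀ α₀ R Rr → SubstN N₀ x₀ α₀ N Nr →
      SubstRR N₀ x₀ α₀ (.app R N) (.app Rr Nr)
/-- `[N₀/x₀]^{rn}_{α₀} R = (Nr, αr)`. -/
inductive SubstRN : Nrm → Var → STy → Atm → Nrm → STy → Prop
  | var {N₀ x₀ α₀} : SubstRN N₀ x₀ α₀ (.fvar x₀) N₀ α₀
  | beta {N₀ x₀ α₀ R₁ N₂ N₁ N₂' N₁' α₁ α₂} (F : Finset Var) :
      SubstRN N₀ x₀ α₀ R₁ (.lam N₁) (.arr α₂ α₁) →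
      SubstN N₀ x₀ α₀ N₂ N₂' →
      (∀ x, x ∉ F → SubstN N₂' x α₂ (N₁.opn 0 x) N₁') →
      SubstRN N₀ x₀ α₀ (.app R₁ N₂) N₁' α₁
end

/-- Substitution into atomic types. -/
inductive SubstP (N₀ : Nrm) (x₀ : Var) (α₀ : STy) : ATy → ATy → Prop
  | con {a} : SubstP N₀ x₀ α₀ (.con a) (.con a)
  | app {P Pr N Nr} : SubstP N₀ x₀ α₀ P Pr → SubstN N₀ x₀ α₀ N Nr →
      SubstP N₀ x₀ α₀ (.app P N) (.app Pr Nr)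

/-- Substitution into normal types. -/
inductive SubstA (N₀ : Nrm) (x₀ : Var) (α₀ : STy) : Ty → Ty → Prop
  | atm {P Pr} : SubstP N₀ x₀ α₀ P Pr → SubstA N₀ x₀ α₀ (.atm P) (.atm Pr)
  | pi {A Ar B Br} (F : Finset Var) : SubstA N₀ x₀ α₀ A Ar →
      (∀ y, y ∉ F → SubstA N₀ x₀ α₀ (B.opn 0 y) (Br.opn 0 y)) →
      SubstA N₀ x₀ α₀ (.pi A B) (.pi Ar Br)

/-- Substitution into atomic sorts. -/
inductive SubstQ (N₀ : Nrm) (x₀ : Var) (α₀ : STy) : ASrt → ASrt → Prop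
  | con {s} : SubstQ N₀ x₀ α₀ (.con s) (.con s)
  | app {Q Qr N Nr} : SubstQ N₀ x₀ α₀ Q Qr → SubstN N₀ x₀ α₀ N Nr →
      SubstQ N₀ x₀ α₀ (.app Q N) (.app Qr Nr)

/-- Substitution into normal sorts. -/
inductive SubstS (N₀ : Nrm) (x₀ : Var) (α₀ : STy) : Srt → Srt → Prop
  | atm {Q Qr} : SubstQ N₀ x₀ α₀ Q Qr → SubstS N₀ x₀ α₀ (.atm Q) (.atm Qr)
  | pi {S Sr A Ar T Tr} (F : Finset Var) :
      SubstS N₀ x₀ α₀ S Sr → SubstA N₀ x₀ α₀ A Ar →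
      (∀ y, y ∉ F → SubstS N₀ x₀ α₀ (T.opn 0 y) (Tr.opn 0 y)) →
      SubstS N₀ x₀ α₀ (.pi S A T) (.pi Sr Ar Tr)
  | top : SubstS N₀ x₀ α₀ .top .top
  | inter {S₁ S₁' S₂ S₂'} : SubstS N₀ x₀ α₀ S₁ S₁' → SubstS N₀ x₀ α₀ S₂ S₂' →
      SubstS N₀ x₀ α₀ (.inter S₁ S₂) (.inter S₁' S₂')

/-- Substitution into kinds. -/
inductive SubstK (N₀ : Nrm) (x₀ : Var) (α₀ : STy) : Knd → Knd → Prop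
  | type : SubstK N₀ x₀ α₀ .type .type
  | pi {A Ar K Kr} (F : Finset Var) : SubstA N₀ x₀ α₀ A Ar →
      (∀ y, y ∉ F → SubstK N₀ x₀ α₀ (K.opn 0 y) (Kr.opn 0 y)) →
      SubstK N₀ x₀ α₀ (.pi A K) (.pi Ar Kr)

/-- Substitution into classes. -/
inductive SubstL (N₀ : Nrm) (x₀ : Var) (α₀ : STy) : Cls → Cls → Prop
  | sort : SubstL N₀ x₀ α₀ .sort .sort
  | pi {S Sr A Ar L Lr} (F : Finset Var) :
      SubstS N₀ x₀ α₀ S Sr → SubstA N₀ x₀ α₀ A Ar →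
      (∀ y, y ∉ F → SubstL N₀ x₀ α₀ (L.opn 0 y) (Lr.opn 0 y)) →
      SubstL N₀ x₀ α₀ (.pi S A L) (.pi Sr Ar Lr)
  | top : SubstL N₀ x₀ α₀ .top .top
  | inter {L₁ L₁' L₂ L₂'} : SubstL N₀ x₀ α₀ L₁ L₁' → SubstL N₀ x₀ α₀ L₂ L₂' →
      SubstL N₀ x₀ α₀ (.inter L₁ L₂) (.inter L₁' L₂')

/-- Substitution into contexts. -/
inductive SubstCtx (N₀ : Nrm) (x₀ : Var) (α₀ : STy) : Ctx → Ctx → Prop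
  | nil : SubstCtx N₀ x₀ α₀ [] []
  | cons {Γ Γr y S Sr A Ar} : SubstCtx N₀ x₀ α₀ Γ Γr →
      SubstS N₀ x₀ α₀ S Sr → SubstA N₀ x₀ α₀ A Ar →
      SubstCtx N₀ x₀ α₀ ((y, S, A) :: Γ) ((y, Sr, Ar) :: Γr)

/-! ## Canonical LF

These judgments consult only the declarations `a:K` and `c:A` of the signature, that is, the
erasure of the signature to an LF signature. -/

mutual
/-- `Γ ⊢ R ⇒ A`: the atomic term `R` synthesizes the type `A`. -/
inductive SynthTy (Sg : Sig) : LFCtx → Atm → Ty → Prop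
  | con {Γ c A} : Decl.tmType c A ∈ Sg → SynthTy Sg Γ (.con c) A
  | var {Γ x A} : (x, A) ∈ Γ → SynthTy Sg Γ (.fvar x) A
  | app {Γ R N A B Br} (F : Finset Var) :
      SynthTy Sg Γ R (.pi A B) → CheckTy Sg Γ N A →
      (∀ x, x ∉ F → SubstA N x A.simple (B.opn 0 x) Br) →
      SynthTy Sg Γ (.app R N) Br
/-- `Γ ⊢ N ⇐ A`: the normal term `N` checks against the type `A`. -/
inductive CheckTy (Sg : Sig) : LFCtx → Nrm → Ty → Prop
  | atm {Γ R P} : SynthTy Sg Γ R (.atm P) → CheckTy Sg Γ (.atm R) (.atm P)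
  | lam {Γ N A B} (F : Finset Var) :
      (∀ x, x ∉ F → CheckTy Sg ((x, A) :: Γ) (N.opn 0 x) (B.opn 0 x)) →
      CheckTy Sg Γ (.lam N) (.pi A B)
end

/-- `Γ ⊢ P ⇒ K`: the atomic type family `P` synthesizes the kind `K`. -/
inductive SynthKnd (Sg : Sig) (Γ : LFCtx) : ATy → Knd → Prop
  | con {a K} : Decl.tyKind a K ∈ Sg → SynthKnd Sg Γ (.con a) K
  | app {P N A K Kr} (F : Finset Var) :
      SynthKnd Sg Γ P (.pi A K) → CheckTy Sg Γ N A →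
      (∀ x, x ∉ F → SubstK N x A.simple (K.opn 0 x) Kr) →
      SynthKnd Sg Γ (.app P N) Kr

/-- `Γ ⊢ A : type`. -/
inductive IsType (Sg : Sig) : LFCtx → Ty → Prop
  | atm {Γ P} : SynthKnd Sg Γ P .type → IsType Sg Γ (.atm P)
  | pi {Γ A B} (F : Finset Var) : IsType Sg Γ A →
      (∀ x, x ∉ F → IsType Sg ((x, A) :: Γ) (B.opn 0 x)) →
      IsType Sg Γ (.pi A B)

/-- `Γ ⊢ K : kind`. -/
inductive IsKnd (Sg : Sig) : LFCtx → Knd → Prop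
  | type {Γ} : IsKnd Sg Γ .type
  | pi {Γ A K} (F : Finset Var) : IsType Sg Γ A →
      (∀ x, x ∉ F → IsKnd Sg ((x, A) :: Γ) (K.opn 0 x)) →
      IsKnd Sg Γ (.pi A K)

/-! ## Sorting -/

/-- A declared subsorting `s₁ ≤ s₂` applied to a common spine of arguments. -/
inductive SubDecl (Sg : Sig) : ASrt → ASrt → Prop
  | con {s₁ s₂} : Decl.subsort s₁ s₂ ∈ Sg → SubDecl Sg (.con s₁) (.con s₂)
  | app {Q₁ Q₂ N} : SubDecl Sg Q₁ Q₂ → SubDecl Sg (.app Q₁ N) (.app Q₂ N)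

/-- Subsorting `Q₁ ≤ Q₂` at atomic sorts. -/
inductive Subsort (Sg : Sig) : ASrt → ASrt → Prop
  | refl {Q} : Subsort Sg Q Q
  | step {Q₁ Qr Q₂} : SubDecl Sg Q₁ Qr → Subsort Sg Qr Q₂ → Subsort Sg Q₁ Q₂

mutual
/-- `Γ ⊢ R ⇒ S`: the atomic term `R` synthesizes the sort `S`. -/
inductive Synth (Sg : Sig) : Ctx → Atm → Srt → Prop
  | con {Γ c S} : Decl.tmSort c S ∈ Sg → Synth Sg Γ (.con c) S
  | var {Γ x S A} : (x, S, A) ∈ Γ → Synth Sg Γ (.fvar x) S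
  | app {Γ R N S A T Tr} (F : Finset Var) :
      Synth Sg Γ R (.pi S A T) → Check Sg Γ N S →
      (∀ x, x ∉ F → SubstS N x A.simple (T.opn 0 x) Tr) →
      Synth Sg Γ (.app R N) Tr
  | interL {Γ R S₁ S₂} : Synth Sg Γ R (.inter S₁ S₂) → Synth Sg Γ R S₁
  | interR {Γ R S₁ S₂} : Synth Sg Γ R (.inter S₁ S₂) → Synth Sg Γ R S₂
/-- `Γ ⊢ N ⇐ S`: the normal term `N` checks against the sort `S`. -/
inductive Check (Sg : Sig) : Ctx → Nrm → Srt → Prop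
  | switch {Γ R Q Qr} : Synth Sg Γ R (.atm Qr) → Subsort Sg Qr Q →
      Check Sg Γ (.atm R) (.atm Q)
  | lam {Γ N S A T} (F : Finset Var) :
      (∀ x, x ∉ F → Check Sg ((x, S, A) :: Γ) (N.opn 0 x) (T.opn 0 x)) →
      Check Sg Γ (.lam N) (.pi S A T)
  | top {Γ N} : Check Sg Γ N .top
  | inter {Γ N S₁ S₂} : Check Sg Γ N S₁ → Check Sg Γ N S₂ → Check Sg Γ N (.inter S₁ S₂)
end

/-- `Γ ⊢ Q ⊏ P ⇒ L`: the atomic sort `Q` refines `P` and synthesizes the class `L`. -/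
inductive SynthCls (Sg : Sig) (Γ : Ctx) : ASrt → ATy → Cls → Prop
  | con {s a L} : Decl.srtRef s a L ∈ Sg → SynthCls Sg Γ (.con s) (.con a) L
  | app {Q P N S A L Lr} (F : Finset Var) :
      SynthCls Sg Γ Q P (.pi S A L) → Check Sg Γ N S →
      (∀ x, x ∉ F → SubstL N x A.simple (L.opn 0 x) Lr) →
      SynthCls Sg Γ (.app Q N) (.app P N) Lr
  | interL {Q P L₁ L₂} : SynthCls Sg Γ Q P (.inter L₁ L₂) → SynthCls Sg Γ Q P L₁
  | interR {Q P L₁ L₂} : SynthCls Sg Γ Q P (.inter L₁ L₂) → SynthCls Sg Γ Q P L₂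

/-- `Γ ⊢ S ⊏ A`: the sort `S` refines the type `A`. -/
inductive Refines (Sg : Sig) : Ctx → Srt → Ty → Prop
  | atm {Γ Q P} : SynthCls Sg Γ Q P .sort → Refines Sg Γ (.atm Q) (.atm P)
  | pi {Γ S A T B} (F : Finset Var) : Refines Sg Γ S A →
      (∀ x, x ∉ F → Refines Sg ((x, S, A) :: Γ) (T.opn 0 x) (B.opn 0 x)) →
      Refines Sg Γ (.pi S A T) (.pi A B)
  | top {Γ A} : Refines Sg Γ .top A
  | inter {Γ S₁ S₂ A} : Refines Sg Γ S₁ A → Refines Sg Γ S₂ A →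
      Refines Sg Γ (.inter S₁ S₂) A

/-- `Γ ⊢ L ⊏ K`: the class `L` refines the kind `K`. -/
inductive RefinesCls (Sg : Sig) : Ctx → Cls → Knd → Prop
  | sort {Γ} : RefinesCls Sg Γ .sort .type
  | pi {Γ S A L K} (F : Finset Var) : Refines Sg Γ S A →
      (∀ x, x ∉ F → RefinesCls Sg ((x, S, A) :: Γ) (L.opn 0 x) (K.opn 0 x)) →
      RefinesCls Sg Γ (.pi S A L) (.pi A K)
  | top {Γ K} : RefinesCls Sg Γ .top K
  | inter {Γ L₁ L₂ K} : RefinesCls Sg Γ L₁ K → RefinesCls Sg Γ L₂ K →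
      RefinesCls Sg Γ (.inter L₁ L₂) K

/-! ## Well-formed signatures and contexts -/

/-- `⊢ Σ sig`. -/
inductive WfSig : Sig → Prop
  | nil : WfSig []
  | tyKind {Sg a K} : WfSig Sg → IsKnd Sg [] K → (∀ Kr, Decl.tyKind a Kr ∉ Sg) →
      WfSig (.tyKind a K :: Sg)
  | tmType {Sg c A} : WfSig Sg → IsType Sg [] A → (∀ Ar, Decl.tmType c Ar ∉ Sg) →
      WfSig (.tmType c A :: Sg)
  | srtRef {Sg s a L K} : WfSig Sg → Decl.tyKind a K ∈ Sg → RefinesCls Sg [] L K →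
      (∀ a' Lr, Decl.srtRef s a' Lr ∉ Sg) → WfSig (.srtRef s a L :: Sg)
  | tmSort {Sg c S A} : WfSig Sg → Decl.tmType c A ∈ Sg → Refines Sg [] S A →
      (∀ Sr, Decl.tmSort c Sr ∉ Sg) → WfSig (.tmSort c S :: Sg)
  | subsort {Sg s₁ s₂ a L} : WfSig Sg → Decl.srtRef s₁ a L ∈ Sg → Decl.srtRef s₂ a L ∈ Sg →
      WfSig (.subsort s₁ s₂ :: Sg)

/-- A sort `S` refining a well-formed type `A`: `Γ* ⊢ A : type` and `Γ ⊢ S ⊏ A`. -/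
def RefinesTy (Sg : Sig) (Γ : Ctx) (S : Srt) (A : Ty) : Prop :=
  IsType Sg Γ.erase A ∧ Refines Sg Γ S A

/-- `⊢ Γ ctx`: the declared names are distinct and every declared sort refines its type, which is
itself well-formed. -/
inductive WfCtx (Sg : Sig) : Ctx → Prop
  | nil : WfCtx Sg []
  | cons {Γ x S A} : WfCtx Sg Γ → x ∉ Γ.dom → RefinesTy Sg Γ S A → WfCtx Sg ((x, S, A) :: Γ)

/-! ## Judgments under the refinement restriction

A term is sort-checked only in a well-formed context, only if it is already well-typed, and only at
sorts that refine its type. -/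

/-- `Γ ⊢ R ⇒ S` with its presuppositions: `Γ` is well-formed, `S` refines the well-formed type `A`,
and `R` synthesizes `A`. -/
structure SynthAt (Sg : Sig) (Γ : Ctx) (R : Atm) (S : Srt) (A : Ty) : Prop where
  ctx : WfCtx Sg Γ
  refines : RefinesTy Sg Γ S A
  typed : SynthTy Sg Γ.erase R A
  sorted : Synth Sg Γ R S

/-- `Γ ⊢ N ⇐ S` with its presuppositions: `Γ` is well-formed, `S` refines the well-formed type `A`,
and `N` checks against `A`. -/
structure CheckAt (Sg : Sig) (Γ : Ctx) (N : Nrm) (S : Srt) (A : Ty) : Prop where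
  ctx : WfCtx Sg Γ
  refines : RefinesTy Sg Γ S A
  typed : CheckTy Sg Γ.erase N A
  sorted : Check Sg Γ N S

/-! ## Five formulations of subsorting between two refinements of `A`

Contexts range over those in which both sorts refine `A`. -/

/-- `Γ` is well-formed and both `S₁` and `S₂` refine the well-formed type `A` in `Γ`. -/
structure BothRefine (Sg : Sig) (Γ : Ctx) (S₁ S₂ : Srt) (A : Ty) : Prop where
  ctx : WfCtx Sg Γ
  left : RefinesTy Sg Γ S₁ A
  right : RefinesTy Sg Γ S₂ A

/-- η-expansions of terms synthesizing `S₁` check against `S₂`. -/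
def SubExpansion (Sg : Sig) (A : Ty) (S₁ S₂ : Srt) : Prop :=
  ∀ (Γ : Ctx) (R : Atm), BothRefine Sg Γ S₁ S₂ A →
    SynthAt Sg Γ R S₁ A → CheckAt Sg Γ (expand A.simple R) S₂ A

/-- The η-expansion of a variable of sort `S₁` checks against `S₂`. -/
def SubIdentity (Sg : Sig) (A : Ty) (S₁ S₂ : Srt) : Prop :=
  ∀ (Γ : Ctx) (x : Var), BothRefine Sg Γ S₁ S₂ A → x ∉ Γ.dom →
    CheckAt Sg ((x, S₁, A) :: Γ) (expand A.simple (.fvar x)) S₂ A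

/-- Every term that checks against `S₁` checks against `S₂`. -/
def SubSubsumption (Sg : Sig) (A : Ty) (S₁ S₂ : Srt) : Prop :=
  ∀ (Γ : Ctx) (N : Nrm), BothRefine Sg Γ S₁ S₂ A →
    CheckAt Sg Γ N S₁ A → CheckAt Sg Γ N S₂ A

/-- A variable of sort `S₂` in the context may be given the sort `S₁` instead. -/
def SubNarrowing (Sg : Sig) (A : Ty) (S₁ S₂ : Srt) : Prop :=
  ∀ (ΓL ΓR : Ctx) (x : Var) (N : Nrm) (S : Srt) (B : Ty), BothRefine Sg ΓL S₁ S₂ A →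
    CheckAt Sg (ΓR ++ (x, S₂, A) :: ΓL) N S B →
    CheckAt Sg (ΓR ++ (x, S₁, A) :: ΓL) N S B

/-- Terms of sort `S₁` may be substituted for variables of sort `S₂`; in particular all the
hereditary substitutions involved are defined. -/
def SubSubstitution (Sg : Sig) (A : Ty) (S₁ S₂ : Srt) : Prop :=
  ∀ (ΓL ΓR : Ctx) (x : Var) (N : Nrm) (S : Srt) (B : Ty) (N₁ : Nrm),
    BothRefine Sg ΓL S₁ S₂ A →
    CheckAt Sg (ΓR ++ (x, S₂, A) :: ΓL) N S B →
    CheckAt Sg ΓL N₁ S₁ A →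
    ∃ (ΓRr : Ctx) (Nr : Nrm) (Sr : Srt) (Br : Ty),
      SubstCtx N₁ x A.simple ΓR ΓRr ∧ SubstN N₁ x A.simple N Nr ∧
      SubstS N₁ x A.simple S Sr ∧ SubstA N₁ x A.simple B Br ∧
      CheckAt Sg (ΓRr ++ ΓL) Nr Sr Br

end LFR
/-!
Everything rests on two properties of canonical forms.  *Substitution*: hereditary substitution of a
term `N₁ ⇐ S` for `x :: S ⊏ A` is defined on every well-formed judgment and preserves it.
*Identity*: `η_A(R)` has the type and the sort of `R`, substituting `η_A(x)` for `y` renames `y` to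
`x`, and substituting `N` for `x` in `η_A(x)` gives `N`.

All formulations are compared with the third.  A term `N ⇐ S₁` substituted for `x` in the judgment
`x :: S₁ ⊢ η_A(x) ⇐ S₂` yields `N ⇐ S₂`, and the fifth formulation yields the same from
`x :: S₂ ⊢ η_A(x) ⇐ S₂`.  Conversely, if `S₁` is contained in `S₂`, then under `x :: S₁` the term
`η_A(x)` has sort `S₂`, and substituting it for `x :: S₂` changes nothing but the context.

Substitution is proved by induction on the erased type: contracting a redex created by substituting
at `α₂ → α₁` only requires substitutions at `α₂`.  The classifier of an application is itself the
result of a substitution, so two hereditary substitutions have to commute; this is an induction on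
the sum of the sizes of the two types.  Encoding families, sorts, kinds and classes as normal terms
makes commutation, scoping and identity for them instances of the statements for terms.
-/

namespace LFR

attribute [simp] Atm.opn Nrm.opn ATy.opn Ty.opn ASrt.opn Srt.opn Knd.opn Cls.opn
  Atm.shift Nrm.shift ATy.simple Ty.simple

/-! ## Terms: free variables, local closure, closing and renaming -/

mutual
/-- The free variables of an atomic term. -/
@[simp] def Atm.fv : Atm → Finset Var
  | .con _ => ∅
  | .fvar x => {x}
  | .bvar _ => ∅
  | .app R N => R.fv ∪ N.fv
/-- The free variables of a normal term. -/
@[simp] def Nrm.fv : Nrm → Finset Var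
  | .atm R => R.fv
  | .lam N => N.fv
end

mutual
/-- All dangling indices of an atomic term are less than `k`; for `k = 0`, the term is locally
closed. -/
@[simp] def Atm.LcAt (k : ℕ) : Atm → Prop
  | .con _ => True
  | .fvar _ => True
  | .bvar i => i < k
  | .app R N => R.LcAt k ∧ N.LcAt k
/-- All dangling indices of a normal term are less than `k`. -/
@[simp] def Nrm.LcAt (k : ℕ) : Nrm → Prop
  | .atm R => R.LcAt k
  | .lam N => N.LcAt (k + 1)
end

mutual
/-- Replace the free variable `x` by the bound variable with index `k`: the inverse of opening. -/
@[simp] def Atm.close (k : ℕ) (x : Var) : Atm → Atm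
  | .con c => .con c
  | .fvar y => if y = x then .bvar k else .fvar y
  | .bvar i => .bvar i
  | .app R N => .app (R.close k x) (N.close k x)
/-- Replace the free variable `x` by the bound variable with index `k`. -/
@[simp] def Nrm.close (k : ℕ) (x : Var) : Nrm → Nrm
  | .atm R => .atm (R.close k x)
  | .lam N => .lam (N.close (k + 1) x)
end

mutual
/-- Apply `ρ` to all free variables of an atomic term. -/
@[simp] def Atm.ren (ρ : Var → Var) : Atm → Atm
  | .con c => .con c
  | .fvar x => .fvar (ρ x)
  | .bvar i => .bvar i
  | .app R N => .app (R.ren ρ) (N.ren ρ)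
/-- Apply `ρ` to all free variables of a normal term. -/
@[simp] def Nrm.ren (ρ : Var → Var) : Nrm → Nrm
  | .atm R => .atm (R.ren ρ)
  | .lam N => .lam (N.ren ρ)
end

mutual
/-- The number of constructors of an atomic term. -/
@[simp] def Atm.size : Atm → ℕ
  | .con _ => 1
  | .fvar _ => 1
  | .bvar _ => 1
  | .app R N => R.size + N.size + 1
/-- The number of constructors of a normal term. -/
@[simp] def Nrm.size : Nrm → ℕ
  | .atm R => R.size + 1
  | .lam N => N.size + 1
end

section Opening

variable {k : ℕ} {x y : Var}

mutual
theorem Atm.opn_of_lcAt : ∀ {j k} {R : Atm}, R.LcAt j → j ≤ k → R.opn k x = R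
  | _, _, .con _, _, _ => rfl
  | _, _, .fvar _, _, _ => rfl
  | _, _, .bvar _, h, hk => if_neg (lt_of_lt_of_le h hk).ne
  | _, _, .app _ _, h, hk => congrArg₂ Atm.app (Atm.opn_of_lcAt h.1 hk) (Nrm.opn_of_lcAt h.2 hk)
theorem Nrm.opn_of_lcAt : ∀ {j k} {N : Nrm}, N.LcAt j → j ≤ k → N.opn k x = N
  | _, _, .atm _, h, hk => congrArg Nrm.atm (Atm.opn_of_lcAt h hk)
  | _, _, .lam _, h, hk => congrArg Nrm.lam (Nrm.opn_of_lcAt (j := _ + 1) h (Nat.succ_le_succ hk))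
end

mutual
theorem Atm.lcAt_opn : ∀ {k} {R : Atm}, (R.opn k x).LcAt k ↔ R.LcAt (k + 1)
  | _, .con _ => Iff.rfl
  | _, .fvar _ => Iff.rfl
  | k, .bvar i => by
      grind [Atm.opn, Atm.LcAt]
  | _, .app _ _ => and_congr Atm.lcAt_opn Nrm.lcAt_opn
theorem Nrm.lcAt_opn : ∀ {k} {N : Nrm}, (N.opn k x).LcAt k ↔ N.LcAt (k + 1)
  | _, .atm R => R.lcAt_opn
  | _, .lam N => N.lcAt_opn
end

mutual
theorem Atm.fv_opn_subset : ∀ {k} {R : Atm}, (R.opn k x).fv ⊆ insert x R.fv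
  | _, .con _ => Finset.empty_subset _
  | _, .fvar _ => Finset.subset_insert _ _
  | k, .bvar i => by by_cases h : i = k <;> simp [h]
  | _, .app _ _ => by
      rw [Atm.fv, Finset.insert_union_distrib]
      exact Finset.union_subset_union Atm.fv_opn_subset Nrm.fv_opn_subset
theorem Nrm.fv_opn_subset : ∀ {k} {N : Nrm}, (N.opn k x).fv ⊆ insert x N.fv
  | _, .atm R => R.fv_opn_subset
  | _, .lam N => N.fv_opn_subset
end

mutual
theorem Atm.fv_subset_fv_opn : ∀ {k} {R : Atm}, R.fv ⊆ (R.opn k x).fv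
  | _, .con _ => subset_rfl
  | _, .fvar _ => subset_rfl
  | _, .bvar _ => Finset.empty_subset _
  | _, .app _ _ => Finset.union_subset_union Atm.fv_subset_fv_opn Nrm.fv_subset_fv_opn
theorem Nrm.fv_subset_fv_opn : ∀ {k} {N : Nrm}, N.fv ⊆ (N.opn k x).fv
  | _, .atm R => R.fv_subset_fv_opn
  | _, .lam N => N.fv_subset_fv_opn
end

theorem Nrm.notMem_fv_opn {N : Nrm} (hN : y ∉ N.fv) (hxy : y ≠ x) : y ∉ (N.opn k x).fv :=
  fun h => (Finset.mem_insert.1 (N.fv_opn_subset h)).elim hxy hN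

mutual
@[simp] theorem Atm.size_opn : ∀ {k} {R : Atm}, (R.opn k x).size = R.size
  | _, .con _ => rfl
  | _, .fvar _ => rfl
  | k, .bvar i => by by_cases h : i = k <;> simp [h]
  | _, .app R N => by simp [R.size_opn, N.size_opn]
@[simp] theorem Nrm.size_opn : ∀ {k} {N : Nrm}, (N.opn k x).size = N.size
  | _, .atm R => by simp [R.size_opn]
  | _, .lam N => by simp [N.size_opn]
end

mutual
theorem Atm.close_opn : ∀ {k} {R : Atm}, x ∉ R.fv → (R.opn k x).close k x = R
  | _, .con _, _ => rfl
  | _, .fvar _, h => if_neg fun e => h (Finset.mem_singleton.2 e.symm)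
  | k, .bvar i, _ => by by_cases h : i = k <;> simp [h]
  | _, .app _ _, h =>
      have h := Finset.notMem_union.1 h
      congrArg₂ Atm.app (Atm.close_opn h.1) (Nrm.close_opn h.2)
theorem Nrm.close_opn : ∀ {k} {N : Nrm}, x ∉ N.fv → (N.opn k x).close k x = N
  | _, .atm _, h => congrArg Nrm.atm (Atm.close_opn h)
  | _, .lam _, h => congrArg Nrm.lam (Nrm.close_opn h)
end

mutual
theorem Atm.opn_close : ∀ {k} {R : Atm}, R.LcAt k → (R.close k x).opn k x = R
  | _, .con _, _ => rfl
  | _, .fvar y, _ => by by_cases h : y = x <;> simp [h]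
  | _, .bvar _, h => if_neg (Nat.ne_of_lt h)
  | _, .app _ _, h => congrArg₂ Atm.app (Atm.opn_close h.1) (Nrm.opn_close h.2)
theorem Nrm.opn_close : ∀ {k} {N : Nrm}, N.LcAt k → (N.close k x).opn k x = N
  | _, .atm _, h => congrArg Nrm.atm (Atm.opn_close h)
  | _, .lam _, h => congrArg Nrm.lam (Nrm.opn_close h)
end

mutual
theorem Atm.notMem_fv_close : ∀ {k} {R : Atm}, x ∉ (R.close k x).fv
  | _, .con _ => Finset.notMem_empty _
  | _, .fvar y => by by_cases h : y = x <;> simp [h, Ne.symm]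
  | _, .bvar _ => Finset.notMem_empty _
  | _, .app _ _ => Finset.notMem_union.2 ⟨Atm.notMem_fv_close, Nrm.notMem_fv_close⟩
theorem Nrm.notMem_fv_close : ∀ {k} {N : Nrm}, x ∉ (N.close k x).fv
  | _, .atm R => R.notMem_fv_close
  | _, .lam N => N.notMem_fv_close
end

theorem Nrm.opn_inj {N N' : Nrm} (h : x ∉ N.fv) (h' : x ∉ N'.fv)
    (e : N.opn k x = N'.opn k x) : N = N' := by
  rw [← close_opn h, e, close_opn h']

end Opening

section Renaming

variable {ρ : Var → Var} {x y z : Var}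

mutual
theorem Atm.ren_opn : ∀ {k} {R : Atm}, (R.opn k x).ren ρ = (R.ren ρ).opn k (ρ x)
  | _, .con _ => rfl
  | _, .fvar _ => rfl
  | k, .bvar i => by by_cases h : i = k <;> simp [h]
  | _, .app _ _ => congrArg₂ Atm.app Atm.ren_opn Nrm.ren_opn
theorem Nrm.ren_opn : ∀ {k} {N : Nrm}, (N.opn k x).ren ρ = (N.ren ρ).opn k (ρ x)
  | _, .atm _ => congrArg Nrm.atm Atm.ren_opn
  | _, .lam _ => congrArg Nrm.lam Nrm.ren_opn
end

mutual
theorem Atm.ren_eq_self : ∀ {R : Atm}, (∀ v ∈ R.fv, ρ v = v) → R.ren ρ = R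
  | .con _, _ => rfl
  | .fvar x, h => congrArg Atm.fvar (h x (Finset.mem_singleton_self x))
  | .bvar _, _ => rfl
  | .app _ _, h => congrArg₂ Atm.app (Atm.ren_eq_self fun v hv => h v (Finset.mem_union_left _ hv))
      (Nrm.ren_eq_self fun v hv => h v (Finset.mem_union_right _ hv))
theorem Nrm.ren_eq_self : ∀ {N : Nrm}, (∀ v ∈ N.fv, ρ v = v) → N.ren ρ = N
  | .atm _, h => congrArg Nrm.atm (Atm.ren_eq_self h)
  | .lam _, h => congrArg Nrm.lam (Nrm.ren_eq_self h)
end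

theorem Nrm.ren_swap_of_notMem {N : Nrm} (hy : y ∉ N.fv) (hz : z ∉ N.fv) :
    N.ren (Equiv.swap y z) = N :=
  ren_eq_self fun _ hv => Equiv.swap_apply_of_ne_of_ne
    (ne_of_mem_of_not_mem hv hy) (ne_of_mem_of_not_mem hv hz)

theorem Nrm.ren_swap_opn {N : Nrm} (hy : y ∉ N.fv) (hz : z ∉ N.fv) :
    (N.opn 0 y).ren (Equiv.swap y z) = N.opn 0 z := by
  rw [ren_opn, ren_swap_of_notMem hy hz, Equiv.swap_apply_left]

theorem Nrm.ren_update_opn {N : Nrm} (hy : y ∉ N.fv) :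
    (N.opn 0 y).ren (Function.update id y x) = N.opn 0 x := by
  rw [ren_opn, Function.update_self,
    ren_eq_self fun v hv => Function.update_of_ne (ne_of_mem_of_not_mem hv hy) _ _]

end Renaming

/-! ## η-expansion -/

section Shift

variable {x : Var}

mutual
theorem Atm.shift_of_lcAt : ∀ {k} {R : Atm}, R.LcAt k → R.shift k = R
  | _, .con _, _ => rfl
  | _, .fvar _, _ => rfl
  | _, .bvar _, h => if_pos h
  | _, .app _ _, h => congrArg₂ Atm.app (Atm.shift_of_lcAt h.1) (Nrm.shift_of_lcAt h.2)
theorem Nrm.shift_of_lcAt : ∀ {k} {N : Nrm}, N.LcAt k → N.shift k = N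
  | _, .atm _, h => congrArg Nrm.atm (Atm.shift_of_lcAt h)
  | _, .lam _, h => congrArg Nrm.lam (Nrm.shift_of_lcAt h)
end

mutual
theorem Atm.opn_shift : ∀ {j k} {R : Atm}, j ≤ k →
    (R.shift j).opn (k + 1) x = (R.opn k x).shift j
  | _, _, .con _, _ => rfl
  | _, _, .fvar _, _ => rfl
  | j, k, .bvar i, h => by grind [Atm.opn, Atm.shift]
  | _, _, .app _ _, h => congrArg₂ Atm.app (Atm.opn_shift h) (Nrm.opn_shift h)
theorem Nrm.opn_shift : ∀ {j k} {N : Nrm}, j ≤ k →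
    (N.shift j).opn (k + 1) x = (N.opn k x).shift j
  | _, _, .atm _, h => congrArg Nrm.atm (Atm.opn_shift h)
  | _, _, .lam _, h => congrArg Nrm.lam (Nrm.opn_shift (Nat.succ_le_succ h))
end

mutual
theorem Atm.lcAt_shift : ∀ {j k} {R : Atm}, R.LcAt k → (R.shift j).LcAt (k + 1)
  | _, _, .con _, _ => trivial
  | _, _, .fvar _, _ => trivial
  | j, k, .bvar i, h => by
      simp only [Atm.LcAt] at h
      by_cases hi : i < j <;> simp only [Atm.shift, hi, if_true, if_false, Atm.LcAt] <;> omega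
  | _, _, .app _ _, h => ⟨Atm.lcAt_shift h.1, Nrm.lcAt_shift h.2⟩
theorem Nrm.lcAt_shift : ∀ {j k} {N : Nrm}, N.LcAt k → (N.shift j).LcAt (k + 1)
  | _, _, .atm R, h => R.lcAt_shift h
  | _, _, .lam N, h => N.lcAt_shift h
end

mutual
@[simp] theorem Atm.fv_shift : ∀ {j} {R : Atm}, (R.shift j).fv = R.fv
  | _, .con _ => rfl
  | _, .fvar _ => rfl
  | j, .bvar i => by by_cases h : i < j <;> simp [h]
  | _, .app _ _ => congrArg₂ (· ∪ ·) Atm.fv_shift Nrm.fv_shift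
@[simp] theorem Nrm.fv_shift : ∀ {j} {N : Nrm}, (N.shift j).fv = N.fv
  | _, .atm R => R.fv_shift
  | _, .lam N => N.fv_shift
end

end Shift

theorem expand_opn (α : STy) {k : ℕ} {x : Var} {R : Atm} :
    (expand α R).opn k x = expand α (R.opn k x) := by
  induction α generalizing k x R with
  | base a => rfl
  | arr α β ihα ihβ => simp [expand, ihα, ihβ, Atm.opn_shift]

theorem lcAt_expand (α : STy) {k : ℕ} {R : Atm} (h : R.LcAt k) : (expand α R).LcAt k := by
  induction α generalizing k R with
  | base _ => exact h
  | arr α _ ihα ihβ => exact ihβ ⟨Atm.lcAt_shift h, ihα k.succ_pos⟩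

@[simp] theorem fv_expand (α : STy) {R : Atm} : (expand α R).fv = R.fv := by
  induction α generalizing R with
  | base a => rfl
  | arr α β ihα ihβ => simp [expand, ihα, ihβ]

theorem expand_body_opn {α β : STy} {R : Atm} (h : R.LcAt 0) {x : Var} :
    (expand β (.app (R.shift 0) (expand α (.bvar 0)))).opn 0 x =
      expand β (.app R (expand α (.fvar x))) := by
  simp [expand_opn, Atm.shift_of_lcAt h, Atm.opn_of_lcAt h le_rfl]

/-! ## Hereditary substitution -/

theorem exists_fresh₄ (F₁ F₂ F₃ F₄ : Finset Var) :
    ∃ y, y ∉ F₁ ∧ y ∉ F₂ ∧ y ∉ F₃ ∧ y ∉ F₄ := by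
  obtain ⟨y, hy⟩ := Infinite.exists_notMem_finset (F₁ ∪ F₂ ∪ F₃ ∪ F₄)
  exact ⟨y, by simpa only [Finset.mem_union, not_or, and_assoc] using hy⟩

theorem forall_notMem_image {p : Var → Prop} {F : Finset Var} (π : Equiv.Perm Var)
    (h : ∀ y, y ∉ F → p (π y)) : ∀ y, y ∉ F.image π → p y := by
  intro y hy
  have hp := h (π.symm y) fun hm => hy (Finset.mem_image.2 ⟨_, hm, π.apply_symm_apply y⟩)
  rwa [π.apply_symm_apply] at hp

mutual
theorem SubstN.equivariant (π : Equiv.Perm Var) : ∀ {N₀ x₀ α₀ N N'}, SubstN N₀ x₀ α₀ N N' →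
    SubstN (N₀.ren π) (π x₀) α₀ (N.ren π) (N'.ren π)
  | _, _, _, _, _, .atom h => .atom (h.equivariant π)
  | _, _, _, _, _, .atomNorm h => .atomNorm (h.equivariant π)
  | _, _, _, _, _, .lam F h => .lam (F.image π) <| forall_notMem_image π fun y hy => by
      rw [← Nrm.ren_opn, ← Nrm.ren_opn]
      exact (h y hy).equivariant π
theorem SubstRR.equivariant (π : Equiv.Perm Var) : ∀ {N₀ x₀ α₀ R R'}, SubstRR N₀ x₀ α₀ R R' →
    SubstRR (N₀.ren π) (π x₀) α₀ (R.ren π) (R'.ren π)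
  | _, _, _, _, _, .var h => .var (π.injective.ne h)
  | _, _, _, _, _, .con => .con
  | _, _, _, _, _, .app h₁ h₂ => .app (h₁.equivariant π) (h₂.equivariant π)
theorem SubstRN.equivariant (π : Equiv.Perm Var) : ∀ {N₀ x₀ α₀ R N' β},
    SubstRN N₀ x₀ α₀ R N' β → SubstRN (N₀.ren π) (π x₀) α₀ (R.ren π) (N'.ren π) β
  | _, _, _, _, _, _, .var => .var
  | _, _, _, _, _, _, .beta F h₁ h₂ h₃ =>
      .beta (F.image π) (h₁.equivariant π) (h₂.equivariant π) <|
        forall_notMem_image π fun y hy => by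
          rw [← Nrm.ren_opn]
          exact (h₃ y hy).equivariant π
end

mutual
theorem SubstN.lc_input : ∀ {N₀ x₀ α₀ N N'}, SubstN N₀ x₀ α₀ N N' → N.LcAt 0
  | _, _, _, _, _, .atom h => h.lc_input
  | _, _, _, _, _, .atomNorm h => h.lc_input
  | _, _, _, _, _, .lam F h =>
      have ⟨y, hy⟩ := Infinite.exists_notMem_finset F
      Nrm.lcAt_opn.1 (h y hy).lc_input
theorem SubstRR.lc_input : ∀ {N₀ x₀ α₀ R R'}, SubstRR N₀ x₀ α₀ R R' → R.LcAt 0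
  | _, _, _, _, _, .var _ => trivial
  | _, _, _, _, _, .con => trivial
  | _, _, _, _, _, .app h₁ h₂ => ⟨h₁.lc_input, h₂.lc_input⟩
theorem SubstRN.lc_input : ∀ {N₀ x₀ α₀ R N' β}, SubstRN N₀ x₀ α₀ R N' β → R.LcAt 0
  | _, _, _, _, _, _, .var => trivial
  | _, _, _, _, _, _, .beta _ h₁ h₂ _ => ⟨h₁.lc_input, h₂.lc_input⟩
end

mutual
theorem SubstN.lc_output : ∀ {N₀ x₀ α₀ N N'}, SubstN N₀ x₀ α₀ N N' → N₀.LcAt 0 → N'.LcAt 0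
  | _, _, _, _, _, .atom h, h₀ => h.lc_output h₀
  | _, _, _, _, _, .atomNorm h, h₀ => h.lc_output h₀
  | _, _, _, _, _, .lam F h, h₀ =>
      have ⟨y, hy⟩ := Infinite.exists_notMem_finset F
      Nrm.lcAt_opn.1 ((h y hy).lc_output h₀)
theorem SubstRR.lc_output : ∀ {N₀ x₀ α₀ R R'}, SubstRR N₀ x₀ α₀ R R' → N₀.LcAt 0 → R'.LcAt 0
  | _, _, _, _, _, .var _, _ => trivial
  | _, _, _, _, _, .con, _ => trivial
  | _, _, _, _, _, .app h₁ h₂, h₀ => ⟨h₁.lc_output h₀, h₂.lc_output h₀⟩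
theorem SubstRN.lc_output : ∀ {N₀ x₀ α₀ R N' β}, SubstRN N₀ x₀ α₀ R N' β → N₀.LcAt 0 →
    N'.LcAt 0
  | _, _, _, _, _, _, .var, h₀ => h₀
  | _, _, _, _, _, _, .beta F _ h₂ h₃, h₀ =>
      have ⟨y, hy⟩ := Infinite.exists_notMem_finset F
      (h₃ y hy).lc_output (h₂.lc_output h₀)
end

mutual
theorem SubstRR.of_notMem (N₀ : Nrm) {x₀ : Var} (α₀ : STy) :
    ∀ {R : Atm}, R.LcAt 0 → x₀ ∉ R.fv → SubstRR N₀ x₀ α₀ R R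
  | .con _, _, _ => .con
  | .fvar _, _, h => .var fun e => h (Finset.mem_singleton.2 e.symm)
  | .bvar _, h, _ => (Nat.not_lt_zero _ h).elim
  | .app _ _, h, hx =>
      have hx := Finset.notMem_union.1 hx
      .app (.of_notMem N₀ α₀ h.1 hx.1) (.of_notMem N₀ α₀ h.2 hx.2)
termination_by R => R.size
decreasing_by all_goals simp only [Atm.size]; omega
theorem SubstN.of_notMem (N₀ : Nrm) {x₀ : Var} (α₀ : STy) :
    ∀ {N : Nrm}, N.LcAt 0 → x₀ ∉ N.fv → SubstN N₀ x₀ α₀ N N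
  | .atm _, h, hx => .atom (.of_notMem N₀ α₀ h hx)
  | .lam _, h, hx => .lam {x₀} fun _ hy =>
      .of_notMem N₀ α₀ (Nrm.lcAt_opn.2 h)
        (Nrm.notMem_fv_opn hx fun e => hy (Finset.mem_singleton.2 e.symm))
termination_by N => N.size
decreasing_by all_goals simp only [Nrm.size, Nrm.size_opn]; omega
end

theorem SubstRR.not_substRN : ∀ {N₀ x₀ α₀ R R' N β}, SubstRR N₀ x₀ α₀ R R' →
    ¬ SubstRN N₀ x₀ α₀ R N β
  | _, _, _, _, _, _, _, .var h, .var => h rfl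
  | _, _, _, _, _, _, _, .app h₁ _, .beta _ h₁' _ _ => h₁.not_substRN h₁'

mutual
theorem SubstN.det : ∀ {N₀ x₀ α₀ N N' N''}, SubstN N₀ x₀ α₀ N N' → SubstN N₀ x₀ α₀ N N'' →
    N' = N''
  | _, _, _, _, _, _, .atom h, .atom h' => congrArg Nrm.atm (h.det h')
  | _, _, _, _, _, _, .atom h, .atomNorm h' => (h.not_substRN h').elim
  | _, _, _, _, _, _, .atomNorm h, .atom h' => (h'.not_substRN h).elim
  | _, _, _, _, _, _, .atomNorm h, .atomNorm h' => (h.det h').1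
  | _, _, _, _, .lam N', .lam N'', .lam F h, .lam F' h' => by
      obtain ⟨y, hy, hy', h₁, h₂⟩ := exists_fresh₄ F F' N'.fv N''.fv
      rw [Nrm.opn_inj h₁ h₂ ((h y hy).det (h' y hy'))]
theorem SubstRR.det : ∀ {N₀ x₀ α₀ R R' R''}, SubstRR N₀ x₀ α₀ R R' → SubstRR N₀ x₀ α₀ R R'' →
    R' = R''
  | _, _, _, _, _, _, .var _, .var _ => rfl
  | _, _, _, _, _, _, .con, .con => rfl
  | _, _, _, _, _, _, .app h₁ h₂, .app h₁' h₂' => congrArg₂ Atm.app (h₁.det h₁') (h₂.det h₂')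
theorem SubstRN.det : ∀ {N₀ x₀ α₀ R N' N'' β β'}, SubstRN N₀ x₀ α₀ R N' β →
    SubstRN N₀ x₀ α₀ R N'' β' → N' = N'' ∧ β = β'
  | _, _, _, _, _, _, _, _, .var, h' => by cases h'; exact ⟨rfl, rfl⟩
  | _, _, _, _, _, _, _, _, .beta F h₁ h₂ h₃, .beta F' h₁' h₂' h₃' => by
      obtain ⟨e₁, e₂⟩ := h₁.det h₁'
      cases e₁; cases e₂
      obtain rfl := h₂.det h₂'
      obtain ⟨y, hy⟩ := Infinite.exists_notMem_finset (F ∪ F')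
      rw [Finset.notMem_union] at hy
      exact ⟨(h₃ y hy.1).det (h₃' y hy.2), rfl⟩
end

section

variable {N₀ : Nrm} {x₀ : Var} {α₀ : STy}

theorem SubstN.opn_of_opn {N N' : Nrm} {y z : Var} (hyN₀ : y ∉ N₀.fv) (hyx : y ≠ x₀)
    (hyN : y ∉ N.fv) (hyN' : y ∉ N'.fv) (hzN₀ : z ∉ N₀.fv) (hzx : z ≠ x₀) (hzN : z ∉ N.fv)
    (hzN' : z ∉ N'.fv) (h : SubstN N₀ x₀ α₀ (N.opn 0 y) (N'.opn 0 y)) :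
    SubstN N₀ x₀ α₀ (N.opn 0 z) (N'.opn 0 z) := by
  have hswap := h.equivariant (Equiv.swap y z)
  rwa [Nrm.ren_swap_of_notMem hyN₀ hzN₀, Equiv.swap_apply_of_ne_of_ne hyx.symm hzx.symm,
    Nrm.ren_swap_opn hyN hzN, Nrm.ren_swap_opn hyN' hzN'] at hswap

theorem SubstN.change_var {N M : Nrm} {y z : Var} (hyN₀ : y ∉ N₀.fv) (hyN : y ∉ N.fv)
    (hyM : y ∉ M.fv) (hzN₀ : z ∉ N₀.fv) (hzN : z ∉ N.fv) (hzM : z ∉ M.fv)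
    (h : SubstN N₀ y α₀ (N.opn 0 y) M) : SubstN N₀ z α₀ (N.opn 0 z) M := by
  have hswap := h.equivariant (Equiv.swap y z)
  rwa [Nrm.ren_swap_of_notMem hyN₀ hzN₀, Equiv.swap_apply_left, Nrm.ren_swap_opn hyN hzN,
    Nrm.ren_swap_of_notMem hyM hzM] at hswap

/-- By equivariance, the result for one fresh name of the bound variable determines the others. -/
theorem SubstN.exists_opn {p : Var → Nrm → Prop} (h₀ : N₀.LcAt 0) {F : Finset Var} {N : Nrm}
    (h : ∀ y, y ∉ F → ∃ N', SubstN N₀ x₀ α₀ (N.opn 0 y) N' ∧ p y N') :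
    ∃ (N' : Nrm) (F' : Finset Var), ∀ y, y ∉ F' →
      SubstN N₀ x₀ α₀ (N.opn 0 y) (N'.opn 0 y) ∧ p y (N'.opn 0 y) := by
  obtain ⟨y, hyF, hyN₀, hyx₀, hyN⟩ := exists_fresh₄ F N₀.fv {x₀} N.fv
  obtain ⟨M, hM, -⟩ := h y hyF
  refine ⟨M.close 0 y, F ∪ N₀.fv ∪ {x₀} ∪ N.fv ∪ (M.close 0 y).fv, fun z hz => ?_⟩
  simp only [Finset.mem_union, Finset.mem_singleton, not_or] at hyx₀ hz
  obtain ⟨⟨⟨⟨hzF, hzN₀⟩, hzx₀⟩, hzN⟩, hzM⟩ := hz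
  rw [← Nrm.opn_close (x := y) (hM.lc_output h₀)] at hM
  have hz := hM.opn_of_opn hyN₀ hyx₀ hyN Nrm.notMem_fv_close hzN₀ hzx₀ hzN hzM
  obtain ⟨M', hM', hp⟩ := h z hzF
  exact ⟨hz, hz.det hM' ▸ hp⟩

end

/-! ## Commutation of hereditary substitutions -/

/-- The number of constructors of a simple type. -/
@[simp] def STy.size : STy → ℕ
  | .base _ => 1
  | .arr α β => α.size + β.size + 1

theorem SubstRN.size_le : ∀ {N₀ x₀ α₀ R N' β}, SubstRN N₀ x₀ α₀ R N' β → β.size ≤ α₀.size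
  | _, _, _, _, _, _, .var => le_rfl
  | _, _, _, _, _, _, .beta _ h _ _ => by
      have := h.size_le
      simp only [STy.size] at this
      omega

/-- Substitutions at the simple types `α₀` and `α₂` commute:
`[N₀/x₀][N₂/x₂]N = [[N₀/x₀]N₂/x₂][N₀/x₀]N`, where `x₂` is not free in `N₀`. -/
def SubstComm (α₀ α₂ : STy) : Prop :=
  ∀ ⦃N₀ x₀ N₂ N₂' x₂ N N' N''⦄, N₀.LcAt 0 → x₂ ∉ N₀.fv → x₀ ≠ x₂ →
    SubstN N₀ x₀ α₀ N₂ N₂' → SubstN N₂ x₂ α₂ N N' → SubstN N₀ x₀ α₀ N N'' →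
    ∃ M, SubstN N₀ x₀ α₀ N' M ∧ SubstN N₂' x₂ α₂ N'' M

theorem SubstComm.instantiate {α₀ α₂ : STy} (hcomm : SubstComm α₀ α₂) {N₀ N₂ N₂' B B' Br : Nrm}
    {x₀ : Var} {F F' : Finset Var} (h₀ : N₀.LcAt 0) (h₀₂ : SubstN N₀ x₀ α₀ N₂ N₂')
    (h : ∀ x, x ∉ F → SubstN N₂ x α₂ (B.opn 0 x) Br)
    (h' : ∀ x, x ∉ F' → SubstN N₀ x₀ α₀ (B.opn 0 x) (B'.opn 0 x)) :
    ∃ (M : Nrm) (G : Finset Var), SubstN N₀ x₀ α₀ Br M ∧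
      ∀ x, x ∉ G → SubstN N₂' x α₂ (B'.opn 0 x) M := by
  have hfresh : ∀ x, x ∉ F ∪ F' ∪ N₀.fv ∪ {x₀} →
      ∃ M, SubstN N₀ x₀ α₀ Br M ∧ SubstN N₂' x α₂ (B'.opn 0 x) M := by
    intro x hx
    simp only [Finset.mem_union, Finset.mem_singleton, not_or] at hx
    obtain ⟨⟨⟨hF, hF'⟩, hN₀⟩, hx₀⟩ := hx
    exact hcomm h₀ hN₀ (Ne.symm hx₀) h₀₂ (h x hF) (h' x hF')
  obtain ⟨z, hz⟩ := Infinite.exists_notMem_finset (F ∪ F' ∪ N₀.fv ∪ {x₀})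
  obtain ⟨M, hM, -⟩ := hfresh z hz
  refine ⟨M, F ∪ F' ∪ N₀.fv ∪ {x₀}, hM, fun x hx => ?_⟩
  obtain ⟨M', hM₁, hM₂⟩ := hfresh x hx
  rwa [hM.det hM₁]

theorem SubstRN.not_substRN_of_ne : ∀ {N₀ x₀ α₀ N₂ x₂ α₂ R N' N'' β β'}, x₀ ≠ x₂ →
    SubstRN N₂ x₂ α₂ R N' β → ¬ SubstRN N₀ x₀ α₀ R N'' β'
  | _, _, _, _, _, _, _, _, _, _, _, hne, .var, h' => by cases h'; exact hne rfl
  | _, _, _, _, _, _, _, _, _, _, _, hne, .beta _ h _ _, .beta _ h' _ _ =>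
      h.not_substRN_of_ne hne h'

section

variable {α₀ : STy} {N₀ N₂' : Nrm} {x₀ : Var}

mutual
theorem SubstN.comm_of_lt : ∀ {N₂ x₂ α₂ N N' N''}
    (_ : ∀ β β' : STy, β.size + β'.size < α₀.size + α₂.size → SubstComm β β')
    (_ : N₀.LcAt 0) (_ : x₂ ∉ N₀.fv) (_ : x₀ ≠ x₂) (_ : SubstN N₀ x₀ α₀ N₂ N₂'),
    SubstN N₂ x₂ α₂ N N' → SubstN N₀ x₀ α₀ N N'' →
    ∃ M, SubstN N₀ x₀ α₀ N' M ∧ SubstN N₂' x₂ α₂ N'' M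
  | _, _, _, _, _, _, ih, hl, hx, hne, h₀₂, .atom h, .atom h' => by
      obtain ⟨M, h₁, h₂⟩ := SubstRR.comm_of_lt ih hl hx hne h₀₂ h h'
      exact ⟨.atm M, .atom h₁, .atom h₂⟩
  | _, _, _, _, _, _, ih, hl, hx, hne, h₀₂, .atom h, .atomNorm h' => by
      obtain ⟨M, h₁, h₂⟩ := SubstRR.comm_rn_of_lt ih hl hx hne h₀₂ h h'
      cases h₂ with
      | atom h₂ => exact ⟨_, .atomNorm h₁, .atom h₂⟩
      | atomNorm h₂ => exact ⟨_, .atomNorm h₁, .atomNorm h₂⟩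
  | _, _, _, _, _, _, ih, hl, hx, hne, h₀₂, .atomNorm h, .atom h' => by
      obtain ⟨M, h₁, h₂⟩ := SubstRN.comm_of_lt ih hl hx hne h₀₂ h h'
      cases h₁ with
      | atom h₁ => exact ⟨_, .atom h₁, .atomNorm h₂⟩
      | atomNorm h₁ => exact ⟨_, .atomNorm h₁, .atomNorm h₂⟩
  | _, _, _, _, _, _, _, _, _, hne, _, .atomNorm h, .atomNorm h' =>
      (h.not_substRN_of_ne hne h').elim
  | _, x₂, α₂, _, _, .lam N'', ih, hl, hx, hne, h₀₂, .lam F h, .lam F' h' => by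
      obtain ⟨M, G, hM⟩ := SubstN.exists_opn (F := F ∪ F')
        (p := fun y => SubstN N₂' x₂ α₂ (N''.opn 0 y)) hl fun y hy =>
          have hy := Finset.notMem_union.1 hy
          SubstN.comm_of_lt ih hl hx hne h₀₂ (h y hy.1) (h' y hy.2)
      exact ⟨.lam M, .lam G fun y hy => (hM y hy).1, .lam G fun y hy => (hM y hy).2⟩
termination_by structural _ _ _ _ _ _ _ _ _ _ _ h => h
theorem SubstRR.comm_of_lt : ∀ {N₂ x₂ α₂ R R' R''}
    (_ : ∀ β β' : STy, β.size + β'.size < α₀.size + α₂.size → SubstComm β β')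
    (_ : N₀.LcAt 0) (_ : x₂ ∉ N₀.fv) (_ : x₀ ≠ x₂) (_ : SubstN N₀ x₀ α₀ N₂ N₂'),
    SubstRR N₂ x₂ α₂ R R' → SubstRR N₀ x₀ α₀ R R'' →
    ∃ M, SubstRR N₀ x₀ α₀ R' M ∧ SubstRR N₂' x₂ α₂ R'' M
  | _, _, _, _, _, _, _, _, _, _, _, .var h, .var h' => ⟨_, .var h', .var h⟩
  | _, _, _, _, _, _, _, _, _, _, _, .con, .con => ⟨_, .con, .con⟩
  | _, _, _, _, _, _, ih, hl, hx, hne, h₀₂, .app h₁ h₂, .app h₁' h₂' => by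
      obtain ⟨_, h₃, h₄⟩ := SubstRR.comm_of_lt ih hl hx hne h₀₂ h₁ h₁'
      obtain ⟨_, h₅, h₆⟩ := SubstN.comm_of_lt ih hl hx hne h₀₂ h₂ h₂'
      exact ⟨_, .app h₃ h₅, .app h₄ h₆⟩
termination_by structural _ _ _ _ _ _ _ _ _ _ _ h => h
theorem SubstRR.comm_rn_of_lt : ∀ {N₂ x₂ α₂ R R' N'' β}
    (_ : ∀ β β' : STy, β.size + β'.size < α₀.size + α₂.size → SubstComm β β')
    (_ : N₀.LcAt 0) (_ : x₂ ∉ N₀.fv) (_ : x₀ ≠ x₂) (_ : SubstN N₀ x₀ α₀ N₂ N₂'),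
    SubstRR N₂ x₂ α₂ R R' → SubstRN N₀ x₀ α₀ R N'' β →
    ∃ M, SubstRN N₀ x₀ α₀ R' M β ∧ SubstN N₂' x₂ α₂ N'' M
  | _, _, _, _, _, _, _, _, hl, hx, _, _, .var _, .var => ⟨_, .var, .of_notMem _ _ hl hx⟩
  | _, _, α₂, _, _, _, _, ih, hl, hx, hne, h₀₂, .app h₁ h₂,
      @SubstRN.beta _ _ _ _ _ _ _ _ _ β₂ F h₁' h₂' h₃' => by
      obtain ⟨M₁, h₃, h₄⟩ := SubstRR.comm_rn_of_lt ih hl hx hne h₀₂ h₁ h₁'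
      obtain ⟨M₂, h₅, h₆⟩ := SubstN.comm_of_lt ih hl hx hne h₀₂ h₂ h₂'
      have hsize := h₁'.size_le
      simp only [STy.size] at hsize
      cases h₄ with
      | lam F' h₄ =>
        obtain ⟨M, G, hM, hG⟩ :=
          (ih α₂ β₂ (by omega)).instantiate (h₀₂.lc_output hl) h₆ h₃' h₄
        exact ⟨M, .beta G h₃ h₅ hG, hM⟩
termination_by structural _ _ _ _ _ _ _ _ _ _ _ _ h => h
theorem SubstRN.comm_of_lt : ∀ {N₂ x₂ α₂ R N' R'' β}
    (_ : ∀ β β' : STy, β.size + β'.size < α₀.size + α₂.size → SubstComm β β')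
    (_ : N₀.LcAt 0) (_ : x₂ ∉ N₀.fv) (_ : x₀ ≠ x₂) (_ : SubstN N₀ x₀ α₀ N₂ N₂'),
    SubstRN N₂ x₂ α₂ R N' β → SubstRR N₀ x₀ α₀ R R'' →
    ∃ M, SubstN N₀ x₀ α₀ N' M ∧ SubstRN N₂' x₂ α₂ R'' M β
  | _, _, _, _, _, _, _, _, _, _, _, h₀₂, .var, .var _ => ⟨_, h₀₂, .var⟩
  | _, _, _, _, _, _, _, ih, hl, hx, hne, h₀₂,
      @SubstRN.beta _ _ _ _ _ _ _ _ _ β₂ F h₁ h₂ h₃, .app h₁' h₂' => by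
      obtain ⟨M₁, h₄, h₅⟩ := SubstRN.comm_of_lt ih hl hx hne h₀₂ h₁ h₁'
      obtain ⟨M₂, h₆, h₇⟩ := SubstN.comm_of_lt ih hl hx hne h₀₂ h₂ h₂'
      have hsize := h₁.size_le
      simp only [STy.size] at hsize
      cases h₄ with
      | lam F' h₄ =>
        obtain ⟨M, G, hM, hG⟩ := (ih α₀ β₂ (by omega)).instantiate hl h₆ h₃ h₄
        exact ⟨M, hM, .beta G h₅ h₇ hG⟩
termination_by structural _ _ _ _ _ _ _ _ _ _ _ _ h => h
end

end

theorem substComm (α₀ α₂ : STy) : SubstComm α₀ α₂ := by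
  induction hn : α₀.size + α₂.size using Nat.strong_induction_on generalizing α₀ α₂ with
  | _ n ih =>
    subst hn
    intro N₀ x₀ N₂ N₂' x₂ N N' N'' hl hx hne h₀₂ hN hN'
    exact SubstN.comm_of_lt (fun β β' hβ => ih _ hβ β β' rfl) hl hx hne h₀₂ hN hN'

/-! ## η-expansion and hereditary substitution -/

mutual
theorem Atm.lcAt_ren {ρ : Var → Var} : ∀ {k} {R : Atm}, R.LcAt k → (R.ren ρ).LcAt k
  | _, .con _, _ => trivial
  | _, .fvar _, _ => trivial
  | _, .bvar _, h => h
  | _, .app _ _, h => ⟨Atm.lcAt_ren h.1, Nrm.lcAt_ren h.2⟩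
theorem Nrm.lcAt_ren {ρ : Var → Var} : ∀ {k} {N : Nrm}, N.LcAt k → (N.ren ρ).LcAt k
  | _, .atm R, h => R.lcAt_ren h
  | _, .lam N, h => N.lcAt_ren h
end

section

variable {N₀ : Nrm} {x₀ : Var} {α₀ : STy}

theorem SubstN.expand_fvar_of_ne (β : STy) {y : Var} (hy : y ≠ x₀) :
    SubstN N₀ x₀ α₀ (expand β (.fvar y)) (expand β (.fvar y)) :=
  .of_notMem _ _ (lcAt_expand β trivial) (by simpa using hy.symm)

theorem SubstRR.expand (β : STy) {R R' : Atm} (hR' : R'.LcAt 0) (h : SubstRR N₀ x₀ α₀ R R') :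
    SubstN N₀ x₀ α₀ (expand β R) (expand β R') := by
  induction β generalizing R R' with
  | base _ => exact .atom h
  | arr β₂ β₁ _ ih₁ =>
    refine .lam {x₀} fun y hy => ?_
    rw [expand_body_opn h.lc_input, expand_body_opn hR']
    exact ih₁ ⟨hR', lcAt_expand β₂ trivial⟩
      (.app h (.expand_fvar_of_ne β₂ (Finset.notMem_singleton.1 hy)))

theorem SubstN.of_expand (β : STy) {R : Atm} {M : Nrm} (h : SubstN N₀ x₀ α₀ (expand β R) M)
    (hR : R.LcAt 0) :
    (∃ R', SubstRR N₀ x₀ α₀ R R') ∨ ∃ N γ, SubstRN N₀ x₀ α₀ R N γ := by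
  induction β generalizing R M with
  | base a =>
    cases h with
    | atom h => exact .inl ⟨_, h⟩
    | atomNorm h => exact .inr ⟨_, _, h⟩
  | arr β₂ β₁ _ ih₁ =>
    cases h with
    | lam F h =>
      obtain ⟨y, hy⟩ := Infinite.exists_notMem_finset F
      have h := h y hy
      rw [expand_body_opn hR] at h
      rcases ih₁ h ⟨hR, lcAt_expand β₂ trivial⟩ with ⟨_, h⟩ | ⟨_, _, h⟩
      · cases h with | app h _ => exact .inl ⟨_, h⟩
      · cases h with | beta _ h _ _ => exact .inr ⟨_, _, h⟩

/-- Substituting `η_α(x)` for `y` renames `y` to `x`. -/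
def ExpandRenames (α : STy) : Prop :=
  ∀ ⦃x y N N'⦄, SubstN (expand α (.fvar x)) y α N N' → N' = N.ren (Function.update id y x)

theorem SubstRN.eq_opn_of_app_expand {β₁ β₂ γ : STy} (hβ₂ : ExpandRenames β₂) {R : Atm}
    {N N' : Nrm} {w : Var} (hw : w ≠ x₀) (h : SubstRN N₀ x₀ α₀ R N (.arr β₂ β₁))
    (h' : SubstRN N₀ x₀ α₀ (.app R (expand β₂ (.fvar w))) N' γ) :
    γ = β₁ ∧ ∃ N₁, N = .lam N₁ ∧ N' = N₁.opn 0 w := by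
  cases h' with
  | @beta _ _ _ _ _ N₁ _ _ _ _ F h₁ h₂ h₃ =>
    cases h.det h₁ with
    | intro hN hβ =>
      cases hβ
      obtain rfl := h₂.det (.expand_fvar_of_ne β₂ hw)
      obtain ⟨u, hu⟩ := Infinite.exists_notMem_finset (F ∪ N₁.fv)
      rw [Finset.notMem_union] at hu
      exact ⟨rfl, N₁, hN, (hβ₂ (h₃ u hu.1)).trans (Nrm.ren_update_opn hu.2)⟩

theorem SubstRN.eq_of_expand (β : STy) (ih : ∀ γ : STy, γ.size < β.size → ExpandRenames γ)
    {R : Atm} {N M : Nrm} (h : SubstRN N₀ x₀ α₀ R N β)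
    (h' : SubstN N₀ x₀ α₀ (LFR.expand β R) M) : M = N := by
  induction β generalizing R N M with
  | base a =>
    cases h' with
    | atom h' => exact (h'.not_substRN h).elim
    | atomNorm h' => exact (h'.det h).1
  | arr β₂ β₁ _ ih₁ =>
    simp only [STy.size] at ih
    cases h' with
    | @lam _ _ _ _ M F h' =>
      obtain ⟨w, hwF, hwx, hwM, hwN⟩ := exists_fresh₄ F {x₀} M.fv N.fv
      have h' := h' w hwF
      rw [expand_body_opn h.lc_input] at h'
      rcases SubstN.of_expand β₁ h' ⟨h.lc_input, lcAt_expand β₂ trivial⟩ with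
        ⟨_, hRR⟩ | ⟨N', γ, hRN⟩
      · cases hRR with | app hRR _ => exact (hRR.not_substRN h).elim
      · obtain ⟨rfl, N₁, rfl, rfl⟩ :=
          h.eq_opn_of_app_expand (ih β₂ (by omega)) (Finset.notMem_singleton.1 hwx) hRN
        have hopn : M.opn 0 w = N₁.opn 0 w := ih₁ (fun δ hδ => ih δ (by omega)) hRN h'
        rw [Nrm.opn_inj (N' := N₁) hwM hwN hopn]

theorem SubstN.eq_of_expand_app {α₁ α₂ : STy}
    (ih : ∀ γ : STy, γ.size < α₂.size → ExpandRenames γ) {R : Atm} {N M : Nrm} {z : Var}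
    (hR : R.LcAt 0) (hz : z ∉ R.fv) (hN : N.LcAt 0)
    (h : SubstN N z α₂ (expand α₁ (.app R (expand α₂ (.fvar z)))) M) :
    M = expand α₁ (.app R N) := by
  have hRR : SubstRR N z α₂ R R := .of_notMem N α₂ hR hz
  rcases SubstN.of_expand α₁ h ⟨hR, lcAt_expand α₂ trivial⟩ with ⟨_, h'⟩ | ⟨_, _, h'⟩
  · cases h' with
    | app _ hη =>
      obtain rfl := SubstRN.var.eq_of_expand α₂ ih hη
      exact h.det ((hRR.app hη).expand α₁ ⟨hR, hN⟩)
  · cases h' with | beta _ hRN _ _ => exact (hRR.not_substRN hRN).elim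

variable {x y : Var} {α : STy}

mutual
theorem SubstN.eq_ren_of_lt : ∀ {N₀ y α N N'} (_ : N₀ = expand α (.fvar x))
    (_ : ∀ γ : STy, γ.size < α.size → ExpandRenames γ), SubstN N₀ y α N N' →
    N' = N.ren (Function.update id y x)
  | _, _, _, _, _, e, ih, .atom h => by rw [SubstRR.eq_ren_of_lt e ih h, Nrm.ren]
  | _, _, _, _, _, e, ih, .atomNorm h => by rw [SubstRN.eq_expand_ren_of_lt e ih h]; rfl
  | _, y, _, .lam N, .lam N', e, ih, .lam F h => by
      obtain ⟨z, hz, hzy, hN', hN⟩ :=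
        exists_fresh₄ F {y} N'.fv (N.ren (Function.update id y x)).fv
      have hopn := SubstN.eq_ren_of_lt e ih (h z hz)
      rw [Nrm.ren_opn, Function.update_of_ne (Finset.notMem_singleton.1 hzy)] at hopn
      rw [Nrm.opn_inj hN' hN hopn, Nrm.ren]
theorem SubstRR.eq_ren_of_lt : ∀ {N₀ y α R R'} (_ : N₀ = expand α (.fvar x))
    (_ : ∀ γ : STy, γ.size < α.size → ExpandRenames γ), SubstRR N₀ y α R R' →
    R' = R.ren (Function.update id y x)
  | _, _, _, _, _, _, _, .var h => by simp [Function.update_of_ne h]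
  | _, _, _, _, _, _, _, .con => rfl
  | _, _, _, _, _, e, ih, .app h₁ h₂ =>
      congrArg₂ Atm.app (SubstRR.eq_ren_of_lt e ih h₁) (SubstN.eq_ren_of_lt e ih h₂)
theorem SubstRN.eq_expand_ren_of_lt : ∀ {N₀ y α R N' β} (_ : N₀ = expand α (.fvar x))
    (_ : ∀ γ : STy, γ.size < α.size → ExpandRenames γ), SubstRN N₀ y α R N' β →
    N' = expand β (R.ren (Function.update id y x))
  | _, _, _, _, _, _, e, _, .var => by simp [e]
  | _, y, α, .app R₁ N₂, N₁', _, e, ih, @SubstRN.beta _ _ _ _ _ _ N₂' _ α₁ α₂ F h₁ h₂ h₃ => by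
      have e₁ := SubstRN.eq_expand_ren_of_lt e ih h₁
      have e₂ := SubstN.eq_ren_of_lt e ih h₂
      have hsize := h₁.size_le
      simp only [STy.size] at hsize
      have hR₁ : (R₁.ren (Function.update id y x)).LcAt 0 := Atm.lcAt_ren h₁.lc_input
      have hN₂ : N₂'.LcAt 0 := e₂ ▸ Nrm.lcAt_ren h₂.lc_input
      obtain ⟨z, hz⟩ := Infinite.exists_notMem_finset (F ∪ (R₁.ren (Function.update id y x)).fv)
      rw [Finset.notMem_union] at hz
      have h₃ := h₃ z hz.1
      rw [Nrm.lam.inj e₁, expand_body_opn hR₁] at h₃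
      rw [SubstN.eq_of_expand_app (fun γ hγ => ih γ (by omega)) hR₁ hz.2 hN₂ h₃, e₂, Atm.ren]
end

theorem expandRenames (α : STy) : ExpandRenames α := by
  induction hn : α.size using Nat.strong_induction_on generalizing α with
  | _ n ih =>
    subst hn
    intro x y N N' h
    exact SubstN.eq_ren_of_lt rfl (fun γ hγ => ih _ hγ γ rfl) h

theorem SubstN.eq_of_expand_fvar {N M : Nrm} (h : SubstN N x α (expand α (.fvar x)) M) : M = N :=
  SubstRN.var.eq_of_expand α (fun γ _ => expandRenames γ) h

theorem SubstN.eq_of_self {N N' : Nrm} (h : SubstN (expand α (.fvar x)) x α N N') : N' = N :=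
  (expandRenames α h).trans <|
    Nrm.ren_eq_self fun _ _ => congrFun (Function.update_eq_self x id) _

theorem SubstN.eq_opn {N N' : Nrm} (hy : y ∉ N.fv)
    (h : SubstN (expand α (.fvar x)) y α (N.opn 0 y) N') : N' = N.opn 0 x :=
  (expandRenames α h).trans (Nrm.ren_update_opn hy)

end

/-! ## Families, kinds, sorts and classes as normal terms -/

/-- An atomic type family as an atomic term. -/
@[simp] def ATy.toAtm : ATy → Atm
  | .con a => .con a
  | .app P N => .app P.toAtm N

/-- A type family as a normal term: a former becomes a constant applied to the encodings of its
arguments. The formers of one category differ in their number of arguments, so that one constant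
suffices, and hereditary substitution into a term with a constant as its head is compositional;
this transfers the properties of hereditary substitution from terms to type families. -/
@[simp] def Ty.toNrm : Ty → Nrm
  | .atm P => .atm (.app (.con 0) (.atm P.toAtm))
  | .pi A B => .atm (.app (.app (.con 0) A.toNrm) (.lam B.toNrm))

/-- An atomic sort family as an atomic term. -/
@[simp] def ASrt.toAtm : ASrt → Atm
  | .con s => .con s
  | .app Q N => .app Q.toAtm N

/-- A sort family as a normal term, encoded in the same way as a type family. -/
@[simp] def Srt.toNrm : Srt → Nrm
  | .atm Q => .atm (.app (.con 0) (.atm Q.toAtm))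
  | .pi S A T => .atm (.app (.app (.app (.con 0) S.toNrm) A.toNrm) (.lam T.toNrm))
  | .top => .atm (.con 0)
  | .inter S₁ S₂ => .atm (.app (.app (.con 0) S₁.toNrm) S₂.toNrm)

/-- A kind as a normal term, encoded in the same way as a type family. -/
@[simp] def Knd.toNrm : Knd → Nrm
  | .type => .atm (.con 0)
  | .pi A K => .atm (.app (.app (.con 0) A.toNrm) (.lam K.toNrm))

/-- A class as a normal term, encoded in the same way as a type family, except that a second
constant separates the two formers without arguments. -/
@[simp] def Cls.toNrm : Cls → Nrm
  | .sort => .atm (.con 0)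
  | .pi S A L => .atm (.app (.app (.app (.con 0) S.toNrm) A.toNrm) (.lam L.toNrm))
  | .top => .atm (.con 1)
  | .inter L₁ L₂ => .atm (.app (.app (.con 0) L₁.toNrm) L₂.toNrm)

section Injectivity

@[simp] theorem ATy.toAtm_inj {P P' : ATy} : P.toAtm = P'.toAtm ↔ P = P' := by
  induction P generalizing P' with
  | con a => cases P' <;> simp
  | app P N ih => cases P' <;> simp [ih]

@[simp] theorem Ty.toNrm_inj {A A' : Ty} : A.toNrm = A'.toNrm ↔ A = A' := by
  induction A generalizing A' with
  | atm P => cases A' <;> simp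
  | pi A B ihA ihB => cases A' <;> simp [ihA, ihB]

@[simp] theorem ASrt.toAtm_inj {Q Q' : ASrt} : Q.toAtm = Q'.toAtm ↔ Q = Q' := by
  induction Q generalizing Q' with
  | con s => cases Q' <;> simp
  | app Q N ih => cases Q' <;> simp [ih]

@[simp] theorem Srt.toNrm_inj {S S' : Srt} : S.toNrm = S'.toNrm ↔ S = S' := by
  induction S generalizing S' with
  | atm Q => cases S' <;> simp
  | pi S A T ihS ihT => cases S' <;> simp [ihS, ihT, and_assoc]
  | top => cases S' <;> simp
  | inter S₁ S₂ ih₁ ih₂ => cases S' <;> simp [ih₁, ih₂]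

@[simp] theorem Knd.toNrm_inj {K K' : Knd} : K.toNrm = K'.toNrm ↔ K = K' := by
  induction K generalizing K' with
  | type => cases K' <;> simp
  | pi A K ih => cases K' <;> simp [ih]

@[simp] theorem Cls.toNrm_inj {L L' : Cls} : L.toNrm = L'.toNrm ↔ L = L' := by
  induction L generalizing L' with
  | sort => cases L' <;> simp
  | pi S A L ih => cases L' <;> simp [ih, and_assoc]
  | top => cases L' <;> simp
  | inter L₁ L₂ ih₁ ih₂ => cases L' <;> simp [ih₁, ih₂]

end Injectivity

section Opening

variable {k : ℕ} {x : Var}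

theorem Nrm.opn_eq_atm {N : Nrm} {R : Atm} :
    N.opn k x = .atm R ↔ ∃ R', N = .atm R' ∧ R'.opn k x = R := by
  cases N <;> simp

theorem Nrm.opn_eq_lam {N N₁ : Nrm} :
    N.opn k x = .lam N₁ ↔ ∃ N', N = .lam N' ∧ N'.opn (k + 1) x = N₁ := by
  cases N <;> simp

theorem Atm.opn_eq_con {R : Atm} {c : TmCon} : R.opn k x = .con c ↔ R = .con c := by
  cases R <;> simp only [opn, reduceCtorEq, iff_self]
  split <;> simp

theorem Atm.opn_eq_app {R R₁ : Atm} {N : Nrm} : R.opn k x = .app R₁ N ↔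
    ∃ R' N', R = .app R' N' ∧ R'.opn k x = R₁ ∧ N'.opn k x = N := by
  cases R <;> simp only [opn, reduceCtorEq, false_and, exists_false, app.injEq]
  · split <;> simp
  · grind

@[simp] theorem ATy.toAtm_opn {P : ATy} : (P.opn k x).toAtm = P.toAtm.opn k x := by
  induction P with
  | con a => rfl
  | app P N ih => simp [ih]

@[simp] theorem Ty.toNrm_opn {A : Ty} : (A.opn k x).toNrm = A.toNrm.opn k x := by
  induction A generalizing k with
  | atm P => simp
  | pi A B ihA ihB => simp [ihA, ihB]

@[simp] theorem ASrt.toAtm_opn {Q : ASrt} : (Q.opn k x).toAtm = Q.toAtm.opn k x := by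
  induction Q with
  | con s => rfl
  | app Q N ih => simp [ih]

@[simp] theorem Srt.toNrm_opn {S : Srt} : (S.opn k x).toNrm = S.toNrm.opn k x := by
  induction S generalizing k with
  | atm Q => simp
  | pi S A T ihS ihT => simp [ihS, ihT]
  | top => rfl
  | inter S₁ S₂ ih₁ ih₂ => simp [ih₁, ih₂]

@[simp] theorem Knd.toNrm_opn {K : Knd} : (K.opn k x).toNrm = K.toNrm.opn k x := by
  induction K generalizing k with
  | type => rfl
  | pi A K ih => simp [ih]

@[simp] theorem Cls.toNrm_opn {L : Cls} : (L.opn k x).toNrm = L.toNrm.opn k x := by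
  induction L generalizing k with
  | sort => rfl
  | pi S A L ih => simp [ih]
  | top => rfl
  | inter L₁ L₂ ih₁ ih₂ => simp [ih₁, ih₂]

theorem ATy.exists_toAtm_eq_of_opn {P : ATy} {R : Atm} (h : R.opn k x = P.toAtm) :
    ∃ P' : ATy, R = P'.toAtm := by
  induction P generalizing R with
  | con a => exact ⟨.con a, Atm.opn_eq_con.1 h⟩
  | app P N ih =>
    obtain ⟨R', N', rfl, hR', -⟩ := Atm.opn_eq_app.1 h
    obtain ⟨P', rfl⟩ := ih hR'
    exact ⟨.app P' N', rfl⟩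

theorem Ty.exists_toNrm_eq_of_opn {A : Ty} {N : Nrm} (h : N.opn k x = A.toNrm) :
    ∃ A' : Ty, N = A'.toNrm := by
  induction A generalizing k N with
  | atm P =>
    simp only [toNrm, Nrm.opn_eq_atm, Atm.opn_eq_app, Atm.opn_eq_con] at h
    obtain ⟨_, rfl, _, _, rfl, rfl, _, rfl, hP⟩ := h
    obtain ⟨P', rfl⟩ := ATy.exists_toAtm_eq_of_opn hP
    exact ⟨.atm P', rfl⟩
  | pi A B ihA ihB =>
    simp only [toNrm, Nrm.opn_eq_atm, Nrm.opn_eq_lam, Atm.opn_eq_app, Atm.opn_eq_con] at h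
    obtain ⟨_, rfl, _, _, rfl, ⟨_, _, rfl, rfl, hA⟩, _, rfl, hB⟩ := h
    obtain ⟨A', rfl⟩ := ihA hA
    obtain ⟨B', rfl⟩ := ihB hB
    exact ⟨.pi A' B', rfl⟩

theorem ASrt.exists_toAtm_eq_of_opn {Q : ASrt} {R : Atm} (h : R.opn k x = Q.toAtm) :
    ∃ Q' : ASrt, R = Q'.toAtm := by
  induction Q generalizing R with
  | con s => exact ⟨.con s, Atm.opn_eq_con.1 h⟩
  | app Q N ih =>
    obtain ⟨R', N', rfl, hR', -⟩ := Atm.opn_eq_app.1 h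
    obtain ⟨Q', rfl⟩ := ih hR'
    exact ⟨.app Q' N', rfl⟩

theorem Srt.exists_toNrm_eq_of_opn {S : Srt} {N : Nrm} (h : N.opn k x = S.toNrm) :
    ∃ S' : Srt, N = S'.toNrm := by
  induction S generalizing k N with
  | atm Q =>
    simp only [toNrm, Nrm.opn_eq_atm, Atm.opn_eq_app, Atm.opn_eq_con] at h
    obtain ⟨_, rfl, _, _, rfl, rfl, _, rfl, hQ⟩ := h
    obtain ⟨Q', rfl⟩ := ASrt.exists_toAtm_eq_of_opn hQ
    exact ⟨.atm Q', rfl⟩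
  | pi S A T ihS ihT =>
    simp only [toNrm, Nrm.opn_eq_atm, Nrm.opn_eq_lam, Atm.opn_eq_app, Atm.opn_eq_con] at h
    obtain ⟨_, rfl, _, _, rfl, ⟨_, _, rfl, ⟨_, _, rfl, rfl, hS⟩, hA⟩, _, rfl, hT⟩ := h
    obtain ⟨S', rfl⟩ := ihS hS
    obtain ⟨A', rfl⟩ := Ty.exists_toNrm_eq_of_opn hA
    obtain ⟨T', rfl⟩ := ihT hT
    exact ⟨.pi S' A' T', rfl⟩
  | top =>
    simp only [toNrm, Nrm.opn_eq_atm, Atm.opn_eq_con] at h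
    obtain ⟨_, rfl, rfl⟩ := h
    exact ⟨.top, rfl⟩
  | inter S₁ S₂ ih₁ ih₂ =>
    simp only [toNrm, Nrm.opn_eq_atm, Atm.opn_eq_app, Atm.opn_eq_con] at h
    obtain ⟨_, rfl, _, _, rfl, ⟨_, _, rfl, rfl, h₁⟩, h₂⟩ := h
    obtain ⟨S₁', rfl⟩ := ih₁ h₁
    obtain ⟨S₂', rfl⟩ := ih₂ h₂
    exact ⟨.inter S₁' S₂', rfl⟩

theorem Knd.exists_toNrm_eq_of_opn {K : Knd} {N : Nrm} (h : N.opn k x = K.toNrm) :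
    ∃ K' : Knd, N = K'.toNrm := by
  induction K generalizing k N with
  | type =>
    simp only [toNrm, Nrm.opn_eq_atm, Atm.opn_eq_con] at h
    obtain ⟨_, rfl, rfl⟩ := h
    exact ⟨.type, rfl⟩
  | pi A K ih =>
    simp only [toNrm, Nrm.opn_eq_atm, Nrm.opn_eq_lam, Atm.opn_eq_app, Atm.opn_eq_con] at h
    obtain ⟨_, rfl, _, _, rfl, ⟨_, _, rfl, rfl, hA⟩, _, rfl, hK⟩ := h
    obtain ⟨A', rfl⟩ := Ty.exists_toNrm_eq_of_opn hA
    obtain ⟨K', rfl⟩ := ih hK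
    exact ⟨.pi A' K', rfl⟩

theorem Cls.exists_toNrm_eq_of_opn {L : Cls} {N : Nrm} (h : N.opn k x = L.toNrm) :
    ∃ L' : Cls, N = L'.toNrm := by
  induction L generalizing k N with
  | sort =>
    simp only [toNrm, Nrm.opn_eq_atm, Atm.opn_eq_con] at h
    obtain ⟨_, rfl, rfl⟩ := h
    exact ⟨.sort, rfl⟩
  | pi S A L ih =>
    simp only [toNrm, Nrm.opn_eq_atm, Nrm.opn_eq_lam, Atm.opn_eq_app, Atm.opn_eq_con] at h
    obtain ⟨_, rfl, _, _, rfl, ⟨_, _, rfl, ⟨_, _, rfl, rfl, hS⟩, hA⟩, _, rfl, hL⟩ := h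
    obtain ⟨S', rfl⟩ := Srt.exists_toNrm_eq_of_opn hS
    obtain ⟨A', rfl⟩ := Ty.exists_toNrm_eq_of_opn hA
    obtain ⟨L', rfl⟩ := ih hL
    exact ⟨.pi S' A' L', rfl⟩
  | top =>
    simp only [toNrm, Nrm.opn_eq_atm, Atm.opn_eq_con] at h
    obtain ⟨_, rfl, rfl⟩ := h
    exact ⟨.top, rfl⟩
  | inter L₁ L₂ ih₁ ih₂ =>
    simp only [toNrm, Nrm.opn_eq_atm, Atm.opn_eq_app, Atm.opn_eq_con] at h
    obtain ⟨_, rfl, _, _, rfl, ⟨_, _, rfl, rfl, h₁⟩, h₂⟩ := h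
    obtain ⟨L₁', rfl⟩ := ih₁ h₁
    obtain ⟨L₂', rfl⟩ := ih₂ h₂
    exact ⟨.inter L₁' L₂', rfl⟩

end Opening

section Substitution

variable {N₀ : Nrm} {x₀ : Var} {α₀ : STy}

/-- The head of an atomic term is a constant, so that hereditary substitution is compositional. -/
inductive Atm.HeadCon : Atm → Prop
  | con {c : TmCon} : HeadCon (.con c)
  | app {R : Atm} {N : Nrm} : HeadCon R → HeadCon (.app R N)

theorem Atm.headCon_app {R : Atm} {N : Nrm} : (Atm.app R N).HeadCon ↔ R.HeadCon :=
  ⟨fun (.app hR) => hR, .app⟩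

theorem Atm.HeadCon.not_substRN {R : Atm} {N : Nrm} {β : STy} :
    R.HeadCon → ¬ SubstRN N₀ x₀ α₀ R N β
  | .app hR, .beta _ h _ _ => hR.not_substRN h

theorem Atm.HeadCon.substN_iff {R : Atm} (hR : R.HeadCon) {M : Nrm} :
    SubstN N₀ x₀ α₀ (.atm R) M ↔ ∃ R', SubstRR N₀ x₀ α₀ R R' ∧ .atm R' = M := by
  refine ⟨fun h => ?_, fun ⟨R', h, e⟩ => e ▸ .atom h⟩
  cases h with
  | atom h => exact ⟨_, h, rfl⟩
  | atomNorm h => exact (hR.not_substRN h).elim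

theorem substRR_con_iff {c : TmCon} {R' : Atm} :
    SubstRR N₀ x₀ α₀ (.con c) R' ↔ .con c = R' :=
  ⟨fun h => by cases h; rfl, fun e => e ▸ .con⟩

theorem substRR_app_iff {R R' : Atm} {N : Nrm} : SubstRR N₀ x₀ α₀ (.app R N) R' ↔
    ∃ R₁, SubstRR N₀ x₀ α₀ R R₁ ∧ ∃ N₁, SubstN N₀ x₀ α₀ N N₁ ∧ .app R₁ N₁ = R' :=
  ⟨fun h => by cases h with | app h₁ h₂ => exact ⟨_, h₁, _, h₂, rfl⟩,
    fun ⟨_, h₁, _, h₂, e⟩ => e ▸ .app h₁ h₂⟩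

@[simp] theorem ATy.headCon_toAtm : ∀ P : ATy, P.toAtm.HeadCon
  | .con _ => .con
  | .app P _ => .app P.headCon_toAtm

@[simp] theorem ASrt.headCon_toAtm : ∀ Q : ASrt, Q.toAtm.HeadCon
  | .con _ => .con
  | .app Q _ => .app Q.headCon_toAtm

/-- The step from the bodies of binders to the binders, for any encoding of bodies as normal terms
that commutes with opening and is closed under its inverse. -/
theorem substN_lam_iff_of_code {β : Type*} {code : β → Nrm} {op : Var → β → β}
    {subst : β → β → Prop} (hinj : ∀ {B B'}, code B = code B' ↔ B = B')
    (hop : ∀ {y B}, code (op y B) = (code B).opn 0 y)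
    (hex : ∀ {y B N}, N.opn 0 y = code B → ∃ B', N = code B') {B : β}
    (ih : ∀ y M, SubstN N₀ x₀ α₀ (code (op y B)) M ↔ ∃ B', subst (op y B) B' ∧ code B' = M)
    {M : Nrm} : SubstN N₀ x₀ α₀ (.lam (code B)) M ↔
      ∃ B', (∃ F : Finset Var, ∀ y, y ∉ F → subst (op y B) (op y B')) ∧ .lam (code B') = M := by
  constructor
  · rintro (_ | _ | ⟨F, h⟩)
    obtain ⟨y, hy⟩ := Infinite.exists_notMem_finset F
    obtain ⟨_, -, e⟩ := (ih y _).1 (hop ▸ h y hy)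
    obtain ⟨B', rfl⟩ := hex e.symm
    refine ⟨B', ⟨F, fun z hz => ?_⟩, rfl⟩
    obtain ⟨_, hB, e⟩ := (ih z _).1 (hop ▸ h z hz)
    rw [← hop, hinj] at e
    exact e ▸ hB
  · rintro ⟨B', ⟨F, h⟩, rfl⟩
    refine .lam F fun y hy => ?_
    rw [← hop, ← hop]
    exact (ih y _).2 ⟨_, h y hy, rfl⟩

theorem substRR_toAtm_iff_substP {P : ATy} {R : Atm} :
    SubstRR N₀ x₀ α₀ P.toAtm R ↔ ∃ P', SubstP N₀ x₀ α₀ P P' ∧ P'.toAtm = R := by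
  induction P generalizing R with
  | con a =>
    simp only [ATy.toAtm, substRR_con_iff]
    exact ⟨fun e => ⟨_, .con, e⟩, fun ⟨_, .con, e⟩ => e⟩
  | app P N ih =>
    simp only [ATy.toAtm, substRR_app_iff, ih]
    exact ⟨fun ⟨_, ⟨_, hP, rfl⟩, _, hN, e⟩ => ⟨_, .app hP hN, e⟩,
      fun ⟨_, .app hP hN, e⟩ => ⟨_, ⟨_, hP, rfl⟩, _, hN, e⟩⟩

theorem substRR_toAtm_iff_substQ {Q : ASrt} {R : Atm} :
    SubstRR N₀ x₀ α₀ Q.toAtm R ↔ ∃ Q', SubstQ N₀ x₀ α₀ Q Q' ∧ Q'.toAtm = R := by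
  induction Q generalizing R with
  | con s =>
    simp only [ASrt.toAtm, substRR_con_iff]
    exact ⟨fun e => ⟨_, .con, e⟩, fun ⟨_, .con, e⟩ => e⟩
  | app Q N ih =>
    simp only [ASrt.toAtm, substRR_app_iff, ih]
    exact ⟨fun ⟨_, ⟨_, hQ, rfl⟩, _, hN, e⟩ => ⟨_, .app hQ hN, e⟩,
      fun ⟨_, .app hQ hN, e⟩ => ⟨_, ⟨_, hQ, rfl⟩, _, hN, e⟩⟩

theorem substN_toNrm_iff_substA : ∀ {A : Ty} {M : Nrm},
    SubstN N₀ x₀ α₀ A.toNrm M ↔ ∃ A', SubstA N₀ x₀ α₀ A A' ∧ A'.toNrm = M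
  | .atm P, M => by
    simp only [Ty.toNrm, Atm.HeadCon.substN_iff, Atm.HeadCon.con, Atm.headCon_app,
      ATy.headCon_toAtm, substRR_app_iff, substRR_con_iff, substRR_toAtm_iff_substP]
    constructor
    · rintro ⟨_, ⟨_, rfl, _, ⟨_, ⟨P', hP, rfl⟩, rfl⟩, rfl⟩, rfl⟩
      exact ⟨_, .atm hP, rfl⟩
    · rintro ⟨_, ⟨hP⟩, rfl⟩
      exact ⟨_, ⟨_, rfl, _, ⟨_, ⟨_, hP, rfl⟩, rfl⟩, rfl⟩, rfl⟩
  | .pi A B, M => by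
    have hB {M} := substN_lam_iff_of_code (M := M) Ty.toNrm_inj Ty.toNrm_opn
      Ty.exists_toNrm_eq_of_opn fun y M => substN_toNrm_iff_substA (A := B.opn 0 y) (M := M)
    simp only [Ty.toNrm, Atm.HeadCon.substN_iff, Atm.HeadCon.con, Atm.headCon_app,
      substRR_app_iff, substRR_con_iff, substN_toNrm_iff_substA (A := A), hB]
    constructor
    · rintro ⟨_, ⟨_, ⟨_, rfl, _, ⟨A', hA, rfl⟩, rfl⟩, _, ⟨B', ⟨F, hB⟩, rfl⟩, rfl⟩, rfl⟩
      exact ⟨_, .pi F hA hB, rfl⟩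
    · rintro ⟨_, _ | ⟨F, hA, hB⟩, rfl⟩
      exact ⟨_, ⟨_, ⟨_, rfl, _, ⟨_, hA, rfl⟩, rfl⟩, _, ⟨_, ⟨F, hB⟩, rfl⟩, rfl⟩, rfl⟩
termination_by A => A.toNrm.size
decreasing_by all_goals simp only [Ty.toNrm_opn, Ty.toNrm, Nrm.size, Atm.size, Nrm.size_opn]; omega

theorem substN_toNrm_iff_substS : ∀ {S : Srt} {M : Nrm},
    SubstN N₀ x₀ α₀ S.toNrm M ↔ ∃ S', SubstS N₀ x₀ α₀ S S' ∧ S'.toNrm = M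
  | .atm Q, M => by
    simp only [Srt.toNrm, Atm.HeadCon.substN_iff, Atm.HeadCon.con, Atm.headCon_app,
      ASrt.headCon_toAtm, substRR_app_iff, substRR_con_iff, substRR_toAtm_iff_substQ]
    constructor
    · rintro ⟨_, ⟨_, rfl, _, ⟨_, ⟨Q', hQ, rfl⟩, rfl⟩, rfl⟩, rfl⟩
      exact ⟨_, .atm hQ, rfl⟩
    · rintro ⟨_, ⟨hQ⟩, rfl⟩
      exact ⟨_, ⟨_, rfl, _, ⟨_, ⟨_, hQ, rfl⟩, rfl⟩, rfl⟩, rfl⟩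
  | .pi S A T, M => by
    have hT {M} := substN_lam_iff_of_code (M := M) Srt.toNrm_inj Srt.toNrm_opn
      Srt.exists_toNrm_eq_of_opn fun y M => substN_toNrm_iff_substS (S := T.opn 0 y) (M := M)
    simp only [Srt.toNrm, Atm.HeadCon.substN_iff, Atm.HeadCon.con, Atm.headCon_app,
      substRR_app_iff, substRR_con_iff, substN_toNrm_iff_substS (S := S), substN_toNrm_iff_substA,
      hT]
    constructor
    · rintro ⟨_, ⟨_, ⟨_, ⟨_, rfl, _, ⟨S', hS, rfl⟩, rfl⟩, _, ⟨A', hA, rfl⟩, rfl⟩,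
        _, ⟨T', ⟨F, hT⟩, rfl⟩, rfl⟩, rfl⟩
      exact ⟨_, .pi F hS hA hT, rfl⟩
    · rintro ⟨_, _ | ⟨F, hS, hA, hT⟩, rfl⟩
      exact ⟨_, ⟨_, ⟨_, ⟨_, rfl, _, ⟨_, hS, rfl⟩, rfl⟩, _, ⟨_, hA, rfl⟩, rfl⟩,
        _, ⟨_, ⟨F, hT⟩, rfl⟩, rfl⟩, rfl⟩
  | .top, M => by
    simp only [Srt.toNrm, Atm.HeadCon.substN_iff, Atm.HeadCon.con, substRR_con_iff]
    constructor
    · rintro ⟨_, rfl, rfl⟩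
      exact ⟨_, .top, rfl⟩
    · rintro ⟨_, ⟨⟩, rfl⟩
      exact ⟨_, rfl, rfl⟩
  | .inter S₁ S₂, M => by
    simp only [Srt.toNrm, Atm.HeadCon.substN_iff, Atm.HeadCon.con, Atm.headCon_app,
      substRR_app_iff, substRR_con_iff, substN_toNrm_iff_substS (S := S₁),
      substN_toNrm_iff_substS (S := S₂)]
    constructor
    · rintro ⟨_, ⟨_, ⟨_, rfl, _, ⟨S₁', h₁, rfl⟩, rfl⟩, _, ⟨S₂', h₂, rfl⟩, rfl⟩, rfl⟩
      exact ⟨_, .inter h₁ h₂, rfl⟩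
    · rintro ⟨_, _ | _ | _ | ⟨h₁, h₂⟩, rfl⟩
      exact ⟨_, ⟨_, ⟨_, rfl, _, ⟨_, h₁, rfl⟩, rfl⟩, _, ⟨_, h₂, rfl⟩, rfl⟩, rfl⟩
termination_by S => S.toNrm.size
decreasing_by
  all_goals simp only [Srt.toNrm_opn, Srt.toNrm, Nrm.size, Atm.size, Nrm.size_opn]; omega

theorem substN_toNrm_iff_substK : ∀ {K : Knd} {M : Nrm},
    SubstN N₀ x₀ α₀ K.toNrm M ↔ ∃ K', SubstK N₀ x₀ α₀ K K' ∧ K'.toNrm = M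
  | .type, M => by
    simp only [Knd.toNrm, Atm.HeadCon.substN_iff, Atm.HeadCon.con, substRR_con_iff]
    constructor
    · rintro ⟨_, rfl, rfl⟩
      exact ⟨_, .type, rfl⟩
    · rintro ⟨_, ⟨⟩, rfl⟩
      exact ⟨_, rfl, rfl⟩
  | .pi A K, M => by
    have hK {M} := substN_lam_iff_of_code (M := M) Knd.toNrm_inj Knd.toNrm_opn
      Knd.exists_toNrm_eq_of_opn fun y M => substN_toNrm_iff_substK (K := K.opn 0 y) (M := M)
    simp only [Knd.toNrm, Atm.HeadCon.substN_iff, Atm.HeadCon.con, Atm.headCon_app,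
      substRR_app_iff, substRR_con_iff, substN_toNrm_iff_substA, hK]
    constructor
    · rintro ⟨_, ⟨_, ⟨_, rfl, _, ⟨A', hA, rfl⟩, rfl⟩, _, ⟨K', ⟨F, hK⟩, rfl⟩, rfl⟩, rfl⟩
      exact ⟨_, .pi F hA hK, rfl⟩
    · rintro ⟨_, _ | ⟨F, hA, hK⟩, rfl⟩
      exact ⟨_, ⟨_, ⟨_, rfl, _, ⟨_, hA, rfl⟩, rfl⟩, _, ⟨_, ⟨F, hK⟩, rfl⟩, rfl⟩, rfl⟩
termination_by K => K.toNrm.size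
decreasing_by simp only [Knd.toNrm_opn, Knd.toNrm, Nrm.size, Atm.size, Nrm.size_opn]; omega

theorem substN_toNrm_iff_substL : ∀ {L : Cls} {M : Nrm},
    SubstN N₀ x₀ α₀ L.toNrm M ↔ ∃ L', SubstL N₀ x₀ α₀ L L' ∧ L'.toNrm = M
  | .sort, M => by
    simp only [Cls.toNrm, Atm.HeadCon.substN_iff, Atm.HeadCon.con, substRR_con_iff]
    constructor
    · rintro ⟨_, rfl, rfl⟩
      exact ⟨_, .sort, rfl⟩
    · rintro ⟨_, ⟨⟩, rfl⟩
      exact ⟨_, rfl, rfl⟩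
  | .pi S A L, M => by
    have hL {M} := substN_lam_iff_of_code (M := M) Cls.toNrm_inj Cls.toNrm_opn
      Cls.exists_toNrm_eq_of_opn fun y M => substN_toNrm_iff_substL (L := L.opn 0 y) (M := M)
    simp only [Cls.toNrm, Atm.HeadCon.substN_iff, Atm.HeadCon.con, Atm.headCon_app,
      substRR_app_iff, substRR_con_iff, substN_toNrm_iff_substS, substN_toNrm_iff_substA, hL]
    constructor
    · rintro ⟨_, ⟨_, ⟨_, ⟨_, rfl, _, ⟨S', hS, rfl⟩, rfl⟩, _, ⟨A', hA, rfl⟩, rfl⟩,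
        _, ⟨L', ⟨F, hL⟩, rfl⟩, rfl⟩, rfl⟩
      exact ⟨_, .pi F hS hA hL, rfl⟩
    · rintro ⟨_, _ | ⟨F, hS, hA, hL⟩, rfl⟩
      exact ⟨_, ⟨_, ⟨_, ⟨_, rfl, _, ⟨_, hS, rfl⟩, rfl⟩, _, ⟨_, hA, rfl⟩, rfl⟩,
        _, ⟨_, ⟨F, hL⟩, rfl⟩, rfl⟩, rfl⟩
  | .top, M => by
    simp only [Cls.toNrm, Atm.HeadCon.substN_iff, Atm.HeadCon.con, substRR_con_iff]
    constructor
    · rintro ⟨_, rfl, rfl⟩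
      exact ⟨_, .top, rfl⟩
    · rintro ⟨_, ⟨⟩, rfl⟩
      exact ⟨_, rfl, rfl⟩
  | .inter L₁ L₂, M => by
    simp only [Cls.toNrm, Atm.HeadCon.substN_iff, Atm.HeadCon.con, Atm.headCon_app,
      substRR_app_iff, substRR_con_iff, substN_toNrm_iff_substL (L := L₁),
      substN_toNrm_iff_substL (L := L₂)]
    constructor
    · rintro ⟨_, ⟨_, ⟨_, rfl, _, ⟨L₁', h₁, rfl⟩, rfl⟩, _, ⟨L₂', h₂, rfl⟩, rfl⟩, rfl⟩
      exact ⟨_, .inter h₁ h₂, rfl⟩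
    · rintro ⟨_, _ | _ | _ | ⟨h₁, h₂⟩, rfl⟩
      exact ⟨_, ⟨_, ⟨_, rfl, _, ⟨_, h₁, rfl⟩, rfl⟩, _, ⟨_, h₂, rfl⟩, rfl⟩, rfl⟩
termination_by L => L.toNrm.size
decreasing_by
  all_goals simp only [Cls.toNrm_opn, Cls.toNrm, Nrm.size, Atm.size, Nrm.size_opn]; omega

theorem substA_iff {A A' : Ty} :
    SubstA N₀ x₀ α₀ A A' ↔ SubstN N₀ x₀ α₀ A.toNrm A'.toNrm := by
  simp [substN_toNrm_iff_substA]

theorem substS_iff {S S' : Srt} :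
    SubstS N₀ x₀ α₀ S S' ↔ SubstN N₀ x₀ α₀ S.toNrm S'.toNrm := by
  simp [substN_toNrm_iff_substS]

theorem substK_iff {K K' : Knd} :
    SubstK N₀ x₀ α₀ K K' ↔ SubstN N₀ x₀ α₀ K.toNrm K'.toNrm := by
  simp [substN_toNrm_iff_substK]

theorem substL_iff {L L' : Cls} :
    SubstL N₀ x₀ α₀ L L' ↔ SubstN N₀ x₀ α₀ L.toNrm L'.toNrm := by
  simp [substN_toNrm_iff_substL]
end Substitution

section

variable {N₀ N₂ N₂' : Nrm} {x₀ : Var} {α₀ α₂ : STy} {F F' : Finset Var}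

theorem SubstQ.det {Q Q' Q'' : ASrt} (h : SubstQ N₀ x₀ α₀ Q Q') (h' : SubstQ N₀ x₀ α₀ Q Q'') :
    Q' = Q'' :=
  ASrt.toAtm_inj.1 <|
    (substRR_toAtm_iff_substQ.2 ⟨_, h, rfl⟩).det (substRR_toAtm_iff_substQ.2 ⟨_, h', rfl⟩)

theorem SubstA.det {A A' A'' : Ty} (h : SubstA N₀ x₀ α₀ A A') (h' : SubstA N₀ x₀ α₀ A A'') :
    A' = A'' :=
  Ty.toNrm_inj.1 ((substA_iff.1 h).det (substA_iff.1 h'))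

theorem SubstS.det {S S' S'' : Srt} (h : SubstS N₀ x₀ α₀ S S') (h' : SubstS N₀ x₀ α₀ S S'') :
    S' = S'' :=
  Srt.toNrm_inj.1 ((substS_iff.1 h).det (substS_iff.1 h'))

theorem SubstA.lc_output {A A' : Ty} (h : SubstA N₀ x₀ α₀ A A') (h₀ : N₀.LcAt 0) :
    A'.toNrm.LcAt 0 :=
  (substA_iff.1 h).lc_output h₀

theorem SubstS.lc_output {S S' : Srt} (h : SubstS N₀ x₀ α₀ S S') (h₀ : N₀.LcAt 0) :
    S'.toNrm.LcAt 0 :=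
  (substS_iff.1 h).lc_output h₀

theorem SubstA.of_notMem (N₀ : Nrm) (α₀ : STy) {A : Ty} (h : A.toNrm.LcAt 0)
    (hx : x₀ ∉ A.toNrm.fv) : SubstA N₀ x₀ α₀ A A :=
  substA_iff.2 (.of_notMem N₀ α₀ h hx)

theorem SubstS.of_notMem (N₀ : Nrm) (α₀ : STy) {S : Srt} (h : S.toNrm.LcAt 0)
    (hx : x₀ ∉ S.toNrm.fv) : SubstS N₀ x₀ α₀ S S :=
  substS_iff.2 (.of_notMem N₀ α₀ h hx)

theorem SubstK.of_notMem (N₀ : Nrm) (α₀ : STy) {K : Knd} (h : K.toNrm.LcAt 0)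
    (hx : x₀ ∉ K.toNrm.fv) : SubstK N₀ x₀ α₀ K K :=
  substK_iff.2 (.of_notMem N₀ α₀ h hx)

theorem SubstL.of_notMem (N₀ : Nrm) (α₀ : STy) {L : Cls} (h : L.toNrm.LcAt 0)
    (hx : x₀ ∉ L.toNrm.fv) : SubstL N₀ x₀ α₀ L L :=
  substL_iff.2 (.of_notMem N₀ α₀ h hx)

theorem SubstA.instantiate {B B' Br : Ty} (h₀ : N₀.LcAt 0) (h₀₂ : SubstN N₀ x₀ α₀ N₂ N₂')
    (h : ∀ x, x ∉ F → SubstA N₂ x α₂ (B.opn 0 x) Br)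
    (h' : ∀ x, x ∉ F' → SubstA N₀ x₀ α₀ (B.opn 0 x) (B'.opn 0 x)) :
    ∃ (M : Ty) (G : Finset Var), SubstA N₀ x₀ α₀ Br M ∧
      ∀ x, x ∉ G → SubstA N₂' x α₂ (B'.opn 0 x) M := by
  simp only [substA_iff, Ty.toNrm_opn] at h h' ⊢
  obtain ⟨_, G, hM, hG⟩ := (substComm α₀ α₂).instantiate h₀ h₀₂ h h'
  obtain ⟨M, -, rfl⟩ := substN_toNrm_iff_substA.1 hM
  exact ⟨M, G, hM, hG⟩

theorem SubstS.instantiate {T T' Tr : Srt} (h₀ : N₀.LcAt 0) (h₀₂ : SubstN N₀ x₀ α₀ N₂ N₂')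
    (h : ∀ x, x ∉ F → SubstS N₂ x α₂ (T.opn 0 x) Tr)
    (h' : ∀ x, x ∉ F' → SubstS N₀ x₀ α₀ (T.opn 0 x) (T'.opn 0 x)) :
    ∃ (M : Srt) (G : Finset Var), SubstS N₀ x₀ α₀ Tr M ∧
      ∀ x, x ∉ G → SubstS N₂' x α₂ (T'.opn 0 x) M := by
  simp only [substS_iff, Srt.toNrm_opn] at h h' ⊢
  obtain ⟨_, G, hM, hG⟩ := (substComm α₀ α₂).instantiate h₀ h₀₂ h h'
  obtain ⟨M, -, rfl⟩ := substN_toNrm_iff_substS.1 hM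
  exact ⟨M, G, hM, hG⟩

theorem SubstK.instantiate {K K' Kr : Knd} (h₀ : N₀.LcAt 0) (h₀₂ : SubstN N₀ x₀ α₀ N₂ N₂')
    (h : ∀ x, x ∉ F → SubstK N₂ x α₂ (K.opn 0 x) Kr)
    (h' : ∀ x, x ∉ F' → SubstK N₀ x₀ α₀ (K.opn 0 x) (K'.opn 0 x)) :
    ∃ (M : Knd) (G : Finset Var), SubstK N₀ x₀ α₀ Kr M ∧
      ∀ x, x ∉ G → SubstK N₂' x α₂ (K'.opn 0 x) M := by
  simp only [substK_iff, Knd.toNrm_opn] at h h' ⊢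
  obtain ⟨_, G, hM, hG⟩ := (substComm α₀ α₂).instantiate h₀ h₀₂ h h'
  obtain ⟨M, -, rfl⟩ := substN_toNrm_iff_substK.1 hM
  exact ⟨M, G, hM, hG⟩

theorem SubstL.instantiate {L L' Lr : Cls} (h₀ : N₀.LcAt 0) (h₀₂ : SubstN N₀ x₀ α₀ N₂ N₂')
    (h : ∀ x, x ∉ F → SubstL N₂ x α₂ (L.opn 0 x) Lr)
    (h' : ∀ x, x ∉ F' → SubstL N₀ x₀ α₀ (L.opn 0 x) (L'.opn 0 x)) :
    ∃ (M : Cls) (G : Finset Var), SubstL N₀ x₀ α₀ Lr M ∧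
      ∀ x, x ∉ G → SubstL N₂' x α₂ (L'.opn 0 x) M := by
  simp only [substL_iff, Cls.toNrm_opn] at h h' ⊢
  obtain ⟨_, G, hM, hG⟩ := (substComm α₀ α₂).instantiate h₀ h₀₂ h h'
  obtain ⟨M, -, rfl⟩ := substN_toNrm_iff_substL.1 hM
  exact ⟨M, G, hM, hG⟩

theorem SubstN.exists_lam {p : Var → Nrm → Prop} (h₀ : N₀.LcAt 0) {N : Nrm}
    (h : ∀ y, y ∉ F → ∃ N', SubstN N₀ x₀ α₀ (N.opn 0 y) N' ∧ p y N') :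
    ∃ N', SubstN N₀ x₀ α₀ (.lam N) (.lam N') ∧
      ∃ F' : Finset Var, ∀ y, y ∉ F' → p y (N'.opn 0 y) := by
  obtain ⟨N', F', h'⟩ := exists_opn h₀ h
  exact ⟨N', .lam F' fun y hy => (h' y hy).1, F', fun y hy => (h' y hy).2⟩

theorem SubstA.exists_pi {p : Var → Ty → Prop} (h₀ : N₀.LcAt 0) {A A' B : Ty}
    (hA : SubstA N₀ x₀ α₀ A A')
    (h : ∀ y, y ∉ F → ∃ B', SubstA N₀ x₀ α₀ (B.opn 0 y) B' ∧ p y B') :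
    ∃ B', SubstA N₀ x₀ α₀ (.pi A B) (.pi A' B') ∧
      ∃ F' : Finset Var, ∀ y, y ∉ F' → p y (B'.opn 0 y) := by
  obtain ⟨M, F', h'⟩ := SubstN.exists_opn (p := fun y M => ∃ B', B'.toNrm = M ∧ p y B') h₀
    fun y hy => by
      obtain ⟨B', hB, hp⟩ := h y hy
      exact ⟨_, Ty.toNrm_opn ▸ substA_iff.1 hB, B', rfl, hp⟩
  obtain ⟨y, hy⟩ := Infinite.exists_notMem_finset F'
  obtain ⟨-, _, e, -⟩ := h' y hy
  obtain ⟨B', rfl⟩ := Ty.exists_toNrm_eq_of_opn e.symm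
  simp only [← Ty.toNrm_opn, ← substA_iff, Ty.toNrm_inj, exists_eq_left] at h'
  exact ⟨B', .pi F' hA fun y hy => (h' y hy).1, F', fun y hy => (h' y hy).2⟩

theorem SubstS.exists_pi {p : Var → Srt → Prop} (h₀ : N₀.LcAt 0) {S S' T : Srt} {A A' : Ty}
    (hS : SubstS N₀ x₀ α₀ S S') (hA : SubstA N₀ x₀ α₀ A A')
    (h : ∀ y, y ∉ F → ∃ T', SubstS N₀ x₀ α₀ (T.opn 0 y) T' ∧ p y T') :
    ∃ T', SubstS N₀ x₀ α₀ (.pi S A T) (.pi S' A' T') ∧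
      ∃ F' : Finset Var, ∀ y, y ∉ F' → p y (T'.opn 0 y) := by
  obtain ⟨M, F', h'⟩ := SubstN.exists_opn (p := fun y M => ∃ T', T'.toNrm = M ∧ p y T') h₀
    fun y hy => by
      obtain ⟨T', hT, hp⟩ := h y hy
      exact ⟨_, Srt.toNrm_opn ▸ substS_iff.1 hT, T', rfl, hp⟩
  obtain ⟨y, hy⟩ := Infinite.exists_notMem_finset F'
  obtain ⟨-, _, e, -⟩ := h' y hy
  obtain ⟨T', rfl⟩ := Srt.exists_toNrm_eq_of_opn e.symm
  simp only [← Srt.toNrm_opn, ← substS_iff, Srt.toNrm_inj, exists_eq_left] at h'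
  exact ⟨T', .pi F' hS hA fun y hy => (h' y hy).1, F', fun y hy => (h' y hy).2⟩

theorem SubstP.simple_eq {P P' : ATy} (h : SubstP N₀ x₀ α₀ P P') : P'.simple = P.simple := by
  induction h with
  | con => rfl
  | app _ _ ih => exact ih

theorem ATy.simple_opn {P : ATy} {k : ℕ} {x : Var} : (P.opn k x).simple = P.simple := by
  induction P with
  | con => rfl
  | app _ _ ih => exact ih

@[simp] theorem Ty.simple_opn {A : Ty} {x : Var} : ∀ {k}, (A.opn k x).simple = A.simple := by
  induction A with
  | atm P => exact P.simple_opn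
  | pi A B ihA ihB => exact congrArg₂ STy.arr ihA ihB

theorem SubstA.simple_eq {A A' : Ty} (h : SubstA N₀ x₀ α₀ A A') : A'.simple = A.simple := by
  induction h with
  | atm h => exact h.simple_eq
  | pi F _ _ ihA ihB =>
    obtain ⟨y, hy⟩ := Infinite.exists_notMem_finset F
    exact congrArg₂ STy.arr ihA (by simpa only [Ty.simple_opn] using ihB y hy)

theorem ATy.exists_simple_eq (P : ATy) : ∃ a, P.simple = .base a := by
  induction P with
  | con a => exact ⟨a, rfl⟩
  | app _ _ ih => exact ih

end

section

variable {x y : Var} {α : STy}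

theorem SubstA.eq_of_self {A A' : Ty} (h : SubstA (expand α (.fvar x)) x α A A') : A' = A :=
  Ty.toNrm_inj.1 (substA_iff.1 h).eq_of_self

theorem SubstS.eq_of_self {S S' : Srt} (h : SubstS (expand α (.fvar x)) x α S S') : S' = S :=
  Srt.toNrm_inj.1 (substS_iff.1 h).eq_of_self

theorem SubstA.eq_opn {B B' : Ty} (hy : y ∉ B.toNrm.fv)
    (h : SubstA (expand α (.fvar x)) y α (B.opn 0 y) B') : B' = B.opn 0 x :=
  Ty.toNrm_inj.1 <| Ty.toNrm_opn ▸ SubstN.eq_opn hy (Ty.toNrm_opn ▸ substA_iff.1 h)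

theorem SubstS.eq_opn {T T' : Srt} (hy : y ∉ T.toNrm.fv)
    (h : SubstS (expand α (.fvar x)) y α (T.opn 0 y) T') : T' = T.opn 0 x :=
  Srt.toNrm_inj.1 <| Srt.toNrm_opn ▸ SubstN.eq_opn hy (Srt.toNrm_opn ▸ substS_iff.1 h)

end

/-! ## Weakening -/

section
variable {Sg : Sig}

mutual
theorem SynthTy.weaken : ∀ {Γ Δ R A}, SynthTy Sg Γ R A → Γ ⊆ Δ → SynthTy Sg Δ R A
  | _, _, _, _, .con h, _ => .con h
  | _, _, _, _, .var h, hs => .var (hs h)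
  | _, _, _, _, .app F h₁ h₂ h₃, hs => .app F (h₁.weaken hs) (h₂.weaken hs) h₃
theorem CheckTy.weaken : ∀ {Γ Δ N A}, CheckTy Sg Γ N A → Γ ⊆ Δ → CheckTy Sg Δ N A
  | _, _, _, _, .atm h, hs => .atm (h.weaken hs)
  | _, _, _, _, .lam F h, hs => .lam F fun x hx => (h x hx).weaken (List.cons_subset_cons _ hs)
end

theorem SynthKnd.weaken {Γ Δ P K} (h : SynthKnd Sg Γ P K) (hs : Γ ⊆ Δ) : SynthKnd Sg Δ P K := by
  induction h with
  | con h => exact .con h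
  | app F _ h₂ h₃ ih => exact .app F ih (h₂.weaken hs) h₃

theorem IsType.weaken {Γ Δ A} (h : IsType Sg Γ A) (hs : Γ ⊆ Δ) : IsType Sg Δ A := by
  induction h generalizing Δ with
  | atm h => exact .atm (h.weaken hs)
  | pi F _ _ ihA ihB => exact .pi F (ihA hs) fun x hx => ihB x hx (List.cons_subset_cons _ hs)

mutual
theorem Synth.weaken : ∀ {Γ Δ R S}, Synth Sg Γ R S → Γ ⊆ Δ → Synth Sg Δ R S
  | _, _, _, _, .con h, _ => .con h
  | _, _, _, _, .var h, hs => .var (hs h)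
  | _, _, _, _, .app F h₁ h₂ h₃, hs => .app F (h₁.weaken hs) (h₂.weaken hs) h₃
  | _, _, _, _, .interL h, hs => .interL (h.weaken hs)
  | _, _, _, _, .interR h, hs => .interR (h.weaken hs)
theorem Check.weaken : ∀ {Γ Δ N S}, Check Sg Γ N S → Γ ⊆ Δ → Check Sg Δ N S
  | _, _, _, _, .switch h hle, hs => .switch (h.weaken hs) hle
  | _, _, _, _, .lam F h, hs => .lam F fun x hx => (h x hx).weaken (List.cons_subset_cons _ hs)
  | _, _, _, _, .top, _ => .top
  | _, _, _, _, .inter h₁ h₂, hs => .inter (h₁.weaken hs) (h₂.weaken hs)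
end

theorem SynthCls.weaken {Γ Δ Q P L} (h : SynthCls Sg Γ Q P L) (hs : Γ ⊆ Δ) :
    SynthCls Sg Δ Q P L := by
  induction h with
  | con h => exact .con h
  | app F _ h₂ h₃ ih => exact .app F ih (h₂.weaken hs) h₃
  | interL _ ih => exact .interL ih
  | interR _ ih => exact .interR ih

theorem Refines.weaken {Γ Δ S A} (h : Refines Sg Γ S A) (hs : Γ ⊆ Δ) : Refines Sg Δ S A := by
  induction h generalizing Δ with
  | atm h => exact .atm (h.weaken hs)
  | pi F _ _ ihS ihT => exact .pi F (ihS hs) fun x hx => ihT x hx (List.cons_subset_cons _ hs)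
  | top => exact .top
  | inter _ _ ih₁ ih₂ => exact .inter (ih₁ hs) (ih₂ hs)

theorem Ctx.erase_subset {Γ Δ : Ctx} (hs : Γ ⊆ Δ) : Γ.erase ⊆ Δ.erase :=
  List.map_subset _ hs

theorem RefinesTy.weaken {Γ Δ S A} (h : RefinesTy Sg Γ S A) (hs : Γ ⊆ Δ) : RefinesTy Sg Δ S A :=
  ⟨h.1.weaken (Ctx.erase_subset hs), h.2.weaken hs⟩


/-! ## Scoping -/

/-- The names declared in an LF context. -/
@[simp] def LFCtx.names : LFCtx → Finset Var
  | [] => ∅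
  | (x, _) :: Γ => insert x (LFCtx.names Γ)

theorem LFCtx.mem_names {Γ : LFCtx} {x : Var} {A : Ty} (h : (x, A) ∈ Γ) : x ∈ Γ.names := by
  induction Γ with
  | nil => cases h
  | cons d Γ ih =>
    rcases List.mem_cons.1 h with rfl | h
    · exact Finset.mem_insert_self _ _
    · exact Finset.mem_insert_of_mem (ih h)

theorem Nrm.fv_subset_of_opn {N : Nrm} {x : Var} {s : Finset Var} (hx : x ∉ N.fv)
    (h : (N.opn 0 x).fv ⊆ insert x s) : N.fv ⊆ s :=
  (Finset.subset_insert_iff_of_notMem hx).1 (fv_subset_fv_opn.trans h)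

mutual
theorem SynthTy.scoped : ∀ {Γ R A}, SynthTy Sg Γ R A → R.LcAt 0 ∧ R.fv ⊆ Γ.names
  | _, _, _, .con _ => ⟨trivial, Finset.empty_subset _⟩
  | _, _, _, .var h => ⟨trivial, Finset.singleton_subset_iff.2 (LFCtx.mem_names h)⟩
  | _, _, _, .app _ h₁ h₂ _ =>
      ⟨⟨h₁.scoped.1, h₂.scoped.1⟩, Finset.union_subset h₁.scoped.2 h₂.scoped.2⟩
theorem CheckTy.scoped : ∀ {Γ N A}, CheckTy Sg Γ N A → N.LcAt 0 ∧ N.fv ⊆ Γ.names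
  | _, _, _, .atm h => h.scoped
  | _, .lam N, _, .lam F h => by
      obtain ⟨x, hx⟩ := Infinite.exists_notMem_finset (F ∪ N.fv)
      obtain ⟨hx, hN⟩ := Finset.notMem_union.1 hx
      have hopn := (h x hx).scoped
      exact ⟨Nrm.lcAt_opn.1 hopn.1, Nrm.fv_subset_of_opn (N := N) hN hopn.2⟩
end

theorem SynthKnd.scoped {Γ P K} (h : SynthKnd Sg Γ P K) :
    P.toAtm.LcAt 0 ∧ P.toAtm.fv ⊆ Γ.names := by
  induction h with
  | con => exact ⟨trivial, Finset.empty_subset _⟩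
  | app _ _ h _ ih => exact ⟨⟨ih.1, h.scoped.1⟩, Finset.union_subset ih.2 h.scoped.2⟩

theorem IsType.scoped {Γ A} (h : IsType Sg Γ A) :
    A.toNrm.LcAt 0 ∧ A.toNrm.fv ⊆ Γ.names := by
  induction h with
  | atm h => simpa using h.scoped
  | @pi _ _ B F _ _ ihA ihB =>
    obtain ⟨x, hx⟩ := Infinite.exists_notMem_finset (F ∪ B.toNrm.fv)
    obtain ⟨hx, hB⟩ := Finset.notMem_union.1 hx
    have hopn := ihB x hx
    rw [Ty.toNrm_opn] at hopn
    simpa [ihA, Finset.union_subset_iff] using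
      And.intro (Nrm.lcAt_opn.1 hopn.1) (Nrm.fv_subset_of_opn hB hopn.2)

theorem IsKnd.scoped {Γ K} (h : IsKnd Sg Γ K) : K.toNrm.LcAt 0 ∧ K.toNrm.fv ⊆ Γ.names := by
  induction h with
  | type => simp
  | @pi _ _ K F hA _ ih =>
    obtain ⟨x, hx⟩ := Infinite.exists_notMem_finset (F ∪ K.toNrm.fv)
    obtain ⟨hx, hK⟩ := Finset.notMem_union.1 hx
    have hopn := ih x hx
    rw [Knd.toNrm_opn] at hopn
    simpa [hA.scoped, Finset.union_subset_iff] using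
      And.intro (Nrm.lcAt_opn.1 hopn.1) (Nrm.fv_subset_of_opn hK hopn.2)

theorem SynthCls.scoped {Γ Q P L} (h : SynthCls Sg Γ Q P L) :
    (P.toAtm.LcAt 0 → Q.toAtm.LcAt 0) ∧ Q.toAtm.fv ⊆ P.toAtm.fv := by
  induction h with
  | con => simp
  | app _ _ _ _ ih => exact ⟨fun h => ⟨ih.1 h.1, h.2⟩, Finset.union_subset_union_left ih.2⟩
  | interL _ ih => exact ih
  | interR _ ih => exact ih

theorem Refines.scoped {Γ S A} (h : Refines Sg Γ S A) :
    (A.toNrm.LcAt 0 → S.toNrm.LcAt 0) ∧ S.toNrm.fv ⊆ A.toNrm.fv := by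
  induction h with
  | atm h => simpa using h.scoped
  | @pi _ _ A T B F _ _ ihS ihT =>
    obtain ⟨x, hx⟩ := Infinite.exists_notMem_finset (F ∪ T.toNrm.fv)
    obtain ⟨hx, hT⟩ := Finset.notMem_union.1 hx
    have hopn := ihT x hx
    simp only [Ty.toNrm_opn, Srt.toNrm_opn, Nrm.lcAt_opn] at hopn
    have hTB := Nrm.fv_subset_of_opn hT (hopn.2.trans Nrm.fv_opn_subset)
    simp only [Srt.toNrm, Ty.toNrm, Nrm.LcAt, Atm.LcAt, true_and, Nrm.fv, Atm.fv,
      Finset.empty_union]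
    exact ⟨fun h => ⟨⟨ihS.1 h.1, h.1⟩, hopn.1 h.2⟩,
      Finset.union_subset_union (Finset.union_subset ihS.2 subset_rfl) hTB⟩
  | top => simp
  | inter _ _ ih₁ ih₂ =>
    simp only [Srt.toNrm, Nrm.LcAt, Atm.LcAt, true_and, Nrm.fv, Atm.fv, Finset.empty_union]
    exact ⟨fun h => ⟨ih₁.1 h, ih₂.1 h⟩, Finset.union_subset ih₁.2 ih₂.2⟩

theorem RefinesCls.scoped {Γ L K} (h : RefinesCls Sg Γ L K) :
    (K.toNrm.LcAt 0 → L.toNrm.LcAt 0) ∧ L.toNrm.fv ⊆ K.toNrm.fv := by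
  induction h with
  | sort => simp
  | @pi _ _ A L K F hS _ ih =>
    obtain ⟨x, hx⟩ := Infinite.exists_notMem_finset (F ∪ L.toNrm.fv)
    obtain ⟨hx, hL⟩ := Finset.notMem_union.1 hx
    have hopn := ih x hx
    simp only [Knd.toNrm_opn, Cls.toNrm_opn, Nrm.lcAt_opn] at hopn
    have hLK := Nrm.fv_subset_of_opn hL (hopn.2.trans Nrm.fv_opn_subset)
    simp only [Cls.toNrm, Knd.toNrm, Nrm.LcAt, Atm.LcAt, true_and, Nrm.fv, Atm.fv,
      Finset.empty_union]
    exact ⟨fun h => ⟨⟨hS.scoped.1 h.1, h.1⟩, hopn.1 h.2⟩,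
      Finset.union_subset_union (Finset.union_subset hS.scoped.2 subset_rfl) hLK⟩
  | top => simp
  | inter _ _ ih₁ ih₂ =>
    simp only [Cls.toNrm, Nrm.LcAt, Atm.LcAt, true_and, Nrm.fv, Atm.fv, Finset.empty_union]
    exact ⟨fun h => ⟨ih₁.1 h, ih₂.1 h⟩, Finset.union_subset ih₁.2 ih₂.2⟩

theorem Ctx.mem_names_erase {Γ : Ctx} {x : Var} : x ∈ Γ.erase.names ↔ x ∈ Γ.dom := by
  induction Γ with
  | nil => simp [erase, dom]
  | cons d Γ ih => simpa [erase, dom] using or_congr_right ih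

theorem RefinesTy.lcAt {Γ S A} (h : RefinesTy Sg Γ S A) : S.toNrm.LcAt 0 ∧ A.toNrm.LcAt 0 :=
  ⟨h.2.scoped.1 h.1.scoped.1, h.1.scoped.1⟩

theorem RefinesTy.notMem_fv {Γ S A x} (h : RefinesTy Sg Γ S A) (hx : x ∉ Γ.dom) :
    x ∉ S.toNrm.fv ∧ x ∉ A.toNrm.fv :=
  have hA : x ∉ A.toNrm.fv := fun hm => hx (Ctx.mem_names_erase.1 (h.1.scoped.2 hm))
  ⟨fun hm => hA (h.2.scoped.2 hm), hA⟩

end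

/-- A normal term without free variables or loose de Bruijn indices. -/
def Nrm.Closed (N : Nrm) : Prop := N.LcAt 0 ∧ N.fv = ∅

theorem Nrm.Closed.notMem_fv {N : Nrm} (h : N.Closed) {x : Var} : x ∉ N.fv :=
  h.2 ▸ Finset.notMem_empty x

/-- The classifier in a signature declaration is closed. -/
def Decl.Closed : Decl → Prop
  | .tyKind _ K => K.toNrm.Closed
  | .tmType _ A => A.toNrm.Closed
  | .srtRef _ _ L => L.toNrm.Closed
  | .subsort _ _ => True
  | .tmSort _ S => S.toNrm.Closed

/-- Everything declared in the signature is closed. -/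
def Sig.Closed (Sg : Sig) : Prop := ∀ d ∈ Sg, d.Closed

theorem WfSig.closed {Sg : Sig} (h : WfSig Sg) : Sg.Closed := by
  induction h with
  | nil => exact List.forall_mem_nil _
  | tyKind _ hK _ ih =>
    exact List.forall_mem_cons.2 ⟨hK.scoped.imp_right Finset.subset_empty.1, ih⟩
  | tmType _ hA _ ih =>
    exact List.forall_mem_cons.2 ⟨hA.scoped.imp_right Finset.subset_empty.1, ih⟩
  | srtRef _ hK hL _ ih =>
    have ⟨hlc, hfv⟩ : Nrm.Closed _ := ih _ hK
    exact List.forall_mem_cons.2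
      ⟨⟨hL.scoped.1 hlc, Finset.subset_empty.1 (hfv ▸ hL.scoped.2)⟩, ih⟩
  | tmSort _ hA hS _ ih =>
    have ⟨hlc, hfv⟩ : Nrm.Closed _ := ih _ hA
    exact List.forall_mem_cons.2
      ⟨⟨hS.scoped.1 hlc, Finset.subset_empty.1 (hfv ▸ hS.scoped.2)⟩, ih⟩
  | subsort _ _ _ ih => exact List.forall_mem_cons.2 ⟨trivial, ih⟩

/-! ## Substitution in LF judgments -/

section
variable {Γ Δ : LFCtx} {N₀ : Nrm} {x x₀ : Var} {α₀ : STy} {A A' : Ty}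

/-- The names that occur in an LF context, declared or in a type. -/
@[simp] def LFCtx.fv : LFCtx → Finset Var
  | [] => ∅
  | (x, A) :: Γ => {x} ∪ A.toNrm.fv ∪ LFCtx.fv Γ

theorem LFCtx.mem_fv (h : (x, A) ∈ Γ) : x ∈ Γ.fv ∧ A.toNrm.fv ⊆ Γ.fv := by
  induction Γ with
  | nil => cases h
  | cons d Γ ih =>
    rcases List.mem_cons.1 h with rfl | h
    · exact ⟨by simp, fun v hv => by simp [hv]⟩
    · exact ⟨by simp [(ih h).1], fun v hv => by simp [(ih h).2 hv]⟩

theorem LFCtx.names_subset_fv : Γ.names ⊆ Γ.fv := by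
  induction Γ with
  | nil => exact subset_rfl
  | cons d Γ ih =>
    exact Finset.insert_subset (by simp) (ih.trans Finset.subset_union_right)

/-- All declared types are locally closed. -/
def LFCtx.Lc (Γ : LFCtx) : Prop := ∀ ⦃x A⦄, (x, A) ∈ Γ → A.toNrm.LcAt 0

theorem LFCtx.Lc.cons (h : Γ.Lc) (hA : A.toNrm.LcAt 0) : LFCtx.Lc ((x, A) :: Γ) := by
  intro y B hy
  rcases List.mem_cons.1 hy with e | hy
  · cases e
    exact hA
  · exact h hy

/-- The substitution `[N₀/x₀]` sends the declarations of `Γ` to declarations of `Δ`, except those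
of `x₀`, for which `N₀` is a well-typed instance in `Δ`.  The name `x₀` may be declared in `Δ`. -/
def LFSubstMap (Sg : Sig) (N₀ : Nrm) (x₀ : Var) (α₀ : STy) (Γ Δ : LFCtx) : Prop :=
  ∀ ⦃y A⦄, (y, A) ∈ Γ → ∃ A', SubstA N₀ x₀ α₀ A A' ∧
    (y ≠ x₀ ∧ (y, A') ∈ Δ ∨ y = x₀ ∧ A.simple = α₀ ∧ CheckTy Sg Δ N₀ A')

variable {Sg : Sig}

theorem LFSubstMap.cons (h : LFSubstMap Sg N₀ x₀ α₀ Γ Δ) (hx : x ≠ x₀)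
    (hA : SubstA N₀ x₀ α₀ A A') : LFSubstMap Sg N₀ x₀ α₀ ((x, A) :: Γ) ((x, A') :: Δ) := by
  intro y B hy
  rcases List.mem_cons.1 hy with e | hy
  · cases e
    exact ⟨A', hA, .inl ⟨hx, List.mem_cons_self⟩⟩
  · obtain ⟨B', hB, ⟨hne, hmem⟩ | ⟨rfl, rfl, hN₀⟩⟩ := h hy
    · exact ⟨B', hB, .inl ⟨hne, List.mem_cons_of_mem _ hmem⟩⟩
    · exact ⟨B', hB, .inr ⟨rfl, rfl, hN₀.weaken (List.subset_cons_self _ _)⟩⟩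

theorem LFSubstMap.single (hΔ : Δ.Lc) (hx : x₀ ∉ Δ.fv) (hA : A.toNrm.LcAt 0)
    (hxA : x₀ ∉ A.toNrm.fv) (h : CheckTy Sg Δ N₀ A) :
    LFSubstMap Sg N₀ x₀ A.simple ((x₀, A) :: Δ) Δ := by
  intro y B hy
  rcases List.mem_cons.1 hy with e | hy
  · cases e
    exact ⟨A, .of_notMem _ _ hA hxA, .inr ⟨rfl, rfl, h⟩⟩
  · obtain ⟨hyΔ, hB⟩ := LFCtx.mem_fv hy
    exact ⟨B, .of_notMem _ _ (hΔ hy) fun h => hx (hB h),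
      .inl ⟨ne_of_mem_of_not_mem hyΔ hx, hy⟩⟩

/-- The substitution property of `Γ ⊢ N ⇐ A` at the simple type `α`. -/
def CheckTySubst (Sg : Sig) (α : STy) : Prop :=
  ∀ ⦃N₀ x₀ Γ Δ N A A'⦄, N₀.LcAt 0 → LFCtx.Lc Δ → LFSubstMap Sg N₀ x₀ α Γ Δ →
    CheckTy Sg Γ N A → SubstA N₀ x₀ α A A' → ∃ N', SubstN N₀ x₀ α N N' ∧ CheckTy Sg Δ N' A'

theorem CheckTySubst.instantiate (hA : CheckTySubst Sg A.simple) (hΔ : Δ.Lc)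
    (hlc : A.toNrm.LcAt 0) {N N₁ : Nrm} {B M : Ty} {F : Finset Var}
    (h₁ : CheckTy Sg Δ (.lam N₁) (.pi A B)) (h : CheckTy Sg Δ N A)
    (hM : ∀ x, x ∉ F → SubstA N x A.simple (B.opn 0 x) M) :
    ∃ (M₁ : Nrm) (G : Finset Var),
      (∀ x, x ∉ G → SubstN N x A.simple (N₁.opn 0 x) M₁) ∧ CheckTy Sg Δ M₁ M := by
  cases h₁ with
  | lam F₁ h₁ =>
    obtain ⟨x, hx₁, hx₂, hx₃, hx₄⟩ :=
      exists_fresh₄ (F ∪ F₁) (Δ.fv ∪ A.toNrm.fv) N.fv N₁.fv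
    obtain ⟨hxF, hxF₁⟩ := Finset.notMem_union.1 hx₁
    obtain ⟨hxΔ, hxA⟩ := Finset.notMem_union.1 hx₂
    obtain ⟨M₁, hN₁, hM₁⟩ :=
      hA h.scoped.1 hΔ (.single hΔ hxΔ hlc hxA h) (h₁ x hxF₁) (hM x hxF)
    have hxM₁ : x ∉ M₁.fv := fun hm => hxΔ (LFCtx.names_subset_fv (hM₁.scoped.2 hm))
    refine ⟨M₁, N.fv ∪ N₁.fv ∪ M₁.fv, fun y hy => ?_, hM₁⟩
    simp only [Finset.notMem_union] at hy
    exact hN₁.change_var hx₃ hx₄ hxM₁ hy.1.1 hy.1.2 hy.2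

/-- In `Δ`, the result of `[N₀/x₀] R` has the type `[N₀/x₀] A`: it synthesizes this type if the head
of `R` is not `x₀`, and checks against it if the head is `x₀`. -/
def SubstSynthTy (Sg : Sig) (N₀ : Nrm) (x₀ : Var) (α₀ : STy) (Δ : LFCtx) (R : Atm) (A : Ty) :
    Prop :=
  ∃ A', SubstA N₀ x₀ α₀ A A' ∧
    ((∃ R', SubstRR N₀ x₀ α₀ R R' ∧ SynthTy Sg Δ R' A') ∨
      ∃ N', SubstRN N₀ x₀ α₀ R N' A.simple ∧ CheckTy Sg Δ N' A')

theorem SubstSynthTy.app {R : Atm} {N N' : Nrm} {B Br : Ty} {F : Finset Var}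
    (ih : ∀ β : STy, β.size < α₀.size → CheckTySubst Sg β) (h₀ : N₀.LcAt 0) (hΔ : Δ.Lc)
    (hR : SubstSynthTy Sg N₀ x₀ α₀ Δ R (.pi A B)) (hA : SubstA N₀ x₀ α₀ A A')
    (hN : SubstN N₀ x₀ α₀ N N') (hN' : CheckTy Sg Δ N' A')
    (hBr : ∀ x, x ∉ F → SubstA N x A.simple (B.opn 0 x) Br) :
    SubstSynthTy Sg N₀ x₀ α₀ Δ (.app R N) Br := by
  obtain ⟨_, hpi, hR⟩ := hR
  cases hpi with
  | pi F' hA' hB =>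
    cases hA'.det hA
    obtain ⟨M, G, hM, hG⟩ := SubstA.instantiate h₀ hN hBr hB
    rw [← hA.simple_eq] at hG
    refine ⟨M, hM, ?_⟩
    rcases hR with ⟨R', hR, hR'⟩ | ⟨_, hR, hR'⟩
    · exact .inl ⟨_, .app hR hN, .app _ hR' hN' hG⟩
    · have hsize : A'.simple.size < α₀.size := by
        have := hR.size_le
        simp only [hA.simple_eq, Ty.simple, STy.size] at this ⊢
        omega
      have hsimple : Br.simple = B.simple := by
        obtain ⟨x, hx⟩ := Infinite.exists_notMem_finset F
        simpa using (hBr x hx).simple_eq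
      cases hR' with
      | lam F₁ hN₁ =>
        obtain ⟨M₁, G', hbeta, hM₁⟩ :=
          (ih _ hsize).instantiate hΔ (hA.lc_output h₀) (.lam F₁ hN₁) hN' hG
        rw [Ty.simple, ← hsimple] at hR
        exact .inr ⟨M₁, .beta G' hR hN (hA.simple_eq ▸ hbeta), hM₁⟩

mutual
theorem SynthTy.subst_of_lt (hSg : Sg.Closed) (h₀ : N₀.LcAt 0)
    (ih : ∀ β : STy, β.size < α₀.size → CheckTySubst Sg β) : ∀ {Γ Δ R A},
    Δ.Lc → LFSubstMap Sg N₀ x₀ α₀ Γ Δ → SynthTy Sg Γ R A → SubstSynthTy Sg N₀ x₀ α₀ Δ R A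
  | _, _, _, _, _, _, .con h =>
      have hA : Nrm.Closed _ := hSg _ h
      ⟨_, .of_notMem _ _ hA.1 hA.notMem_fv, .inl ⟨_, .con, .con h⟩⟩
  | _, _, _, _, _, hm, .var h => by
      obtain ⟨A', hA, ⟨hne, h⟩ | ⟨rfl, rfl, h⟩⟩ := hm h
      · exact ⟨A', hA, .inl ⟨_, .var hne, .var h⟩⟩
      · exact ⟨A', hA, .inr ⟨_, .var, h⟩⟩
  | _, _, _, _, hΔ, hm, .app F h₁ h₂ h₃ => by
      have hR := SynthTy.subst_of_lt hSg h₀ ih hΔ hm h₁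
      have ⟨_, hpi, _⟩ := hR
      cases hpi with
      | pi F' hA _ =>
        obtain ⟨N', hN, hN'⟩ := CheckTy.subst_of_lt hSg h₀ ih hΔ hm h₂ hA
        exact .app ih h₀ hΔ hR hA hN hN' h₃
theorem CheckTy.subst_of_lt (hSg : Sg.Closed) (h₀ : N₀.LcAt 0)
    (ih : ∀ β : STy, β.size < α₀.size → CheckTySubst Sg β) : ∀ {Γ Δ N A A'},
    Δ.Lc → LFSubstMap Sg N₀ x₀ α₀ Γ Δ → CheckTy Sg Γ N A → SubstA N₀ x₀ α₀ A A' →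
    ∃ N', SubstN N₀ x₀ α₀ N N' ∧ CheckTy Sg Δ N' A'
  | _, _, _, _, _, hΔ, hm, @CheckTy.atm _ _ R P h, hA => by
      obtain ⟨A', hA', hR⟩ := SynthTy.subst_of_lt hSg h₀ ih hΔ hm h
      cases hA.det hA'
      cases hA with
      | atm hA =>
        rcases hR with ⟨R', hR, hR'⟩ | ⟨N', hR, hR'⟩
        · exact ⟨_, .atom hR, .atm hR'⟩
        · cases hR' with
          | atm hR' =>
            obtain ⟨a, ha⟩ := P.exists_simple_eq
            rw [Ty.simple, ha] at hR
            exact ⟨_, .atomNorm hR, .atm hR'⟩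
  | _, Δ, _, _, _, hΔ, hm, .lam (N := N) F h, hA => by
      cases hA with
      | @pi _ A' _ B' F' hA hB =>
        have hbody : ∀ y, y ∉ F ∪ F' ∪ {x₀} → ∃ N', SubstN N₀ x₀ α₀ (N.opn 0 y) N' ∧
            CheckTy Sg ((y, A') :: Δ) N' (B'.opn 0 y) := by
          intro y hy
          simp only [Finset.notMem_union, Finset.mem_singleton] at hy
          exact CheckTy.subst_of_lt hSg h₀ ih (hΔ.cons (hA.lc_output h₀)) (hm.cons hy.2 hA)
            (h y hy.1.1) (hB y hy.1.2)
        obtain ⟨N', hN, G, hN'⟩ := SubstN.exists_lam h₀ hbody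
        exact ⟨.lam N', hN, .lam G hN'⟩
end

theorem checkTySubst (hSg : Sg.Closed) (α : STy) : CheckTySubst Sg α := by
  induction hn : α.size using Nat.strong_induction_on generalizing α with
  | _ n ih =>
    subst hn
    intro N₀ x₀ Γ Δ N A A' h₀ hΔ hm h hA
    exact h.subst_of_lt hSg h₀ (fun β hβ => ih _ hβ β rfl) hΔ hm hA

theorem SynthKnd.subst (hSg : Sg.Closed) (h₀ : N₀.LcAt 0) (hΔ : Δ.Lc)
    (hm : LFSubstMap Sg N₀ x₀ α₀ Γ Δ) {P : ATy} {K : Knd} (h : SynthKnd Sg Γ P K) :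
    ∃ P' K', SubstP N₀ x₀ α₀ P P' ∧ SubstK N₀ x₀ α₀ K K' ∧ SynthKnd Sg Δ P' K' := by
  induction h with
  | con h =>
    have hK : Nrm.Closed _ := hSg _ h
    exact ⟨_, _, .con, .of_notMem _ _ hK.1 hK.notMem_fv, .con h⟩
  | app F _ h₂ h₃ ih =>
    obtain ⟨P', _, hP, hpi, hP'⟩ := ih
    cases hpi with
    | pi F' hA hK =>
      obtain ⟨N', hN, hN'⟩ := checkTySubst hSg α₀ h₀ hΔ hm h₂ hA
      obtain ⟨M, G, hM, hG⟩ := SubstK.instantiate h₀ hN h₃ hK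
      rw [← hA.simple_eq] at hG
      exact ⟨_, M, .app hP hN, hM, .app G hP' hN' hG⟩

theorem IsType.subst (hSg : Sg.Closed) (h₀ : N₀.LcAt 0) (hΔ : Δ.Lc)
    (hm : LFSubstMap Sg N₀ x₀ α₀ Γ Δ) (h : IsType Sg Γ A) :
    ∃ A', SubstA N₀ x₀ α₀ A A' ∧ IsType Sg Δ A' := by
  induction h generalizing Δ with
  | atm h =>
    obtain ⟨P', _, hP, hK, h⟩ := h.subst hSg h₀ hΔ hm
    cases hK
    exact ⟨_, .atm hP, .atm h⟩
  | @pi _ A B F _ _ ihA ihB =>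
    obtain ⟨A', hA, hA'⟩ := ihA hΔ hm
    have hbody : ∀ y, y ∉ F ∪ {x₀} → ∃ B', SubstA N₀ x₀ α₀ (B.opn 0 y) B' ∧
        IsType Sg ((y, A') :: Δ) B' := by
      intro y hy
      simp only [Finset.notMem_union, Finset.mem_singleton] at hy
      exact ihB y hy.1 (hΔ.cons hA'.scoped.1) (hm.cons hy.2 hA)
    obtain ⟨B', hB, G, hB'⟩ := SubstA.exists_pi h₀ hA hbody
    exact ⟨_, hB, .pi G hA' hB'⟩

end

/-! ## Substitution in sorting judgments -/

/-- The function sorts in `S` follow the arrows of the simple type. -/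
def Srt.Compat : Srt → STy → Prop
  | .atm _, _ => True
  | .pi _ _ _, .base _ => False
  | .pi S A T, .arr α β => A.simple = α ∧ S.Compat α ∧ T.Compat β
  | .top, _ => True
  | .inter S₁ S₂, α => S₁.Compat α ∧ S₂.Compat α

@[simp] theorem Srt.compat_opn {x : Var} {S : Srt} :
    ∀ {k α}, (S.opn k x).Compat α ↔ S.Compat α := by
  induction S with
  | atm | top => simp [Compat]
  | pi S A T ihS ihT => intro k α; cases α <;> simp [Compat, ihS, ihT]
  | inter S₁ S₂ ih₁ ih₂ => simp [Compat, ih₁, ih₂]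

theorem Refines.compat {Sg Γ S A} (h : Refines Sg Γ S A) : S.Compat A.simple := by
  induction h with
  | atm | top => trivial
  | pi F _ _ ihS ihT =>
    obtain ⟨x, hx⟩ := Infinite.exists_notMem_finset F
    exact ⟨rfl, ihS, by simpa using ihT x hx⟩
  | inter _ _ ih₁ ih₂ => exact ⟨ih₁, ih₂⟩

section
variable {Γ Δ : Ctx} {N₀ : Nrm} {x x₀ : Var} {α₀ : STy} {S S' : Srt} {A A' : Ty}

theorem SubstS.compat (h : SubstS N₀ x₀ α₀ S S') : ∀ {α}, S.Compat α → S'.Compat α := by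
  induction h with
  | atm | top => exact fun _ => trivial
  | pi F _ hA _ ihS ihT =>
    rintro (_ | ⟨α, β⟩) h
    · exact h
    · obtain ⟨x, hx⟩ := Infinite.exists_notMem_finset F
      exact ⟨hA.simple_eq.trans h.1, ihS h.2.1, by simpa [h.2.2] using ihT x hx (α := β)⟩
  | inter _ _ ih₁ ih₂ => exact fun h => ⟨ih₁ h.1, ih₂ h.2⟩

/-- The names that occur in a context, declared or in a sort or type. -/
@[simp] def Ctx.fv : Ctx → Finset Var
  | [] => ∅
  | (x, S, A) :: Γ => {x} ∪ S.toNrm.fv ∪ A.toNrm.fv ∪ Ctx.fv Γ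

theorem Ctx.mem_fv (h : (x, S, A) ∈ Γ) :
    x ∈ Γ.fv ∧ S.toNrm.fv ⊆ Γ.fv ∧ A.toNrm.fv ⊆ Γ.fv := by
  induction Γ with
  | nil => cases h
  | cons d Γ ih =>
    rcases List.mem_cons.1 h with rfl | h
    · exact ⟨by simp, fun v hv => by simp [hv], fun v hv => by simp [hv]⟩
    · exact ⟨by simp [(ih h).1], fun v hv => by simp [(ih h).2.1 hv],
        fun v hv => by simp [(ih h).2.2 hv]⟩

/-- All declared sorts and types are locally closed. -/
def Ctx.Lc (Γ : Ctx) : Prop := ∀ ⦃x S A⦄, (x, S, A) ∈ Γ → S.toNrm.LcAt 0 ∧ A.toNrm.LcAt 0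

theorem Ctx.Lc.cons (h : Γ.Lc) (hS : S.toNrm.LcAt 0) (hA : A.toNrm.LcAt 0) :
    Ctx.Lc ((x, S, A) :: Γ) := by
  intro y T B hy
  rcases List.mem_cons.1 hy with e | hy
  · cases e
    exact ⟨hS, hA⟩
  · exact h hy

/-- The substitution `[N₀/x₀]` sends the declarations of `Γ` to declarations of `Δ`, except those
of `x₀`, for which `N₀` is a well-sorted instance in `Δ`.  The name `x₀` may be declared in `Δ`. -/
def SubstMap (Sg : Sig) (N₀ : Nrm) (x₀ : Var) (α₀ : STy) (Γ Δ : Ctx) : Prop :=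
  ∀ ⦃y S A⦄, (y, S, A) ∈ Γ → ∃ S' A', SubstS N₀ x₀ α₀ S S' ∧ SubstA N₀ x₀ α₀ A A' ∧
    (y ≠ x₀ ∧ (y, S', A') ∈ Δ ∨ y = x₀ ∧ S.Compat α₀ ∧ Check Sg Δ N₀ S')

variable {Sg : Sig}

theorem SubstMap.cons (h : SubstMap Sg N₀ x₀ α₀ Γ Δ) (hx : x ≠ x₀)
    (hS : SubstS N₀ x₀ α₀ S S') (hA : SubstA N₀ x₀ α₀ A A') :
    SubstMap Sg N₀ x₀ α₀ ((x, S, A) :: Γ) ((x, S', A') :: Δ) := by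
  intro y T B hy
  rcases List.mem_cons.1 hy with e | hy
  · cases e
    exact ⟨S', A', hS, hA, .inl ⟨hx, List.mem_cons_self⟩⟩
  · obtain ⟨T', B', hT, hB, ⟨hne, hmem⟩ | ⟨rfl, hc, hN₀⟩⟩ := h hy
    · exact ⟨T', B', hT, hB, .inl ⟨hne, List.mem_cons_of_mem _ hmem⟩⟩
    · exact ⟨T', B', hT, hB, .inr ⟨rfl, hc, hN₀.weaken (List.subset_cons_self _ _)⟩⟩

theorem SubstMap.single (hΔ : Δ.Lc) (hx : x₀ ∉ Δ.fv) (hS : S.toNrm.LcAt 0)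
    (hxS : x₀ ∉ S.toNrm.fv) (hA : A.toNrm.LcAt 0) (hxA : x₀ ∉ A.toNrm.fv) (hc : S.Compat α₀)
    (h : Check Sg Δ N₀ S) : SubstMap Sg N₀ x₀ α₀ ((x₀, S, A) :: Δ) Δ := by
  intro y T B hy
  rcases List.mem_cons.1 hy with e | hy
  · cases e
    exact ⟨S, A, .of_notMem _ _ hS hxS, .of_notMem _ _ hA hxA, .inr ⟨rfl, hc, h⟩⟩
  · obtain ⟨hyΔ, hT, hB⟩ := Ctx.mem_fv hy
    exact ⟨T, B, .of_notMem _ _ (hΔ hy).1 fun h => hx (hT h),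
      .of_notMem _ _ (hΔ hy).2 fun h => hx (hB h), .inl ⟨ne_of_mem_of_not_mem hyΔ hx, hy⟩⟩

theorem Subsort.trans {Q₁ Q₂ Q₃ : ASrt} (h : Subsort Sg Q₁ Q₂) (h' : Subsort Sg Q₂ Q₃) :
    Subsort Sg Q₁ Q₃ := by
  induction h with
  | refl => exact h'
  | step h _ ih => exact .step h (ih h')

theorem SubDecl.subst {Q₁ Q₂ Q₁' : ASrt} (h : SubDecl Sg Q₁ Q₂)
    (h₁ : SubstQ N₀ x₀ α₀ Q₁ Q₁') : ∃ Q₂', SubstQ N₀ x₀ α₀ Q₂ Q₂' ∧ SubDecl Sg Q₁' Q₂' := by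
  induction h generalizing Q₁' with
  | con h =>
    cases h₁
    exact ⟨_, .con, .con h⟩
  | app _ ih =>
    cases h₁ with
    | app hQ hN =>
      obtain ⟨_, hQ', h⟩ := ih hQ
      exact ⟨_, .app hQ' hN, .app h⟩

theorem Subsort.subst {Q₁ Q₂ Q₁' Q₂' : ASrt} (h : Subsort Sg Q₁ Q₂)
    (h₁ : SubstQ N₀ x₀ α₀ Q₁ Q₁') (h₂ : SubstQ N₀ x₀ α₀ Q₂ Q₂') : Subsort Sg Q₁' Q₂' := by
  induction h generalizing Q₁' with
  | refl => exact h₁.det h₂ ▸ .refl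
  | step h _ ih =>
    obtain ⟨_, hr, h'⟩ := h.subst h₁
    exact .step h' (ih hr h₂)

/-- The substitution property of `Γ ⊢ N ⇐ S` at the simple type `α`.  The result of the substitution
into `N` is assumed to exist: sorting does not imply it, since every term has the sort `⊤`. -/
def CheckSubst (Sg : Sig) (α : STy) : Prop :=
  ∀ ⦃N₀ x₀ Γ Δ N N' S S'⦄, N₀.LcAt 0 → Ctx.Lc Δ → SubstMap Sg N₀ x₀ α Γ Δ →
    Check Sg Γ N S → SubstN N₀ x₀ α N N' → SubstS N₀ x₀ α S S' → Check Sg Δ N' S'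

theorem CheckSubst.instantiate (hA : CheckSubst Sg A.simple) (hΔ : Δ.Lc)
    (hSlc : S.toNrm.LcAt 0) (hAlc : A.toNrm.LcAt 0) (hc : S.Compat A.simple)
    {N N₁ M₁ : Nrm} {T M : Srt} {F F' : Finset Var} (hN : N.LcAt 0)
    (h₁ : Check Sg Δ (.lam N₁) (.pi S A T)) (h : Check Sg Δ N S)
    (hM₁ : ∀ x, x ∉ F → SubstN N x A.simple (N₁.opn 0 x) M₁)
    (hM : ∀ x, x ∉ F' → SubstS N x A.simple (T.opn 0 x) M) : Check Sg Δ M₁ M := by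
  cases h₁ with
  | lam F₁ h₁ =>
    obtain ⟨x, hx, hx', hx₁, hxΔ⟩ :=
      exists_fresh₄ F F' F₁ (Δ.fv ∪ S.toNrm.fv ∪ A.toNrm.fv)
    simp only [Finset.notMem_union] at hxΔ
    obtain ⟨⟨hxΔ, hxS⟩, hxA⟩ := hxΔ
    exact hA hN hΔ (.single hΔ hxΔ hSlc hxS hAlc hxA hc h) (h₁ x hx₁) (hM₁ x hx) (hM x hx')

/-- In `Δ`, whenever `[N₀/x₀] R` is defined it has the sort `[N₀/x₀] S`: it synthesizes this sort if
the head of `R` is not `x₀`, and checks against it if the head is `x₀`. -/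
structure SubstSynth (Sg : Sig) (N₀ : Nrm) (x₀ : Var) (α₀ : STy) (Δ : Ctx) (R : Atm)
    (S : Srt) : Prop where
  synth {R'} : SubstRR N₀ x₀ α₀ R R' → ∃ S', SubstS N₀ x₀ α₀ S S' ∧ Synth Sg Δ R' S'
  check {N' β} : SubstRN N₀ x₀ α₀ R N' β →
    ∃ S', SubstS N₀ x₀ α₀ S S' ∧ S.Compat β ∧ Check Sg Δ N' S'

theorem SubstSynth.interL {R : Atm} {S₁ S₂ : Srt}
    (h : SubstSynth Sg N₀ x₀ α₀ Δ R (.inter S₁ S₂)) : SubstSynth Sg N₀ x₀ α₀ Δ R S₁ where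
  synth hR := by
    obtain ⟨_, hS, hR'⟩ := h.synth hR
    cases hS with
    | inter hS _ => exact ⟨_, hS, .interL hR'⟩
  check hR := by
    obtain ⟨_, hS, hc, hN'⟩ := h.check hR
    cases hS with
    | inter hS _ => cases hN' with | inter hN' _ => exact ⟨_, hS, hc.1, hN'⟩

theorem SubstSynth.interR {R : Atm} {S₁ S₂ : Srt}
    (h : SubstSynth Sg N₀ x₀ α₀ Δ R (.inter S₁ S₂)) : SubstSynth Sg N₀ x₀ α₀ Δ R S₂ where
  synth hR := by
    obtain ⟨_, hS, hR'⟩ := h.synth hR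
    cases hS with
    | inter _ hS => exact ⟨_, hS, .interR hR'⟩
  check hR := by
    obtain ⟨_, hS, hc, hN'⟩ := h.check hR
    cases hS with
    | inter _ hS => cases hN' with | inter _ hN' => exact ⟨_, hS, hc.2, hN'⟩

theorem SubstSynth.app {R : Atm} {N : Nrm} {T Tr : Srt} {F : Finset Var}
    (ih : ∀ β : STy, β.size < α₀.size → CheckSubst Sg β) (h₀ : N₀.LcAt 0) (hΔ : Δ.Lc)
    (hR : SubstSynth Sg N₀ x₀ α₀ Δ R (.pi S A T))
    (hN : ∀ {N' S'}, SubstN N₀ x₀ α₀ N N' → SubstS N₀ x₀ α₀ S S' → Check Sg Δ N' S')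
    (hTr : ∀ x, x ∉ F → SubstS N x A.simple (T.opn 0 x) Tr) :
    SubstSynth Sg N₀ x₀ α₀ Δ (.app R N) Tr where
  synth h := by
    cases h with
    | app hRR hNN =>
      obtain ⟨_, hpi, hR'⟩ := hR.synth hRR
      cases hpi with
      | pi F' hS hA hT =>
        obtain ⟨M, G, hM, hG⟩ := SubstS.instantiate h₀ hNN hTr hT
        rw [← hA.simple_eq] at hG
        exact ⟨M, hM, .app G hR' (hN hNN hS) hG⟩
  check h := by
    cases h with
    | beta F₁ hRN hNN hbeta =>
      have hsize := hRN.size_le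
      simp only [STy.size] at hsize
      obtain ⟨_, hpi, ⟨rfl, hcS, hcT⟩, hR'⟩ := hR.check hRN
      cases hpi with
      | pi F' hS hA hT =>
        obtain ⟨M, G, hM, hG⟩ := SubstS.instantiate h₀ hNN hTr hT
        obtain ⟨x, hx⟩ := Infinite.exists_notMem_finset F
        refine ⟨M, hM, (hTr x hx).compat (Srt.compat_opn.2 hcT), ?_⟩
        rw [← hA.simple_eq] at hcS hbeta hG hsize
        exact (ih _ (by omega)).instantiate hΔ (hS.lc_output h₀) (hA.lc_output h₀)
          (hS.compat hcS) (hNN.lc_output h₀) hR' (hN hNN hS) hbeta hG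

mutual
theorem Synth.subst_of_lt (hSg : Sg.Closed) (h₀ : N₀.LcAt 0)
    (ih : ∀ β : STy, β.size < α₀.size → CheckSubst Sg β) : ∀ {Γ Δ R S},
    Δ.Lc → SubstMap Sg N₀ x₀ α₀ Γ Δ → Synth Sg Γ R S → SubstSynth Sg N₀ x₀ α₀ Δ R S
  | _, _, _, _, _, _, .con h =>
      have hS : Nrm.Closed _ := hSg _ h
      { synth := fun hR => by
          cases hR
          exact ⟨_, .of_notMem _ _ hS.1 hS.notMem_fv, .con h⟩
        check := nofun }
  | _, _, _, _, _, hm, .var h => by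
      obtain ⟨S', A', hS, -, ⟨hne, hmem⟩ | ⟨rfl, hN₀⟩⟩ := hm h
      · refine ⟨fun hR => ?_, fun hR => ?_⟩ <;> cases hR
        · exact ⟨S', hS, .var hmem⟩
        · exact absurd rfl hne
      · refine ⟨fun hR => ?_, fun hR => ?_⟩ <;> cases hR
        · contradiction
        · exact ⟨S', hS, hN₀⟩
  | _, _, _, _, hΔ, hm, .app _ h₁ h₂ h₃ =>
      .app ih h₀ hΔ (Synth.subst_of_lt hSg h₀ ih hΔ hm h₁)
        (fun hN hS => Check.subst_of_lt hSg h₀ ih hΔ hm h₂ hN hS) h₃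
  | _, _, _, _, hΔ, hm, .interL h => (Synth.subst_of_lt hSg h₀ ih hΔ hm h).interL
  | _, _, _, _, hΔ, hm, .interR h => (Synth.subst_of_lt hSg h₀ ih hΔ hm h).interR
theorem Check.subst_of_lt (hSg : Sg.Closed) (h₀ : N₀.LcAt 0)
    (ih : ∀ β : STy, β.size < α₀.size → CheckSubst Sg β) : ∀ {Γ Δ N N' S S'},
    Δ.Lc → SubstMap Sg N₀ x₀ α₀ Γ Δ → Check Sg Γ N S →
    SubstN N₀ x₀ α₀ N N' → SubstS N₀ x₀ α₀ S S' → Check Sg Δ N' S'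
  | _, _, _, _, _, _, hΔ, hm, .switch h hle, hN, hS => by
      have hR := Synth.subst_of_lt hSg h₀ ih hΔ hm h
      cases hS with
      | atm hQ =>
        cases hN with
        | atom hRR =>
          obtain ⟨_, hS, h⟩ := hR.synth hRR
          cases hS with
          | atm hQ' => exact .switch h (hle.subst hQ' hQ)
        | atomNorm hRN =>
          obtain ⟨_, hS, -, h⟩ := hR.check hRN
          cases hS with
          | atm hQ' =>
            cases h with
            | switch h hle' => exact .switch h (hle'.trans (hle.subst hQ' hQ))
  | _, _, _, _, _, _, hΔ, hm, .lam F h, hN, hS => by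
      cases hS with
      | pi F₁ hS hA hT =>
        cases hN with
        | lam F₂ hN =>
          refine .lam (F ∪ F₁ ∪ F₂ ∪ {x₀}) fun y hy => ?_
          simp only [Finset.notMem_union, Finset.mem_singleton] at hy
          obtain ⟨⟨⟨hyF, hyF₁⟩, hyF₂⟩, hyx₀⟩ := hy
          exact Check.subst_of_lt hSg h₀ ih (hΔ.cons (hS.lc_output h₀) (hA.lc_output h₀))
            (hm.cons hyx₀ hS hA) (h y hyF) (hN y hyF₂) (hT y hyF₁)
  | _, _, _, _, _, _, _, _, .top, _, hS => by
      cases hS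
      exact .top
  | _, _, _, _, _, _, hΔ, hm, .inter h₁ h₂, hN, hS => by
      cases hS with
      | inter hS₁ hS₂ =>
        exact .inter (Check.subst_of_lt hSg h₀ ih hΔ hm h₁ hN hS₁)
          (Check.subst_of_lt hSg h₀ ih hΔ hm h₂ hN hS₂)
end

theorem checkSubst (hSg : Sg.Closed) (α : STy) : CheckSubst Sg α := by
  induction hn : α.size using Nat.strong_induction_on generalizing α with
  | _ n ih =>
    subst hn
    intro N₀ x₀ Γ Δ N N' S S' h₀ hΔ hm h hN hS
    exact h.subst_of_lt hSg h₀ (fun β hβ => ih _ hβ β rfl) hΔ hm hN hS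

theorem SynthCls.subst (hSg : Sg.Closed) (h₀ : N₀.LcAt 0) (hΔ : Δ.Lc)
    (hm : SubstMap Sg N₀ x₀ α₀ Γ Δ) {Q : ASrt} {P P' : ATy} {L : Cls}
    (h : SynthCls Sg Γ Q P L) (hP : SubstP N₀ x₀ α₀ P P') :
    ∃ Q' L', SubstQ N₀ x₀ α₀ Q Q' ∧ SubstL N₀ x₀ α₀ L L' ∧ SynthCls Sg Δ Q' P' L' := by
  induction h generalizing P' with
  | con h =>
    have hL : Nrm.Closed _ := hSg _ h
    cases hP
    exact ⟨_, _, .con, .of_notMem _ _ hL.1 hL.notMem_fv, .con h⟩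
  | app F _ h₂ h₃ ih =>
    cases hP with
    | app hP hN =>
      obtain ⟨Q', _, hQ, hpi, hQ'⟩ := ih hP
      cases hpi with
      | pi F' hS hA hL =>
        obtain ⟨M, G, hM, hG⟩ := SubstL.instantiate h₀ hN h₃ hL
        rw [← hA.simple_eq] at hG
        exact ⟨_, M, .app hQ hN, hM, .app G hQ' (checkSubst hSg α₀ h₀ hΔ hm h₂ hN hS) hG⟩
  | interL _ ih =>
    obtain ⟨Q', _, hQ, hL, h⟩ := ih hP
    cases hL with
    | inter hL _ => exact ⟨_, _, hQ, hL, .interL h⟩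
  | interR _ ih =>
    obtain ⟨Q', _, hQ, hL, h⟩ := ih hP
    cases hL with
    | inter _ hL => exact ⟨_, _, hQ, hL, .interR h⟩

theorem Refines.subst (hSg : Sg.Closed) (h₀ : N₀.LcAt 0) (hΔ : Δ.Lc)
    (hm : SubstMap Sg N₀ x₀ α₀ Γ Δ) (h : Refines Sg Γ S A) (hA : SubstA N₀ x₀ α₀ A A') :
    ∃ S', SubstS N₀ x₀ α₀ S S' ∧ Refines Sg Δ S' A' := by
  induction h generalizing Δ A' with
  | atm h =>
    cases hA with
    | atm hP =>
      obtain ⟨_, _, hQ, hL, h⟩ := h.subst hSg h₀ hΔ hm hP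
      cases hL
      exact ⟨_, .atm hQ, .atm h⟩
  | @pi _ S A T B F _ _ ihS ihT =>
    cases hA with
    | @pi _ A' _ B' F' hA hB =>
      obtain ⟨S', hS, hS'⟩ := ihS hΔ hm hA
      have hbody : ∀ y, y ∉ F ∪ F' ∪ {x₀} → ∃ T', SubstS N₀ x₀ α₀ (T.opn 0 y) T' ∧
          Refines Sg ((y, S', A') :: Δ) T' (B'.opn 0 y) := by
        intro y hy
        simp only [Finset.notMem_union, Finset.mem_singleton] at hy
        exact ihT y hy.1.1 (hΔ.cons (hS.lc_output h₀) (hA.lc_output h₀)) (hm.cons hy.2 hS hA)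
          (hB y hy.1.2)
      obtain ⟨T', hT, G, hT'⟩ := SubstS.exists_pi h₀ hS hA hbody
      exact ⟨_, hT, .pi G hS' hT'⟩
  | top => exact ⟨_, .top, .top⟩
  | inter _ _ ih₁ ih₂ =>
    obtain ⟨_, h₁, h₁'⟩ := ih₁ hΔ hm hA
    obtain ⟨_, h₂, h₂'⟩ := ih₂ hΔ hm hA
    exact ⟨_, .inter h₁ h₂, .inter h₁' h₂'⟩

end

/-! ## η-expansion preserves types and sorts -/

section
variable {Sg : Sig} {Γ : Ctx} {Δ : LFCtx} {x : Var} {A B : Ty} {S T : Srt}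

theorem IsType.substA_expand (hSg : Sg.Closed) (hΔ : Δ.Lc) (h : IsType Sg Δ (.pi A B))
    (hx : CheckTy Sg ((x, A) :: Δ) (expand A.simple (.fvar x)) A) :
    ∃ F : Finset Var, ∀ z, z ∉ F →
      SubstA (expand A.simple (.fvar x)) z A.simple (B.opn 0 z) (B.opn 0 x) := by
  cases h with
  | pi F hA hB =>
    refine ⟨F ∪ LFCtx.fv ((x, A) :: Δ) ∪ A.toNrm.fv ∪ B.toNrm.fv, fun z hz => ?_⟩
    simp only [Finset.notMem_union] at hz
    obtain ⟨⟨⟨hzF, hzΔ⟩, hzA⟩, hzB⟩ := hz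
    have hxΔ := hΔ.cons (x := x) hA.scoped.1
    have hB' := (hB z hzF).weaken (List.cons_subset_cons _ (List.subset_cons_self (x, A) Δ))
    obtain ⟨B', hs, -⟩ := hB'.subst hSg (lcAt_expand (R := .fvar x) _ trivial) hxΔ
      (.single hxΔ hzΔ hA.scoped.1 hzA hx)
    rwa [hs.eq_opn hzB] at hs

theorem SynthTy.expand (hSg : Sg.Closed) : ∀ {A Δ R}, LFCtx.Lc Δ → IsType Sg Δ A →
    SynthTy Sg Δ R A → CheckTy Sg Δ (expand A.simple R) A
  | .atm P, _, _, _, _, h => by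
      obtain ⟨a, ha⟩ := P.exists_simple_eq
      rw [Ty.simple, ha]
      exact .atm h
  | .pi A B, Δ, R, hΔ, hpi, h => by
      have ⟨F, hA, hB⟩ : ∃ F : Finset Var, IsType Sg Δ A ∧
          ∀ x, x ∉ F → IsType Sg ((x, A) :: Δ) (B.opn 0 x) := by
        cases hpi with
        | pi F hA hB => exact ⟨F, hA, hB⟩
      refine .lam F fun x hx => ?_
      rw [expand_body_opn h.scoped.1]
      have hs : Δ ⊆ (x, A) :: Δ := List.subset_cons_self _ _
      have hxΔ := hΔ.cons (x := x) hA.scoped.1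
      have hη := SynthTy.expand hSg hxΔ (hA.weaken hs) (.var List.mem_cons_self)
      obtain ⟨F', hF'⟩ := hpi.substA_expand hSg hΔ hη
      have hbody := SynthTy.expand hSg hxΔ (hB x hx) (.app F' (h.weaken hs) hη hF')
      rwa [Ty.simple_opn] at hbody
termination_by A => A.toNrm.size
decreasing_by
  all_goals
    simp only [Ty.toNrm_opn, Ty.toNrm, Nrm.size, Atm.size, Nrm.size_opn]
    omega

theorem Ctx.Lc.erase (h : Γ.Lc) : Γ.erase.Lc := by
  intro x A hx
  obtain ⟨⟨y, S, B⟩, hm, e⟩ := List.mem_map.1 hx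
  cases e
  exact (h hm).2

theorem Refines.substS_expand (hSg : Sg.Closed) (hΓ : Γ.Lc) (hA : IsType Sg Γ.erase (.pi A B))
    (h : Refines Sg Γ (.pi S A T) (.pi A B))
    (hxA : CheckTy Sg ((x, A) :: Γ.erase) (expand A.simple (.fvar x)) A)
    (hxS : Check Sg ((x, S, A) :: Γ) (expand A.simple (.fvar x)) S) :
    ∃ F : Finset Var, ∀ z, z ∉ F →
      SubstS (expand A.simple (.fvar x)) z A.simple (T.opn 0 z) (T.opn 0 x) := by
  obtain ⟨F₁, hF₁⟩ := hA.substA_expand hSg hΓ.erase hxA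
  cases hA with
  | pi _ hA _ =>
    cases h with
    | pi F hS hT =>
      refine ⟨F ∪ F₁ ∪ Ctx.fv ((x, S, A) :: Γ) ∪ S.toNrm.fv ∪ A.toNrm.fv ∪ T.toNrm.fv,
        fun z hz => ?_⟩
      simp only [Finset.notMem_union] at hz
      obtain ⟨⟨⟨⟨⟨hzF, hzF₁⟩, hzΓ⟩, hzS⟩, hzA⟩, hzT⟩ := hz
      have hSlc := hS.scoped.1 hA.scoped.1
      have hxΓ := hΓ.cons (x := x) hSlc hA.scoped.1
      have hT' := (hT z hzF).weaken
        (List.cons_subset_cons _ (List.subset_cons_self (x, S, A) Γ))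
      obtain ⟨T', hs, -⟩ := hT'.subst hSg (lcAt_expand (R := .fvar x) _ trivial) hxΓ
        (.single hxΓ hzΓ hSlc hzS hA.scoped.1 hzA hS.compat hxS) (hF₁ z hzF₁)
      rwa [hs.eq_opn hzT] at hs

theorem Synth.expand (hSg : Sg.Closed) : ∀ {S Γ R A}, Ctx.Lc Γ → RefinesTy Sg Γ S A →
    R.LcAt 0 → Synth Sg Γ R S → Check Sg Γ (expand A.simple R) S
  | .atm _, _, _, _, _, ⟨_, .atm (P := P) _⟩, _, h => by
      obtain ⟨a, ha⟩ := P.exists_simple_eq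
      rw [Ty.simple, ha]
      exact .switch h .refl
  | .top, _, _, _, _, _, _, _ => .top
  | .inter _ _, _, _, _, hΓ, ⟨hA, .inter hr₁ hr₂⟩, hR, h =>
      .inter (Synth.expand hSg hΓ ⟨hA, hr₁⟩ hR (.interL h))
        (Synth.expand hSg hΓ ⟨hA, hr₂⟩ hR (.interR h))
  | .pi S A T, Γ, R, _, hΓ, ⟨.pi (B := B) F' hA hB, .pi F hS hT⟩, hR, h => by
      refine .lam (F ∪ F') fun x hx => ?_
      obtain ⟨hxF, hxF'⟩ := Finset.notMem_union.1 hx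
      rw [expand_body_opn hR]
      have hs : Γ ⊆ (x, S, A) :: Γ := List.subset_cons_self _ _
      have hSA : RefinesTy Sg ((x, S, A) :: Γ) S A := RefinesTy.weaken ⟨hA, hS⟩ hs
      have hxΓ := hΓ.cons (x := x) (hS.scoped.1 hA.scoped.1) hA.scoped.1
      have hηA := SynthTy.expand hSg hxΓ.erase hSA.1 (.var List.mem_cons_self)
      have hη := Synth.expand hSg hxΓ hSA (R := .fvar x) trivial (.var List.mem_cons_self)
      obtain ⟨F₁, hF₁⟩ := Refines.substS_expand hSg hΓ (.pi F' hA hB) (.pi F hS hT) hηA hη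
      have hRη : (Atm.app R (LFR.expand A.simple (.fvar x))).LcAt 0 :=
        ⟨hR, lcAt_expand _ trivial⟩
      have hbody := Synth.expand hSg hxΓ ⟨hB x hxF', hT x hxF⟩ hRη
        (.app F₁ (h.weaken hs) hη hF₁)
      rwa [Ty.simple_opn] at hbody
termination_by S => S.toNrm.size
decreasing_by
  all_goals
    simp only [Srt.toNrm_opn, Srt.toNrm, Nrm.size, Atm.size, Nrm.size_opn]
    omega

/-! ## Well-formed contexts -/

theorem WfCtx.refinesTy (h : WfCtx Sg Γ) (hx : (x, S, A) ∈ Γ) : RefinesTy Sg Γ S A := by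
  induction h with
  | nil => cases hx
  | cons _ _ hr ih =>
    rcases List.mem_cons.1 hx with e | hx
    · cases e
      exact hr.weaken (List.subset_cons_self _ _)
    · exact (ih hx).weaken (List.subset_cons_self _ _)

theorem WfCtx.lc (h : WfCtx Sg Γ) : Γ.Lc := fun _ _ _ hx => (h.refinesTy hx).lcAt

theorem WfCtx.notMem_dom_of_append {ΓL ΓR : Ctx} (h : WfCtx Sg (ΓR ++ (x, S, A) :: ΓL)) :
    x ∉ ΓL.dom := by
  induction ΓR with
  | nil => cases h with | cons _ hx _ => exact hx
  | cons _ _ ih => cases h with | cons h _ _ => exact ih h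

theorem Ctx.exists_notMem_dom (Γ : Ctx) : ∃ x, x ∉ Γ.dom := by
  obtain ⟨x, hx⟩ := Infinite.exists_notMem_finset Γ.dom.toFinset
  exact ⟨x, by simpa using hx⟩

theorem SynthAt.expand (hSg : Sg.Closed) {R} (h : SynthAt Sg Γ R S A) :
    CheckAt Sg Γ (expand A.simple R) S A where
  ctx := h.ctx
  refines := h.refines
  typed := h.typed.expand hSg h.ctx.lc.erase h.refines.1
  sorted := h.sorted.expand hSg h.ctx.lc h.refines h.typed.scoped.1

theorem SynthAt.fvar (h : WfCtx Sg Γ) (hx : x ∉ Γ.dom) (hr : RefinesTy Sg Γ S A) :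
    SynthAt Sg ((x, S, A) :: Γ) (.fvar x) S A where
  ctx := h.cons hx hr
  refines := hr.weaken (List.subset_cons_self _ _)
  typed := .var List.mem_cons_self
  sorted := .var List.mem_cons_self

end

/-! ## The substitution theorem -/

section
variable {Sg : Sig} {N N₀ N₁ : Nrm} {x x₀ : Var} {α₀ : STy} {A B : Ty} {S S₁ S₂ T : Srt}
  {Γ ΓL ΓR Δ : Ctx}

theorem RefinesTy.subst_of_notMem (h : RefinesTy Sg Γ S A) (hx : x ∉ Γ.dom) (N : Nrm) (α : STy) :
    SubstS N x α S S ∧ SubstA N x α A A :=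
  ⟨.of_notMem _ _ h.lcAt.1 (h.notMem_fv hx).1, .of_notMem _ _ h.lcAt.2 (h.notMem_fv hx).2⟩

theorem SubstMap.head (hL : WfCtx Sg ΓL) (hx : x ∉ ΓL.dom) (hr : RefinesTy Sg ΓL S A)
    (hs : ΓL ⊆ Δ) (hN₁ : CheckAt Sg Δ N₁ S A) :
    LFSubstMap Sg N₁ x A.simple (Ctx.erase ((x, S, A) :: ΓL)) Δ.erase ∧
      SubstMap Sg N₁ x A.simple ((x, S, A) :: ΓL) Δ := by
  have vacuous {T B} (h : RefinesTy Sg ΓL T B) := h.subst_of_notMem hx N₁ A.simple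
  have ne_head {y T B} (hy : (y, T, B) ∈ ΓL) : y ≠ x := by
    rintro rfl
    exact hx (List.mem_map.2 ⟨_, hy, rfl⟩)
  constructor
  · intro y B hy
    obtain ⟨⟨y, T, B⟩, hm, e⟩ := List.mem_map.1 hy
    cases e
    rcases List.mem_cons.1 hm with e | hm
    · cases e
      exact ⟨A, (vacuous hr).2, .inr ⟨rfl, rfl, hN₁.typed⟩⟩
    · exact ⟨B, (vacuous (hL.refinesTy hm)).2,
        .inl ⟨ne_head hm, List.mem_map.2 ⟨(y, T, B), hs hm, rfl⟩⟩⟩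
  · intro y T B hm
    rcases List.mem_cons.1 hm with e | hm
    · cases e
      exact ⟨S, A, (vacuous hr).1, (vacuous hr).2, .inr ⟨rfl, hr.2.compat, hN₁.sorted⟩⟩
    · have hTB := vacuous (hL.refinesTy hm)
      exact ⟨T, B, hTB.1, hTB.2, .inl ⟨ne_head hm, hs hm⟩⟩

theorem RefinesTy.subst (hSg : Sg.Closed) (h₀ : N₀.LcAt 0) (hΔ : Δ.Lc)
    (hm : LFSubstMap Sg N₀ x₀ α₀ Γ.erase Δ.erase) (hm' : SubstMap Sg N₀ x₀ α₀ Γ Δ)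
    (h : RefinesTy Sg Γ S A) :
    ∃ S' A', SubstS N₀ x₀ α₀ S S' ∧ SubstA N₀ x₀ α₀ A A' ∧ RefinesTy Sg Δ S' A' := by
  obtain ⟨A', hA, hA'⟩ := h.1.subst hSg h₀ hΔ.erase hm
  obtain ⟨S', hS, hS'⟩ := h.2.subst hSg h₀ hΔ hm' hA
  exact ⟨S', A', hS, hA, hA', hS'⟩

theorem Ctx.dom_append : Ctx.dom (Γ ++ Δ) = Γ.dom ++ Δ.dom := List.map_append

theorem SubstCtx.dom_eq {Γ'} (h : SubstCtx N₀ x₀ α₀ Γ Γ') : Γ'.dom = Γ.dom := by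
  induction h with
  | nil => rfl
  | cons _ _ _ ih => exact congrArg (_ :: ·) ih

theorem WfCtx.subst (hSg : Sg.Closed) (hs : ΓL ⊆ Δ) (hd : Δ.dom ⊆ x :: ΓL.dom)
    (hN₁ : CheckAt Sg Δ N₁ S A) : ∀ {ΓR : Ctx}, WfCtx Sg (ΓR ++ (x, S, A) :: ΓL) →
    ∃ ΓR', SubstCtx N₁ x A.simple ΓR ΓR' ∧ WfCtx Sg (ΓR' ++ Δ) ∧
      LFSubstMap Sg N₁ x A.simple (Ctx.erase (ΓR ++ (x, S, A) :: ΓL)) (Ctx.erase (ΓR' ++ Δ)) ∧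
      SubstMap Sg N₁ x A.simple (ΓR ++ (x, S, A) :: ΓL) (ΓR' ++ Δ)
  | [], .cons hL hx hr => ⟨[], .nil, hN₁.ctx, SubstMap.head hL hx hr hs hN₁⟩
  | (y, T, B) :: ΓR, .cons h hy hr => by
      obtain ⟨ΓR', hc, hwf, hm, hm'⟩ := WfCtx.subst hSg hs hd hN₁ h
      obtain ⟨T', B', hT, hB, hr'⟩ := hr.subst hSg hN₁.typed.scoped.1 hwf.lc hm hm'
      have hy : y ∉ Ctx.dom (ΓR ++ (x, S, A) :: ΓL) := hy
      rw [Ctx.dom_append, List.mem_append, not_or] at hy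
      have hyx : y ≠ x := List.ne_of_not_mem_cons hy.2
      have hy' : y ∉ Ctx.dom (ΓR' ++ Δ) := by
        rw [Ctx.dom_append, List.mem_append, not_or, hc.dom_eq]
        exact ⟨hy.1, fun hm => hy.2 (hd hm)⟩
      exact ⟨(y, T', B') :: ΓR', .cons hc hT hB, hwf.cons hy' hr', hm.cons hyx hB,
        hm'.cons hyx hT hB⟩

/-- The target context `Δ` may redeclare `x`, so that substitution of `η_A(x)` for `x` itself is an
instance. -/
theorem CheckAt.subst (hSg : Sg.Closed) (hs : ΓL ⊆ Δ) (hd : Δ.dom ⊆ x :: ΓL.dom)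
    (hN₁ : CheckAt Sg Δ N₁ S A) (h : CheckAt Sg (ΓR ++ (x, S, A) :: ΓL) N T B) :
    ∃ (ΓR' : Ctx) (N' : Nrm) (T' : Srt) (B' : Ty),
      SubstCtx N₁ x A.simple ΓR ΓR' ∧ SubstN N₁ x A.simple N N' ∧
      SubstS N₁ x A.simple T T' ∧ SubstA N₁ x A.simple B B' ∧
      CheckAt Sg (ΓR' ++ Δ) N' T' B' := by
  obtain ⟨ΓR', hc, hwf, hm, hm'⟩ := h.ctx.subst hSg hs hd hN₁
  have h₁ := hN₁.typed.scoped.1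
  obtain ⟨T', B', hT, hB, hr⟩ := h.refines.subst hSg h₁ hwf.lc hm hm'
  obtain ⟨N', hN, hN'⟩ := checkTySubst hSg _ h₁ hwf.lc.erase hm h.typed hB
  exact ⟨ΓR', N', T', B', hc, hN, hT, hB, hwf, hr, hN',
    checkSubst hSg _ h₁ hwf.lc hm' h.sorted hN hT⟩

theorem SubstCtx.eq_of_self {α Γ'} (h : SubstCtx (expand α (.fvar x)) x α Γ Γ') : Γ' = Γ := by
  induction h with
  | nil => rfl
  | cons _ hS hA ih => rw [ih, hS.eq_of_self, hA.eq_of_self]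

/-! ## The formulations of subsorting -/

theorem BothRefine.cons_left (h : BothRefine Sg Γ S₁ S₂ A) (hx : x ∉ Γ.dom) :
    BothRefine Sg ((x, S₁, A) :: Γ) S₁ S₂ A where
  ctx := h.ctx.cons hx h.left
  left := h.left.weaken (List.subset_cons_self _ _)
  right := h.right.weaken (List.subset_cons_self _ _)

theorem SubExpansion.subIdentity (h : SubExpansion Sg A S₁ S₂) : SubIdentity Sg A S₁ S₂ :=
  fun _ _ hb hx => h _ _ (hb.cons_left hx) (.fvar hb.ctx hx hb.left)

theorem SubSubsumption.subExpansion (hSg : Sg.Closed) (h : SubSubsumption Sg A S₁ S₂) :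
    SubExpansion Sg A S₁ S₂ :=
  fun _ _ hb hR => h _ _ hb (hR.expand hSg)

theorem SubSubsumption.subSubstitution (hSg : Sg.Closed) (h : SubSubsumption Sg A S₁ S₂) :
    SubSubstitution Sg A S₁ S₂ :=
  fun ΓL _ x _ _ _ _ hb hN hN₁ =>
    CheckAt.subst hSg (List.Subset.refl ΓL) (List.subset_cons_self x _) (h _ _ hb hN₁) hN

theorem SubSubsumption.subNarrowing (hSg : Sg.Closed) (h : SubSubsumption Sg A S₁ S₂) :
    SubNarrowing Sg A S₁ S₂ := by
  intro ΓL ΓR x N S B hb hN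
  have hx := hN.ctx.notMem_dom_of_append
  have hη := h _ _ (hb.cons_left hx) ((SynthAt.fvar hb.ctx hx hb.left).expand hSg)
  obtain ⟨_, _, _, _, hΓR, hN, hS, hB, h'⟩ :=
    CheckAt.subst hSg (List.subset_cons_self _ _) (List.Subset.refl _) hη hN
  cases hΓR.eq_of_self
  cases hN.eq_of_self
  cases hS.eq_of_self
  cases hB.eq_of_self
  exact h'

theorem SubNarrowing.subIdentity (hSg : Sg.Closed) (h : SubNarrowing Sg A S₁ S₂) :
    SubIdentity Sg A S₁ S₂ :=
  fun Γ x hb hx => h Γ [] x _ _ _ hb ((SynthAt.fvar hb.ctx hx hb.right).expand hSg)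

theorem CheckAt.of_subst_expand (hr : RefinesTy Sg Γ S A) (hx : x ∉ Γ.dom)
    (h : ∃ (ΓR : Ctx) (N' : Nrm) (S' : Srt) (A' : Ty),
      SubstCtx N x A.simple [] ΓR ∧ SubstN N x A.simple (expand A.simple (.fvar x)) N' ∧
      SubstS N x A.simple S S' ∧ SubstA N x A.simple A A' ∧ CheckAt Sg (ΓR ++ Γ) N' S' A') :
    CheckAt Sg Γ N S A := by
  obtain ⟨_, _, _, _, hΓR, hN, hS, hA, h⟩ := h
  obtain ⟨hS', hA'⟩ := hr.subst_of_notMem hx N A.simple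
  cases hΓR
  cases hN.eq_of_expand_fvar
  cases hS.det hS'
  cases hA.det hA'
  exact h

theorem SubIdentity.subSubsumption (hSg : Sg.Closed) (h : SubIdentity Sg A S₁ S₂) :
    SubSubsumption Sg A S₁ S₂ := by
  intro Γ N hb hN
  obtain ⟨x, hx⟩ := Γ.exists_notMem_dom
  exact .of_subst_expand hb.right hx <|
    CheckAt.subst hSg (List.Subset.refl Γ) (List.subset_cons_self x _) hN (h Γ x hb hx)

theorem SubSubstitution.subSubsumption (hSg : Sg.Closed) (h : SubSubstitution Sg A S₁ S₂) :
    SubSubsumption Sg A S₁ S₂ := by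
  intro Γ N hb hN
  obtain ⟨x, hx⟩ := Γ.exists_notMem_dom
  have hη := (SynthAt.fvar hb.ctx hx hb.right).expand hSg
  exact .of_subst_expand hb.right hx (h Γ [] x _ _ _ N hb hη hN)

end

end LFR

theorem mainTheorem4_general (Sg : LFR.Sig) (hSg : Sg.Closed) (A : LFR.Ty) (S₁ S₂ : LFR.Srt) :
    List.TFAE [
      LFR.SubExpansion Sg A S₁ S₂,
      LFR.SubIdentity Sg A S₁ S₂,
      LFR.SubSubsumption Sg A S₁ S₂,
      LFR.SubNarrowing Sg A S₁ S₂,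
      LFR.SubSubstitution Sg A S₁ S₂] := by
  tfae_have 1 → 2 := LFR.SubExpansion.subIdentity
  tfae_have 2 → 3 := LFR.SubIdentity.subSubsumption hSg
  tfae_have 3 → 1 := LFR.SubSubsumption.subExpansion hSg
  tfae_have 3 → 4 := LFR.SubSubsumption.subNarrowing hSg
  tfae_have 4 → 2 := LFR.SubNarrowing.subIdentity hSg
  tfae_have 3 → 5 := LFR.SubSubsumption.subSubstitution hSg
  tfae_have 5 → 3 := LFR.SubSubstitution.subSubsumption hSg
  tfae_finish

theorem mainTheorem4 (Sg : LFR.Sig) (hSg : LFR.WfSig Sg)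
    (A : LFR.Ty) (S₁ S₂ : LFR.Srt)
    (h₀ : ∃ Γ₀ : LFR.Ctx, LFR.BothRefine Sg Γ₀ S₁ S₂ A) :
    List.TFAE [
      LFR.SubExpansion Sg A S₁ S₂,
      LFR.SubIdentity Sg A S₁ S₂,
      LFR.SubSubsumption Sg A S₁ S₂,
      LFR.SubNarrowing Sg A S₁ S₂,
      LFR.SubSubstitution Sg A S₁ S₂] :=
  mainTheorem4_general Sg hSg.closed A S₁ S₂
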